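/- **Market.** Fix $N\ge 1$, $0\le l<u$ and $\eta>0$. Let $\mathcal F^\eta$ be the set of probability distributions $F$ on $[l,u]$ having a density $f$ that is continuous and strictly positive on $[l,u]$, satisfies $|f(p)-f(p')|\le\eta|p-p'|$ for $p,p'\in[l,u]$, and whose hazard rate $f/(1-F)$ is increasing on $[l,u)$. Let $b^*(F)=\arg\max_p p(1-F(p))$ and $q^*(F)=1-F(b^*(F))$. In every period $t=1,2,\dots$ there are $N$ buyers with independent valuations $v_{i,t}\sim F_i$, independent over time, where $F=\frac1N\sum_iF_i$; at price $p$ the quantity sold is $\frac1N\#\{i: v_{i,t}\ge p\}$. **Algorithm $\mathcal A_a$.** The parameters are a gain $a>0$, a noise width $\epsilon>0$, a compact set $\mathsf B\subset(0,\infty)\times(-\infty,0)$ containing $\bigl(2q^*(F),-q^*(F)/b^*(F)\bigr)$ for all $F\in\mathcal F^\eta$, a compact convex set $\mathcal B\subset(0,\infty)\times(-\infty,0)$ containing $\mathsf B$ in its interior, and a point $\hat\beta$ in the interior of $\mathsf B$. Starting from $\beta_0\in\mathsf B$, and writing $\beta_{t-1}=(\beta_{0,t-1},\beta_{1,t-1})$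 and $b_t=-\beta_{0,t-1}/(2\beta_{1,t-1})$, in period $t$ the price is $p_t=b_t+\epsilon_{1,t}$, where the $\epsilon_{1,t}$ are i.i.d. uniform on $[-\epsilon,\epsilon]$ (variance $\sigma_1^2=\epsilon^2/3$) and independent of the valuations; the quantity $q_t$ at price $p_t$ is observed, and $$\beta_t=\beta_{t-1}+a\begin{pmatrix}1&b_t\\ b_t&b_t^2+\sigma_1^2\end{pmatrix}^{-1}\begin{pmatrix}1\\p_t\end{pmatrix}\bigl(q_t-\beta_{0,t-1}-\beta_{1,t-1}p_t\bigr)$$ if the right-hand side lies in $\mathcal B$, and $\beta_t=\hat\beta$ otherwise. The forecast $\varphi(\beta_t)$ after $t$ periods is the price $b_{t+1}$ together with a quantity, which is either the mean quantity $\beta_{0,t}+\beta_{1,t}b_{t+1}=\beta_{0,t}/2$ predicted by the linear model, or the true mean quantity $1-F(b_{t+1}+\epsilon_{1,t+1})$ at the price charged next. All claims below hold for both choices. $|\cdot|$ is the Euclidean norm. **Theorem.** For every $F\in\mathcal F^\eta$ the maximizer $b^*(F)$ exists and is unique. Moreover $\mathsf B$, $\mathcal B$, $\hat\beta$ can be chosen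 such that the following hold. 1. For every $\mu>0$ there are a noise width $\epsilon(\mu)>0$ and $\tau(\mu)>0$, $\rho(\mu)>0$, $\bar a(\mu)>0$ such that for all $a\in(0,\bar a(\mu))$, with $T=\lceil\tau(\mu)/a\rceil$, $$\mathbb P\bigl(|\varphi(\beta_T)-(b^*(F),q^*(F))|>4\mu\bigr)\le e^{-\rho(\mu)T}$$ for all $F\in\mathcal F^\eta$, all $F_1,\dots,F_N$ with average $F$, and all initial estimates $\beta_0\in\mathsf B$. Here, as $\mu\downarrow0$, $\tau(\mu)$ is of exact order $-\log\mu$, and $\bar a(\mu)=O(-\mu/\log\mu)$. 2. The family $\mathcal A_a$ uniformly learns $\mathcal F^\eta$: for every $\mu>0$ there is a noise width $\epsilon(\mu)>0$, and for every $\mu>0$ and $\lambda\in(0,1)$ there are a gain $a(\mu,\lambda)>0$ and a time $\bar T(\mu,\lambda)\in\{0,1,2,\dots\}$ such that $\mathcal A_{a(\mu,\lambda)}$ with noise width $\epsilon(\mu)$ satisfies $$\mathbb P\bigl(|\varphi(\beta_{\bar T(\mu,\lambda)})-(b^*(F),q^*(F))|\ge\mu\bigr)\le\lambda$$ for all $F\in\mathcal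 F^\eta$, all $F_1,\dots,F_N$ with average $F$, and all $\beta_0\in\mathsf B$; and there are $k>0$ and $C$ with $\bar T(\mu,\lambda)\le C\,\frac{-\log\lambda}{\mu^k}$ for all $\mu\in(0,1]$ and $\lambda\in(0,\tfrac12]$. -/

import Mathlib

open MeasureTheory ProbabilityTheory Filter Topology Asymptotics
open scoped Matrix

noncomputable section

namespace MonopolyLearning

/-- `f` is a density of the distribution `m` with support `[l, u]`: it is continuous and strictly
positive on `[l, u]`, and the hazard rate `f / (1 - F)` is increasing there
(at `u` itself `1 - F` vanishes, so the hazard rate lives on `[l, u)`). -/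
structure HasIHRDensity (l u : ℝ) (m : Measure ℝ) (f : ℝ → ℝ) : Prop where
  isProb : IsProbabilityMeasure m
  density : m = (volume.restrict (Set.Icc l u)).withDensity (fun x => ENNReal.ofReal (f x))
  cont : ContinuousOn f (Set.Icc l u)
  pos : ∀ p ∈ Set.Icc l u, 0 < f p
  hazard : MonotoneOn (fun p => f p / (1 - cdf m p)) (Set.Ico l u)

/-- The class of distributions on `[l, u]` with increasing hazard rate whose density is
`η`-Lipschitz on `[l, u]`. -/
def lipschitzIHR (l u η : ℝ) : Set (Measure ℝ) :=
  {m | ∃ f : ℝ → ℝ, HasIHRDensity l u m f ∧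
    ∀ p ∈ Set.Icc l u, ∀ p' ∈ Set.Icc l u, |f p - f p'| ≤ η * |p - p'|}

/-- `b` maximizes the expected profit `p (1 - F p)`. -/
def IsOptimalPrice (m : Measure ℝ) (b : ℝ) : Prop :=
  ∀ p : ℝ, p * (1 - cdf m p) ≤ b * (1 - cdf m b)

/-- The optimal price `b*(F)` (a maximizer of the expected profit). -/
def optPrice (m : Measure ℝ) : ℝ := Classical.epsilon (IsOptimalPrice m)

/-- The expected quantity `q*(F) = 1 - F (b*(F))` at the optimal price. -/
def optQuantity (m : Measure ℝ) : ℝ := 1 - cdf m (optPrice m)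

/-- The linear demand `β 0 + β 1 * p` that supports the true optimum, i.e.
`q* = β 0 / 2` and `b* = -β 0 / (2 β 1)`. -/
def optBeta (m : Measure ℝ) : Fin 2 → ℝ :=
  ![2 * optQuantity m, -(optQuantity m / optPrice m)]

/-- The normalized aggregate distribution `F = (1/N) ∑ i, F i` of `N` buyers. -/
def aggregate {N : ℕ} (ν : Fin N → Measure ℝ) : Measure ℝ :=
  (N : ENNReal)⁻¹ • ∑ i, ν i

/-- The normalized quantity sold at price `p` to `N` buyers with valuations `v`. -/
def quantity {N : ℕ} (v : Fin N → ℝ) (p : ℝ) : ℝ :=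
  (∑ i, if p ≤ v i then (1 : ℝ) else 0) / N

/-- The uniform distribution on `[-ε, ε]`. -/
def noiseLaw (ε : ℝ) : Measure ℝ := cond volume (Set.Icc (-ε) ε)

/-- The shocks of period `t + 1` are `D t = (experimentation noise, valuations of the buyers)`.
The periods are i.i.d.; within a period the noise is uniform on `[-ε, ε]`, buyer `i` has valuation
distribution `ν i`, and all of these are independent. -/
structure IsShockProcess {Ω : Type} [MeasurableSpace Ω] (P : Measure Ω) {N : ℕ}
    (ν : Fin N → Measure ℝ) (ε : ℝ) (D : ℕ → Ω → ℝ × (Fin N → ℝ)) : Prop where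
  isProb : IsProbabilityMeasure P
  meas : ∀ t, Measurable (D t)
  indep : iIndepFun D P
  law : ∀ t, P.map (D t) = (noiseLaw ε).prod (Measure.pi ν)

/-- The optimal price for the linear demand `q = β 0 + β 1 * p`. -/
def linPrice (β : Fin 2 → ℝ) : ℝ := -β 0 / (2 * β 1)

/-- The second moment matrix of `(1, b + ε₁)`, where `ε₁` is uniform on `[-ε, ε]` and so has
variance `ε ^ 2 / 3`. -/
def momentMatrix (ε b : ℝ) : Matrix (Fin 2) (Fin 2) ℝ :=
  !![1, b; b, b ^ 2 + ε ^ 2 / 3]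

/-- One recursive least-squares update of `β` with gain `a`, from the observed price `p` and
quantity `q`. -/
def lsUpdate (ε a : ℝ) (β : Fin 2 → ℝ) (p q : ℝ) : Fin 2 → ℝ :=
  β + (a * (q - (β 0 + β 1 * p))) • ((momentMatrix ε (linPrice β))⁻¹ *ᵥ ![1, p])

/-- The projection facility: a compact set `core` of intercept-slope pairs containing every
linear demand that supports the optimum of some `m ∈ 𝓕`, a compact convex set `box` containing
`core` in its interior, and the point of `core` to which estimates leaving `box` are reset. -/
structure ProjectionFacility (𝓕 : Set (Measure ℝ)) where
  core : Set (Fin 2 → ℝ)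
  box : Set (Fin 2 → ℝ)
  reset : Fin 2 → ℝ
  core_compact : IsCompact core
  opt_mem_core : ∀ m ∈ 𝓕, optBeta m ∈ core
  box_compact : IsCompact box
  box_convex : Convex ℝ box
  core_subset : core ⊆ interior box
  box_sign : ∀ β ∈ box, 0 < β 0 ∧ β 1 < 0
  reset_mem : reset ∈ interior core

open Classical in
/-- The constant-gain algorithm: `estimate … t` is the estimate after `t` periods. In each period
the price is `-β 0 / (2 β 1)` plus the noise, the quantity is the realized demand, and `β` is
updated by least squares, or reset if the update leaves `box`. -/
def estimate {𝓕 : Set (Measure ℝ)} (pf : ProjectionFacility 𝓕) (ε a : ℝ) (β₀ : Fin 2 → ℝ) {N : ℕ}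
    (d : ℕ → ℝ × (Fin N → ℝ)) : ℕ → (Fin 2 → ℝ)
  | 0 => β₀
  | t + 1 =>
    let β := estimate pf ε a β₀ d t
    let p := linPrice β + (d t).1
    let β' := lsUpdate ε a β p (quantity (d t).2 p)
    if β' ∈ pf.box then β' else pf.reset

/-- The optimal price and the mean quantity forecast of the estimated linear model. -/
def modelForecast (β : Fin 2 → ℝ) (_e : ℝ) : ℝ × ℝ :=
  (linPrice β, β 0 + β 1 * linPrice β)

/-- The optimal price of the estimated linear model and the true mean quantity at the price that is
actually charged when the experimentation noise is `e`. -/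
def demandForecast (m : Measure ℝ) (β : Fin 2 → ℝ) (e : ℝ) : ℝ × ℝ :=
  (linPrice β, 1 - cdf m (linPrice β + e))

/-- Euclidean distance from a price-quantity pair to the true optimum `(b*(F), q*(F))`. -/
def distToOpt (m : Measure ℝ) (x : ℝ × ℝ) : ℝ :=
  Real.sqrt ((x.1 - optPrice m) ^ 2 + (x.2 - optQuantity m) ^ 2)

/-- Uniformly over all initial estimates in `core`, all `N`-buyer markets with aggregate
distribution in `𝓕`, and both ways of reading off the quantity forecast, the distance between the
forecast after `T` periods and the true optimum is `bad` with probability at most `δ`. -/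
def FailsWithProbAtMost {𝓕 : Set (Measure ℝ)} (pf : ProjectionFacility 𝓕) (N : ℕ) (ε a : ℝ) (T : ℕ)
    (bad : ℝ → Prop) (δ : ℝ) : Prop :=
  ∀ β₀ ∈ pf.core,
  ∀ ν : Fin N → Measure ℝ, (∀ i, IsProbabilityMeasure (ν i)) → aggregate ν ∈ 𝓕 →
  ∀ (Ω : Type) [MeasurableSpace Ω] (P : Measure Ω) (D : ℕ → Ω → ℝ × (Fin N → ℝ)),
    IsShockProcess P ν ε D →
  ∀ φ ∈ ({modelForecast, demandForecast (aggregate ν)} : Set ((Fin 2 → ℝ) → ℝ → ℝ × ℝ)),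
    P.real {ω | bad (distToOpt (aggregate ν)
      (φ (estimate pf ε a β₀ (fun t => D t ω) T) (D T ω).1))} ≤ δ

/-- Uniform learning: for all accuracies `μ` and confidence levels `1 - r` there are a noise width,
a gain and a stopping time `T μ r = O(-log r / μ ^ k)` at which the forecast is, uniformly over `𝓕`,
within `μ` of the optimum with probability at least `1 - r`. -/
def UniformlyLearns {𝓕 : Set (Measure ℝ)} (pf : ProjectionFacility 𝓕) (N : ℕ) : Prop :=
  ∃ (ε : ℝ → ℝ) (gain : ℝ → ℝ → ℝ) (T : ℝ → ℝ → ℕ),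
    (∀ μ > 0, 0 < ε μ ∧ ∀ r ∈ Set.Ioo (0 : ℝ) 1, 0 < gain μ r ∧
      FailsWithProbAtMost pf N (ε μ) (gain μ r) (T μ r) (fun d => μ ≤ d) r) ∧
    ∃ k > (0 : ℝ), ∃ C : ℝ, ∀ μ ∈ Set.Ioc (0 : ℝ) 1, ∀ r ∈ Set.Ioc (0 : ℝ) (1 / 2),
      (T μ r : ℝ) ≤ C * (-Real.log r / μ ^ k)

end MonopolyLearning

end

/-! Write `b` for the price, `y = β 0 / 2` for the predicted quantity and `x = b * y` for the
predicted profit. In these coordinates a small least-squares step moves on average along the planar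
system b' = b² G(b) / (2x), x' = b A(b) - x. Here A (`meanDemand`) is demand averaged over the price
noise, and G = A - b S (`meanMarginal`), with S (`meanSlope`) the absolute regression slope of
demand on the noisy price. The price follows the sign of an estimated marginal profit, while the
predicted profit tracks the actual one.

The increasing hazard rate gives 1 - F(p) ≤ b* f(p) above the optimum b*, and the reverse inequality
between l and an optimum b* > l. Up to O(ε), G therefore changes sign at a single price b₀ within 2ε
of b*, and pushes the price towards b₀ with strength at least |b - b₀| A(b) / u
(`IHRCdf.exists_approx_root`). The Lipschitz bound on the density makes every constant uniform over
the class (`IHRCdf.driftBounds`).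

This push degenerates at high prices, where demand has no uniform positive lower bound. The Lyapunov
function `lyap` therefore adds two terms to the one-sided squares of b - b₀. The first is an entropy
gap in x: its logarithm is a barrier at x = 0, and its derivative 1 - x₀/x carries the same factor
1/x as the price equation. The second is E x (b - b₀ - c)₊², which falls at high prices because x
decays when demand is small. With suitable constants (`nonempty_lyapunovConstants`) the mean drift
is at most -rate · V + err · ε, and V outside the box is at least its value at the reset point, so
that the projection never raises V.

A random step changes V by a bounded linear term, whose mean is this drift, plus a second-order
remainder (`exists_step_constants`). Hence exponential moments of V contract
(`lintegral_exp_lsStep_le`), and iteration with Markov's inequality gives a tail bound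
(`measure_recursion_gt_le`). Since V dominates squared distances, accuracy μ calls for ε of order
μ². Steps then have size a/μ², which is harmless for a below order μ⁶. After order -log μ / a
periods the failure probability is at most exp(-k₂ μ⁸ / a) (`exists_fails_bound`), and both claims
follow by choosing a. -/

noncomputable section

namespace MonopolyLearning

/-! ### Regularity of distribution functions in the class -/

/-- The analytic properties of a distribution function `F` on `[l, u]` with increasing hazard rate
and `η`-Lipschitz density `f`. -/
structure IHRCdf (l u η : ℝ) (F f : ℝ → ℝ) : Prop where
  mono : Monotone F
  eq_zero : ∀ p ≤ l, F p = 0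
  eq_one : ∀ p, u ≤ p → F p = 1
  cont : ContinuousOn f (Set.Icc l u)
  pos : ∀ p ∈ Set.Icc l u, 0 < f p
  lip : ∀ p ∈ Set.Icc l u, ∀ p' ∈ Set.Icc l u, |f p - f p'| ≤ η * |p - p'|
  sub_eq : ∀ x y, l ≤ x → x ≤ y → y ≤ u → F y - F x = ∫ t in x..y, f t
  hazard : MonotoneOn (fun p => f p / (1 - F p)) (Set.Ico l u)

lemma HasIHRDensity.absolutelyContinuous {l u : ℝ} {m : Measure ℝ} {f : ℝ → ℝ}
    (h : HasIHRDensity l u m f) : m ≪ volume := by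
  rw [h.density]
  exact (withDensity_absolutelyContinuous _ _).trans Measure.restrict_le_self.absolutelyContinuous

lemma HasIHRDensity.measure_eq_zero {l u : ℝ} {m : Measure ℝ} {f : ℝ → ℝ}
    (h : HasIHRDensity l u m f) {s : Set ℝ} (hs : volume (s ∩ Set.Icc l u) = 0)
    (hm : MeasurableSet s) : m s = 0 := by
  rw [h.density]
  apply withDensity_absolutelyContinuous
  rwa [Measure.restrict_apply hm]

/-- A buyer with valuation equal to the price buys, so demand is the mass of a closed half-line;
absolute continuity rules out an atom at the price. -/
lemma real_Ici_eq_one_sub_cdf {m : Measure ℝ} [IsProbabilityMeasure m] (h : m ≪ volume) (p : ℝ) :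
    m.real (Set.Ici p) = 1 - cdf m p := by
  have h1 : m.real (Set.Ici p) = m.real (Set.Ioi p) := by
    apply measureReal_congr
    exact h.ae_le Ioi_ae_eq_Ici.symm
  rw [h1, cdf_eq_real, ← Set.compl_Iic, probReal_compl_eq_one_sub measurableSet_Iic]

lemma HasIHRDensity.ihrCdf {l u η : ℝ} {m : Measure ℝ} {f : ℝ → ℝ}
    (h : HasIHRDensity l u m f)
    (hf : ∀ p ∈ Set.Icc l u, ∀ p' ∈ Set.Icc l u, |f p - f p'| ≤ η * |p - p'|) :
    IHRCdf l u η (cdf m) f := by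
  have := h.isProb
  refine ⟨monotone_cdf m, fun p hp => ?_, fun p hp => ?_, h.cont, h.pos, hf, ?_, h.hazard⟩
  · rw [cdf_eq_real, measureReal_def, h.measure_eq_zero _ measurableSet_Iic]
    · simp
    · refine measure_mono_null (t := {p}) ?_ (by simp)
      rintro x ⟨hx, hx'⟩
      exact le_antisymm hx (hp.trans hx'.1)
  · have := real_Ici_eq_one_sub_cdf h.absolutelyContinuous p
    rw [measureReal_def, h.measure_eq_zero _ measurableSet_Ici] at this
    · simp at this; linarith
    · refine measure_mono_null (t := {p}) ?_ (by simp)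
      rintro x ⟨hx, hx'⟩
      exact le_antisymm (hx'.2.trans hp) hx
  · intro x y hx hxy hy
    have hsub : Set.Ioc x y ⊆ Set.Icc l u := fun t ht => ⟨hx.trans ht.1.le, ht.2.trans hy⟩
    have hint : IntegrableOn f (Set.Ioc x y) :=
      (h.cont.integrableOn_Icc).mono_set hsub
    have h1 : cdf m y - cdf m x = m.real (Set.Ioc x y) := by
      rw [cdf_eq_real, cdf_eq_real, ← Set.Iic_sdiff_Iic,
        measureReal_sdiff (Set.Iic_subset_Iic.2 hxy) measurableSet_Iic]
    rw [h1, intervalIntegral.integral_of_le hxy, measureReal_def]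
    conv_lhs => rw [h.density]
    rw [withDensity_apply _ measurableSet_Ioc, Measure.restrict_restrict measurableSet_Ioc,
      Set.inter_eq_left.2 hsub, integral_eq_lintegral_of_nonneg_ae]
    · filter_upwards [ae_restrict_mem measurableSet_Ioc] with t ht using (h.pos t (hsub ht)).le
    · exact hint.aestronglyMeasurable

namespace IHRCdf

variable {l u η : ℝ} {F f : ℝ → ℝ}

lemma nonneg (h : IHRCdf l u η F f) (p : ℝ) : 0 ≤ F p := by
  rw [← h.eq_zero (min p l) (min_le_right _ _)]
  exact h.mono (min_le_left _ _)

lemma le_one (h : IHRCdf l u η F f) (p : ℝ) : F p ≤ 1 := by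
  rw [← h.eq_one (max p u) (le_max_right _ _)]
  exact h.mono (le_max_left _ _)

lemma intervalIntegrable (h : IHRCdf l u η F f) {x y : ℝ} (hx : l ≤ x) (hxy : x ≤ y) (hy : y ≤ u) :
    IntervalIntegrable f volume x y :=
  (h.cont.mono (by rw [Set.uIcc_of_le hxy]; exact Set.Icc_subset_Icc hx hy)).intervalIntegrable

/-- A Lipschitz density that is large at one point is large on all of `[l, u]`, which is impossible
for total mass one. -/
lemma density_le (h : IHRCdf l u η F f) (hlu : l < u) (hη : 0 < η) {p : ℝ}
    (hp : p ∈ Set.Icc l u) : f p ≤ 1 / (u - l) + η * (u - l) := by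
  have h1 : ∫ _ in l..u, (f p - η * (u - l)) ≤ ∫ t in l..u, f t := by
    apply intervalIntegral.integral_mono_on hlu.le (by simp)
      (h.intervalIntegrable le_rfl hlu.le le_rfl)
    intro t ht
    have h2 := (abs_le.1 (h.lip p hp t ht)).2
    have h3 : |p - t| ≤ u - l := by
      rw [abs_le]; constructor <;> linarith [hp.1, hp.2, ht.1, ht.2]
    nlinarith
  rw [← h.sub_eq l u le_rfl hlu.le le_rfl, h.eq_zero l le_rfl, h.eq_one u le_rfl] at h1
  simp only [intervalIntegral.integral_const, smul_eq_mul] at h1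
  have h4 : 0 < u - l := by linarith
  have h5 : f p - η * (u - l) ≤ 1 / (u - l) := by
    rw [le_div_iff₀ h4]; linarith
  linarith

lemma lipschitz (h : IHRCdf l u η F f) (hlu : l < u) (hη : 0 < η) (x y : ℝ) :
    |F x - F y| ≤ (1 / (u - l) + η * (u - l)) * |x - y| := by
  set M := 1 / (u - l) + η * (u - l) with hM
  have hM0 : 0 < M := by
    have : 0 < u - l := by linarith
    positivity
  have key : ∀ x y, l ≤ x → x ≤ y → y ≤ u → F y - F x ≤ M * (y - x) := by
    intro x y hx hxy hy
    rw [h.sub_eq x y hx hxy hy]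
    have : ∫ t in x..y, f t ≤ ∫ _ in x..y, M :=
      intervalIntegral.integral_mono_on hxy (h.intervalIntegrable hx hxy hy) (by simp)
        fun t ht => h.density_le hlu hη ⟨hx.trans ht.1, ht.2.trans hy⟩
    simpa [mul_comm] using this
  -- `F` is constant on either side of `[l, u]`, so the Lipschitz bound inside extends to the whole
  -- line by projecting onto the interval.
  have clamp : ∀ x, F x = F (max l (min u x)) := by
    intro x
    rcases le_total x l with hx | hx
    · rw [h.eq_zero x hx, h.eq_zero]
      simp [(min_le_right u x).trans hx]
    · rcases le_total u x with hx' | hx'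
      · rw [h.eq_one x hx', min_eq_left hx', max_eq_right hlu.le, h.eq_one u le_rfl]
      · rw [min_eq_right hx', max_eq_right hx]
  have mono' : ∀ x y, x ≤ y → F y - F x ≤ M * (y - x) := by
    intro x y hxy
    rw [clamp x, clamp y]
    have h1 := key (max l (min u x)) (max l (min u y)) (le_max_left _ _)
      (max_le_max le_rfl (min_le_min le_rfl hxy)) (max_le hlu.le (min_le_left _ _))
    refine h1.trans (mul_le_mul_of_nonneg_left ?_ hM0.le)
    rcases max_cases l (min u x) with ⟨h2, h3⟩ | ⟨h2, h3⟩ <;>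
    rcases max_cases l (min u y) with ⟨h4, h5⟩ | ⟨h4, h5⟩ <;>
    rcases min_cases u x with ⟨h6, h7⟩ | ⟨h6, h7⟩ <;>
    rcases min_cases u y with ⟨h8, h9⟩ | ⟨h8, h9⟩ <;> linarith
  rcases le_total x y with hxy | hxy
  · rw [abs_of_nonpos (by linarith [h.mono hxy]), abs_of_nonpos (by linarith)]
    linarith [mono' x y hxy]
  · rw [abs_of_nonneg (by linarith [h.mono hxy]), abs_of_nonneg (by linarith)]
    linarith [mono' y x hxy]

lemma continuous (h : IHRCdf l u η F f) (hlu : l < u) (hη : 0 < η) : Continuous F := by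
  have : LipschitzWith (Real.toNNReal (1 / (u - l) + η * (u - l))) F := by
    apply LipschitzWith.of_dist_le_mul
    intro x y
    have : 0 < u - l := by linarith
    rw [Real.coe_toNNReal _ (by positivity)]
    exact h.lipschitz hlu hη x y
  exact this.continuous

/-- First-order Taylor expansion of the distribution function. -/
lemma taylor (h : IHRCdf l u η F f) {x y : ℝ} (hx : x ∈ Set.Icc l u) (hy : y ∈ Set.Icc l u)
    (hη : 0 < η) : |F y - F x - f x * (y - x)| ≤ η * (y - x) ^ 2 := by
  have key : ∀ a b, l ≤ a → a ≤ b → b ≤ u → ∀ z ∈ Set.Icc a b,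
      |F b - F a - f z * (b - a)| ≤ η * (b - a) ^ 2 := by
    intro a b ha hab hb z hz
    have hi := h.intervalIntegrable ha hab hb
    have hz' : z ∈ Set.Icc l u := ⟨ha.trans hz.1, hz.2.trans hb⟩
    have e : F b - F a - f z * (b - a) = ∫ t in a..b, (f t - f z) := by
      rw [intervalIntegral.integral_sub hi (by simp), h.sub_eq a b ha hab hb]
      simp [mul_comm]
    rw [e, ← Real.norm_eq_abs]
    refine (intervalIntegral.norm_integral_le_of_norm_le_const
      (C := η * (b - a)) ?_).trans (le_of_eq ?_)
    · intro t ht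
      rw [Set.uIoc_of_le hab] at ht
      refine (h.lip t ⟨ha.trans ht.1.le, ht.2.trans hb⟩ z hz').trans ?_
      apply mul_le_mul_of_nonneg_left _ hη.le
      rw [abs_le]; constructor <;> linarith [hz.1, hz.2, ht.1, ht.2]
    · rw [abs_of_nonneg (by linarith)]; ring
  rcases le_total x y with hxy | hxy
  · exact key x y hx.1 hxy hy.2 x ⟨le_rfl, hxy⟩
  · have := key y x hy.1 hxy hx.2 x ⟨hxy, le_rfl⟩
    rw [abs_sub_comm]
    rw [show f x * (y - x) - (F y - F x) = F x - F y - f x * (x - y) by ring]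
    rw [show (y - x) ^ 2 = (x - y) ^ 2 by ring]
    exact this

/-- Increments of the distribution function over intervals of equal length are almost monotone. -/
lemma shift (h : IHRCdf l u η F f) (hη : 0 < η) {x y t : ℝ} (hxy : x ≤ y) (ht : 0 ≤ t)
    (hu : y + t ≤ u) : F y - F x - η * t * (y - x) ≤ F (y + t) - F (x + t) := by
  have key : ∀ a b, l ≤ a → a ≤ b → b + t ≤ u →
      F b - F a - η * t * (b - a) ≤ F (b + t) - F (a + t) := by
    intro a b ha hab hb
    rw [h.sub_eq a b ha hab (by linarith), h.sub_eq (a + t) (b + t) (by linarith) (by linarith) hb]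
    have hi := h.intervalIntegrable ha hab (by linarith)
    have hi2 : IntervalIntegrable (fun s => f (s + t)) volume a b := by
      have h3 := h.intervalIntegrable (x := a + t) (y := b + t) (by linarith) (by linarith) hb
      simpa using h3.comp_add_right t
    rw [← intervalIntegral.integral_comp_add_right]
    have h4 : ∫ s in a..b, (f s - η * t) ≤ ∫ s in a..b, f (s + t) := by
      apply intervalIntegral.integral_mono_on hab (hi.sub (by simp)) hi2
      intro s hs
      have h5 := h.lip s ⟨ha.trans hs.1, by linarith [hs.2]⟩ (s + t)
        ⟨by linarith [hs.1], by linarith [hs.2]⟩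
      rw [show s - (s + t) = -t by ring, abs_neg, abs_of_nonneg ht] at h5
      linarith [(abs_le.1 h5).2]
    rw [intervalIntegral.integral_sub hi (by simp)] at h4
    simp only [intervalIntegral.integral_const, smul_eq_mul] at h4
    linarith
  -- The density vanishes below `l`, so its jump at `l` is upward and can only enlarge the shifted
  -- increment; the part of `[x, y]` below `l` may be discarded.
  rcases le_total y l with hy | hy
  · rw [h.eq_zero y hy, h.eq_zero x (hxy.trans hy)]
    have := h.mono (show x + t ≤ y + t by linarith)
    have : 0 ≤ η * t * (y - x) := by
      have : 0 ≤ y - x := by linarith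
      positivity
    linarith
  · rcases le_total x l with hx | hx
    · have h1 := key l y le_rfl hy hu
      rw [h.eq_zero x hx]
      rw [h.eq_zero l le_rfl] at h1
      have h2 := h.mono (show x + t ≤ l + t by linarith)
      have h3 : η * t * (y - l) ≤ η * t * (y - x) := by gcongr
      linarith
    · exact key x y hx hxy hu

end IHRCdf

/-! ### The optimal price: bounds, first-order conditions, uniqueness -/

namespace IHRCdf

variable {l u η : ℝ} {F f : ℝ → ℝ} {b : ℝ}

/-- An upper bound for the densities in the class. -/
def densityBound (l u η : ℝ) : ℝ := 1 / (u - l) + η * (u - l)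

lemma densityBound_pos (hlu : l < u) (hη : 0 < η) : 0 < densityBound l u η := by
  have : 0 < u - l := by linarith
  unfold densityBound
  positivity

lemma one_le_densityBound_mul (hlu : l < u) (hη : 0 < η) : 1 ≤ densityBound l u η * (u - l) := by
  have : 0 < u - l := by linarith
  unfold densityBound
  rw [add_mul, one_div, inv_mul_cancel₀ this.ne']
  have : 0 ≤ η * (u - l) * (u - l) := by positivity
  linarith

lemma exists_isMax (h : IHRCdf l u η F f) (hl : 0 ≤ l) (hlu : l < u) (hη : 0 < η) :
    ∃ b, ∀ p, p * (1 - F p) ≤ b * (1 - F b) := by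
  have hc : Continuous fun p => p * (1 - F p) := by
    have := h.continuous hlu hη
    fun_prop
  obtain ⟨b, hb, hmax⟩ := isCompact_Icc.exists_isMaxOn (Set.nonempty_Icc.2 hlu.le) hc.continuousOn
  refine ⟨b, fun p => ?_⟩
  have hl' := hmax (Set.left_mem_Icc.2 hlu.le)
  simp only [Set.mem_ofPred_eq, h.eq_zero l le_rfl] at hl'
  rcases le_total p l with hp | hp
  · rw [h.eq_zero p hp]; linarith
  · rcases le_total p u with hp' | hp'
    · exact hmax ⟨hp, hp'⟩
    · rw [h.eq_one p hp']; linarith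

lemma survival_pos (h : IHRCdf l u η F f) {p : ℝ} (hp : p < u) : 0 < 1 - F p := by
  rcases le_total p l with hpl | hpl
  · rw [h.eq_zero p hpl]; norm_num
  · rw [← h.eq_one u le_rfl, h.sub_eq p u hpl hp.le le_rfl]
    apply intervalIntegral.intervalIntegral_pos_of_pos_on (h.intervalIntegrable hpl hp.le le_rfl)
      _ hp
    intro t ht
    exact h.pos t ⟨hpl.trans ht.1.le, ht.2.le⟩

lemma le_opt (h : IHRCdf l u η F f) (hb : ∀ p, p * (1 - F p) ≤ b * (1 - F b)) :
    l ≤ b := by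
  by_contra hbl
  have h1 := hb l
  rw [h.eq_zero l le_rfl, h.eq_zero b (not_le.1 hbl).le] at h1
  linarith

section Optimum

variable (h : IHRCdf l u η F f) (hb : ∀ p, p * (1 - F p) ≤ b * (1 - F b)) (hl : 0 ≤ l)
  (hlu : l < u) (hη : 0 < η)

include h hb hl hlu hη

/-- At the price `l + 1 / (2 * densityBound l u η)` at least half of the demand survives, so that
price already earns this much. -/
lemma opt_value : 1 / (4 * densityBound l u η) ≤ b * (1 - F b) := by
  have hM := densityBound_pos hlu hη
  have h1 := hb (l + 1 / (2 * densityBound l u η))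
  have h2 := h.lipschitz hlu hη (l + 1 / (2 * densityBound l u η)) l
  rw [h.eq_zero l le_rfl, add_sub_cancel_left, sub_zero, abs_of_nonneg (h.nonneg _),
    abs_of_pos (by positivity)] at h2
  change _ ≤ densityBound l u η * _ at h2
  rw [show densityBound l u η * (1 / (2 * densityBound l u η)) = 1 / 2 by field_simp] at h2
  have h3 : (1 : ℝ) / (4 * densityBound l u η) = 1 / (2 * densityBound l u η) * (1 / 2) := by
    field_simp; norm_num
  have h4 : 0 < 1 / (2 * densityBound l u η) := by positivity
  rw [h3]
  refine le_trans ?_ h1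
  apply mul_le_mul <;> linarith

lemma opt_lt : b < u := by
  by_contra hbu
  have h1 := opt_value h hb hl hlu hη
  rw [h.eq_one b (not_lt.1 hbu)] at h1
  have := densityBound_pos hlu hη
  have : 0 < 1 / (4 * densityBound l u η) := by positivity
  linarith

lemma le_opt' : 1 / (4 * densityBound l u η) ≤ b := by
  have h1 := opt_value h hb hl hlu hη
  have h2 := le_opt h hb
  have := h.nonneg b
  nlinarith

lemma opt_pos : 0 < b := by
  have := densityBound_pos hlu hη
  have : 0 < 1 / (4 * densityBound l u η) := by positivity
  linarith [le_opt' h hb hl hlu hη]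

lemma opt_quantity_ge : 1 / (4 * densityBound l u η) / u ≤ 1 - F b := by
  have h1 := opt_value h hb hl hlu hη
  have h2 := opt_lt h hb hl hlu hη
  have h3 := h.le_one b
  rw [div_le_iff₀ (by linarith)]
  nlinarith

/-- The optimal quantity is bounded below, and `F` climbs to 1 at `u` with bounded slope, so the
optimum stays away from `u`. -/
lemma opt_le : b ≤ u - 1 / (4 * densityBound l u η) / u / densityBound l u η := by
  have h1 := opt_quantity_ge h hb hl hlu hη
  have h2 := opt_lt h hb hl hlu hη
  have h3 := h.lipschitz hlu hη u b
  change _ ≤ densityBound l u η * _ at h3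
  rw [h.eq_one u le_rfl, abs_of_nonneg (by linarith [h.le_one b]), abs_of_pos (by linarith)] at h3
  have : 1 / (4 * densityBound l u η) / u / densityBound l u η ≤ u - b := by
    rw [div_le_iff₀ (densityBound_pos hlu hη)]
    linarith
  linarith

/-- Compares the profit at `b` with that at `b + t` and lets `t` decrease to 0. The one-sided
version also covers the corner optimum `b = l`, where `F` may have a kink. -/
lemma opt_foc_right : 1 - F b ≤ b * f b := by
  have hbl := le_opt h hb
  have hbu := opt_lt h hb hl hlu hη
  have key : ∀ᶠ t in 𝓝[>] (0 : ℝ), 1 - F b - (b + t) * (f b + η * t) ≤ 0 := by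
    filter_upwards [Ioo_mem_nhdsGT (show (0 : ℝ) < u - b by linarith)] with t ht
    have h1 := hb (b + t)
    have h2 := (abs_le.1 (h.taylor (x := b) (y := b + t) ⟨hbl, hbu.le⟩
      ⟨by linarith [ht.1], by linarith [ht.2]⟩ hη)).2
    have ht0 := ht.1
    have h3 : F (b + t) ≤ F b + (f b + η * t) * t := by linarith
    have h4 : (b + t) * (1 - (F b + (f b + η * t) * t)) ≤ (b + t) * (1 - F (b + t)) := by
      apply mul_le_mul_of_nonneg_left <;> linarith
    have h5 : t * (1 - F b - (b + t) * (f b + η * t)) ≤ 0 := by nlinarith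
    by_contra hcon
    have := mul_pos ht0 (not_le.1 hcon)
    linarith
  have hlim : Tendsto (fun t => 1 - F b - (b + t) * (f b + η * t)) (𝓝[>] 0)
      (𝓝 (1 - F b - (b + 0) * (f b + η * 0))) :=
    (Continuous.tendsto (by fun_prop) 0).mono_left nhdsWithin_le_nhds
  have := le_of_tendsto hlim key
  simp at this
  linarith

/-- Deviations to `b - t` stay in the support only for an interior optimum; at a corner this
inequality can fail. -/
lemma opt_foc_left (hlb : l < b) : b * f b ≤ 1 - F b := by
  have hbu := opt_lt h hb hl hlu hη
  have key : ∀ᶠ t in 𝓝[>] (0 : ℝ), 0 ≤ 1 - F b - (b - t) * (f b - η * t) := by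
    filter_upwards [Ioo_mem_nhdsGT (show (0 : ℝ) < b - l by linarith)] with t ht
    have h1 := hb (b - t)
    have h2 := (abs_le.1 (h.taylor (x := b) (y := b - t) ⟨hlb.le, hbu.le⟩
      ⟨by linarith [ht.2], by linarith [ht.1]⟩ hη)).2
    have ht0 := ht.1
    have h3 : F (b - t) ≤ F b - (f b - η * t) * t := by linarith
    have h4 : (b - t) * (1 - (F b - (f b - η * t) * t)) ≤ (b - t) * (1 - F (b - t)) := by
      apply mul_le_mul_of_nonneg_left <;> linarith [ht.2]
    have h5 : 0 ≤ t * (1 - F b - (b - t) * (f b - η * t)) := by nlinarith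
    by_contra hcon
    have := mul_neg_of_pos_of_neg ht0 (not_le.1 hcon)
    linarith
  have hlim : Tendsto (fun t => 1 - F b - (b - t) * (f b - η * t)) (𝓝[>] 0)
      (𝓝 (1 - F b - (b - 0) * (f b - η * 0))) :=
    (Continuous.tendsto (by fun_prop) 0).mono_left nhdsWithin_le_nhds
  have := ge_of_tendsto hlim key
  simp at this
  linarith

/-- The first-order condition says that the hazard rate at `b` is at least `1 / b`, and monotonicity
carries this to all higher prices. -/
lemma survival_le_of_opt_le {p : ℝ} (hbp : b ≤ p) (hp : p < u) : 1 - F p ≤ b * f p := by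
  have hbl := le_opt h hb
  have hbu := opt_lt h hb hl hlu hη
  have h1 := h.hazard ⟨hbl, hbu⟩ ⟨hbl.trans hbp, hp⟩ hbp
  have h2 := survival_pos h hbu
  have h3 := survival_pos h hp
  have h4 := opt_foc_right h hb hl hlu hη
  have h5 := opt_pos h hb hl hlu hη
  simp only at h1
  rw [div_le_div_iff₀ h2 h3] at h1
  have h6 : (1 - F b) * (1 - F p) ≤ (1 - F b) * (b * f p) := by nlinarith
  exact le_of_mul_le_mul_left h6 h2

/-- The mirror image: at an interior optimum the hazard rate is at most `1 / b`, hence also at all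
lower prices in the support. -/
lemma le_survival_of_le_opt {p : ℝ} (hlb : l < b) (hlp : l ≤ p) (hpb : p ≤ b) :
    b * f p ≤ 1 - F p := by
  have hbu := opt_lt h hb hl hlu hη
  have h1 := h.hazard ⟨hlp, hpb.trans_lt hbu⟩ ⟨hlb.le, hbu⟩ hpb
  have h2 := survival_pos h hbu
  have h3 := survival_pos h (hpb.trans_lt hbu)
  have h4 := opt_foc_left h hb hl hlu hη hlb
  have h5 := opt_pos h hb hl hlu hη
  simp only at h1
  rw [div_le_div_iff₀ h3 h2] at h1
  have h6 : (1 - F b) * (b * f p) ≤ (1 - F b) * (1 - F p) := by nlinarith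
  exact le_of_mul_le_mul_left h6 h2

/-- If `b < b'` were both optimal, then `b' * f b' ≤ 1 - F b' ≤ b * f b'`, which contradicts `0 < f
b'`. -/
lemma opt_unique_of_le {b' : ℝ} (hb' : ∀ p, p * (1 - F p) ≤ b' * (1 - F b')) (hbb : b ≤ b') :
    b' = b := by
  by_contra hne
  have hlt : b < b' := lt_of_le_of_ne hbb (Ne.symm hne)
  have hbl := le_opt h hb
  have hbu' := opt_lt h hb' hl hlu hη
  have h1 := survival_le_of_opt_le h hb hl hlu hη hbb hbu'
  have h2 := opt_foc_left h hb' hl hlu hη (hbl.trans_lt hlt)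
  have h3 := h.pos b' ⟨hbl.trans hbb, hbu'.le⟩
  nlinarith

end Optimum

lemma existsUnique_isMax (h : IHRCdf l u η F f) (hl : 0 ≤ l) (hlu : l < u) (hη : 0 < η) :
    ∃! b, ∀ p, p * (1 - F p) ≤ b * (1 - F b) := by
  obtain ⟨b, hb⟩ := h.exists_isMax hl hlu hη
  refine ⟨b, hb, fun b' hb' => ?_⟩
  rcases le_total b b' with hbb | hbb
  · exact opt_unique_of_le h hb hl hlu hη hb' hbb
  · exact (opt_unique_of_le h hb' hl hlu hη hb hbb).symm

end IHRCdf

/-! ### Demand smoothed by the price noise and its regression slope -/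

/-- The mean demand at the noisy price `b + e`, with `e` uniform on `[-ε, ε]`. -/
def meanDemand (F : ℝ → ℝ) (ε b : ℝ) : ℝ := (∫ e in -ε..ε, (1 - F (b + e))) / (2 * ε)

/-- The absolute value of the slope of the linear regression of demand on the noisy price. -/
def meanSlope (F : ℝ → ℝ) (ε b : ℝ) : ℝ := 3 / (2 * ε ^ 3) * ∫ e in -ε..ε, e * F (b + e)

/-- The marginal profit at `b` according to the linear regression of demand on the noisy price. -/
def meanMarginal (F : ℝ → ℝ) (ε b : ℝ) : ℝ := meanDemand F ε b - b * meanSlope F ε b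

lemma integral_quadratic_symm (ε c d : ℝ) :
    ∫ e in -ε..ε, (c * e + d * e ^ 2) = d * (2 * ε ^ 3 / 3) := by
  rw [intervalIntegral.integral_add (Continuous.intervalIntegrable (by fun_prop) _ _)
    (Continuous.intervalIntegrable (by fun_prop) _ _)]
  rw [intervalIntegral.integral_const_mul, intervalIntegral.integral_const_mul, integral_id,
    integral_pow]
  push_cast
  ring

section Smoothing

variable {F : ℝ → ℝ} {ε b : ℝ}

/-- The slope functional annihilates odd linear terms and maps `d * e ^ 2` to `d`, so pointwise
quadratic bounds of `e * F (b + e)` turn into bounds of the slope. The free `c` serves to subtract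
`F b * e`. -/
lemma le_meanSlope (hF : Continuous F) (hε : 0 < ε) {c d : ℝ}
    (h : ∀ e ∈ Set.Icc (-ε) ε, c * e + d * e ^ 2 ≤ e * F (b + e)) : d ≤ meanSlope F ε b := by
  have h1 : ∫ e in -ε..ε, (c * e + d * e ^ 2) ≤ ∫ e in -ε..ε, e * F (b + e) :=
    intervalIntegral.integral_mono_on (by linarith)
      (Continuous.intervalIntegrable (by fun_prop) _ _)
      (Continuous.intervalIntegrable (by fun_prop) _ _) h
  rw [integral_quadratic_symm] at h1
  unfold meanSlope
  calc d = 3 / (2 * ε ^ 3) * (d * (2 * ε ^ 3 / 3)) := by field_simp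
    _ ≤ _ := by gcongr

lemma meanSlope_le (hF : Continuous F) (hε : 0 < ε) {c d : ℝ}
    (h : ∀ e ∈ Set.Icc (-ε) ε, e * F (b + e) ≤ c * e + d * e ^ 2) : meanSlope F ε b ≤ d := by
  have h1 : ∫ e in -ε..ε, e * F (b + e) ≤ ∫ e in -ε..ε, (c * e + d * e ^ 2) :=
    intervalIntegral.integral_mono_on (by linarith)
      (Continuous.intervalIntegrable (by fun_prop) _ _)
      (Continuous.intervalIntegrable (by fun_prop) _ _) h
  rw [integral_quadratic_symm] at h1
  unfold meanSlope
  calc _ ≤ 3 / (2 * ε ^ 3) * (d * (2 * ε ^ 3 / 3)) := by gcongr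
    _ = d := by field_simp

/-- The term `e * (F b - F b')` integrates to zero, so only increments away from the two centres
have to be compared. -/
lemma meanSlope_sub_ge (hF : Continuous F) (hε : 0 < ε) {b' d : ℝ}
    (h : ∀ e ∈ Set.Icc (-ε) ε, e * (F b - F b') - d * e ^ 2 ≤ e * (F (b + e) - F (b' + e))) :
    meanSlope F ε b' - d ≤ meanSlope F ε b := by
  have h1 : ∫ e in -ε..ε, (e * F (b' + e) + ((F b - F b') * e + (-d) * e ^ 2))
      ≤ ∫ e in -ε..ε, e * F (b + e) :=
    intervalIntegral.integral_mono_on (by linarith)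
      (Continuous.intervalIntegrable (by fun_prop) _ _)
      (Continuous.intervalIntegrable (by fun_prop) _ _) fun e he => by linarith [h e he]
  rw [intervalIntegral.integral_add (Continuous.intervalIntegrable (by fun_prop) _ _)
    (Continuous.intervalIntegrable (by fun_prop) _ _), integral_quadratic_symm] at h1
  unfold meanSlope
  calc _ = 3 / (2 * ε ^ 3) * ((∫ e in -ε..ε, e * F (b' + e)) + -d * (2 * ε ^ 3 / 3)) := by
        field_simp; ring
    _ ≤ _ := by gcongr

lemma le_meanDemand (hF : Continuous F) (hε : 0 < ε) {d : ℝ}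
    (h : ∀ e ∈ Set.Icc (-ε) ε, d ≤ 1 - F (b + e)) : d ≤ meanDemand F ε b := by
  have h1 : ∫ _ in -ε..ε, d ≤ ∫ e in -ε..ε, (1 - F (b + e)) :=
    intervalIntegral.integral_mono_on (by linarith)
      (Continuous.intervalIntegrable (by fun_prop) _ _)
      (Continuous.intervalIntegrable (by fun_prop) _ _) h
  simp only [intervalIntegral.integral_const, smul_eq_mul] at h1
  unfold meanDemand
  rw [le_div_iff₀ (by linarith)]
  linarith

lemma meanDemand_le (hF : Continuous F) (hε : 0 < ε) {d : ℝ}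
    (h : ∀ e ∈ Set.Icc (-ε) ε, 1 - F (b + e) ≤ d) : meanDemand F ε b ≤ d := by
  have h1 : ∫ e in -ε..ε, (1 - F (b + e)) ≤ ∫ _ in -ε..ε, d :=
    intervalIntegral.integral_mono_on (by linarith)
      (Continuous.intervalIntegrable (by fun_prop) _ _)
      (Continuous.intervalIntegrable (by fun_prop) _ _) h
  simp only [intervalIntegral.integral_const, smul_eq_mul] at h1
  unfold meanDemand
  rw [div_le_iff₀ (by linarith)]
  linarith

lemma meanDemand_antitone (hF : Continuous F) (hm : Monotone F) (hε : 0 < ε) :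
    Antitone (meanDemand F ε) := by
  intro b b' hbb
  unfold meanDemand
  gcongr
  apply intervalIntegral.integral_mono_on (by linarith)
      (Continuous.intervalIntegrable (by fun_prop) _ _)
      (Continuous.intervalIntegrable (by fun_prop) _ _)
  intro e _
  have := hm (show b + e ≤ b' + e by linarith)
  linarith

lemma meanSlope_nonneg (hF : Continuous F) (hm : Monotone F) (hε : 0 < ε) :
    0 ≤ meanSlope F ε b := by
  apply le_meanSlope hF hε (c := F b)
  intro e _
  rcases le_total 0 e with he | he
  · have := hm (show b ≤ b + e by linarith)
    nlinarith
  · have := hm (show b + e ≤ b by linarith)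
    nlinarith

lemma continuous_meanMarginal (hF : Continuous F) : Continuous (meanMarginal F ε) := by
  unfold meanMarginal meanDemand meanSlope
  have h1 : Continuous fun b => ∫ e in -ε..ε, (1 - F (b + e)) :=
    intervalIntegral.continuous_parametric_intervalIntegral_of_continuous' (by fun_prop) _ _
  have h2 : Continuous fun b => ∫ e in -ε..ε, e * F (b + e) :=
    intervalIntegral.continuous_parametric_intervalIntegral_of_continuous' (by fun_prop) _ _
  fun_prop

end Smoothing

namespace IHRCdf

variable {l u η : ℝ} {F f : ℝ → ℝ} {ε b : ℝ}

lemma meanDemand_nonneg (h : IHRCdf l u η F f) (hlu : l < u) (hη : 0 < η) (hε : 0 < ε) :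
    0 ≤ meanDemand F ε b :=
  le_meanDemand (h.continuous hlu hη) hε fun e _ => by linarith [h.le_one (b + e)]

lemma meanDemand_le_one (h : IHRCdf l u η F f) (hlu : l < u) (hη : 0 < η) (hε : 0 < ε) :
    meanDemand F ε b ≤ 1 :=
  meanDemand_le (h.continuous hlu hη) hε fun e _ => by linarith [h.nonneg (b + e)]

lemma abs_meanDemand_sub_le (h : IHRCdf l u η F f) (hlu : l < u) (hη : 0 < η) (hε : 0 < ε)
    (p : ℝ) : |meanDemand F ε b - (1 - F p)| ≤ densityBound l u η * (|b - p| + ε) := by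
  have hM := densityBound_pos hlu hη
  have key : ∀ e ∈ Set.Icc (-ε) ε, |F (b + e) - F p| ≤ densityBound l u η * (|b - p| + ε) := by
    intro e he
    refine (h.lipschitz hlu hη _ _).trans ?_
    change densityBound l u η * _ ≤ _
    gcongr
    rw [show b + e - p = (b - p) + e by ring]
    refine (abs_add_le _ _).trans ?_
    have := abs_le.2 he
    linarith
  have h1 : (1 - F p) - densityBound l u η * (|b - p| + ε) ≤ meanDemand F ε b :=
    le_meanDemand (h.continuous hlu hη) hε fun e he => by linarith [(abs_le.1 (key e he)).2]
  have h2 : meanDemand F ε b ≤ (1 - F p) + densityBound l u η * (|b - p| + ε) :=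
    meanDemand_le (h.continuous hlu hη) hε fun e he => by linarith [(abs_le.1 (key e he)).1]
  rw [abs_le]; constructor <;> linarith

lemma meanMarginal_of_le (h : IHRCdf l u η F f) (hlu : l < u) (hη : 0 < η) (hε : 0 < ε)
    (hb : b ≤ l - ε) : meanMarginal F ε b = 1 := by
  have hz : ∀ e ∈ Set.Icc (-ε) ε, F (b + e) = 0 := fun e he => h.eq_zero _ (by linarith [he.2])
  have h1 : meanDemand F ε b = 1 := by
    apply le_antisymm (h.meanDemand_le_one hlu hη hε)
    exact le_meanDemand (h.continuous hlu hη) hε fun e he => by rw [hz e he]; norm_num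
  have h2 : meanSlope F ε b = 0 := by
    apply le_antisymm _ (meanSlope_nonneg (h.continuous hlu hη) h.mono hε)
    exact meanSlope_le (h.continuous hlu hη) hε (c := 0) fun e he => by rw [hz e he]; simp
  rw [meanMarginal, h1, h2]; ring

lemma abs_meanSlope_sub_le (h : IHRCdf l u η F f) (hlu : l < u) (hη : 0 < η) (hε : 0 < ε)
    (hb : l + ε ≤ b) (hb' : b ≤ u - ε) : |meanSlope F ε b - f b| ≤ η * ε := by
  have key : ∀ e ∈ Set.Icc (-ε) ε, |e * F (b + e) - (F b * e + f b * e ^ 2)| ≤ η * ε * e ^ 2 := by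
    intro e he
    have h1 := h.taylor (x := b) (y := b + e) ⟨by linarith, by linarith⟩
      ⟨by linarith [he.1], by linarith [he.2]⟩ hη
    rw [add_sub_cancel_left] at h1
    rw [show e * F (b + e) - (F b * e + f b * e ^ 2) = e * (F (b + e) - F b - f b * e) by ring,
      abs_mul]
    calc |e| * |F (b + e) - F b - f b * e| ≤ ε * (η * e ^ 2) :=
          mul_le_mul (abs_le.2 he) h1 (abs_nonneg _) hε.le
      _ = _ := by ring
  have h1 : f b - η * ε ≤ meanSlope F ε b :=
    le_meanSlope (h.continuous hlu hη) hε (c := F b) fun e he => by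
      linarith [(abs_le.1 (key e he)).1]
  have h2 : meanSlope F ε b ≤ f b + η * ε :=
    meanSlope_le (h.continuous hlu hη) hε (c := F b) fun e he => by
      linarith [(abs_le.1 (key e he)).2]
  rw [abs_le]; constructor <;> linarith

/-- Near the lower end of the support the marginal profit is almost decreasing. -/
lemma meanMarginal_le_of_le (h : IHRCdf l u η F f) (hlu : l < u) (hη : 0 < η) (hε : 0 < ε)
    (hεu : l + 2 * ε ≤ u) {b' : ℝ} (hb' : 0 ≤ b') (hlb : l - ε ≤ b') (hbb : b' ≤ b)
    (hb : b ≤ l + ε) : meanMarginal F ε b ≤ meanMarginal F ε b' + u * (2 * η * ε) := by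
  have h1 : meanDemand F ε b ≤ meanDemand F ε b' :=
    meanDemand_antitone (h.continuous hlu hη) h.mono hε hbb
  have h2 : meanSlope F ε b' - η * (2 * ε) ≤ meanSlope F ε b := by
    apply meanSlope_sub_ge (h.continuous hlu hη) hε
    have hsh : ∀ x y, x ≤ y → y + (b - b') ≤ u →
        F y - F x - η * (2 * ε) * (y - x) ≤ F (y + (b - b')) - F (x + (b - b')) := by
      intro x y hxy hy
      have h3 := h.shift hη hxy (show 0 ≤ b - b' by linarith) hy
      have h4 : η * (b - b') * (y - x) ≤ η * (2 * ε) * (y - x) := by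
        gcongr
        · linarith
      linarith
    -- For either sign of `e`, `e * (F (b + e) - F b)` is `|e|` times the increment of `F` over the
    -- interval between `b` and `b + e`, so the shift inequality applies.
    intro e he
    rcases le_total 0 e with h0 | h0
    · have h3 := hsh b' (b' + e) (by linarith) (by linarith [he.2])
      rw [show b' + e + (b - b') = b + e by ring, show b' + (b - b') = b by ring,
        add_sub_cancel_left] at h3
      nlinarith
    · have h3 := hsh (b' + e) b' (by linarith) (by linarith [he.2])
      rw [show b' + e + (b - b') = b + e by ring, show b' + (b - b') = b by ring,
        sub_add_cancel_left] at h3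
      nlinarith
  have h3 := meanSlope_nonneg (b := b) (h.continuous hlu hη) h.mono hε
  unfold meanMarginal
  have h4 : b' * meanSlope F ε b ≤ b * meanSlope F ε b := by gcongr
  have h5 : b' * (meanSlope F ε b' - η * (2 * ε)) ≤ b' * meanSlope F ε b := by gcongr
  have h6 : b' * (η * (2 * ε)) ≤ u * (η * (2 * ε)) := by
    gcongr
    linarith
  nlinarith

end IHRCdf

/-! ### The sign change of the smoothed marginal profit -/

namespace IHRCdf

variable {l u η : ℝ} {F f : ℝ → ℝ} {ε o : ℝ}

/-- The constant in the bounds of the marginal profit of the smoothed demand. -/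
def marginalConst (l u η : ℝ) : ℝ :=
  4 * u * densityBound l u η ^ 2 + 3 * u * η + 4 * densityBound l u η + 2 / u

/-- Above the optimum `o`, the hazard inequality gives `b * f b ≥ (b / o) * (1 - F b)`, so the
marginal profit is about `-(b / o - 1)` times demand, and `1 / o ≥ 1 / u`. The errors are multiplied
by `b / o`, which is bounded because `o` is bounded below. -/
lemma meanMarginal_le_of_opt_le (h : IHRCdf l u η F f)
    (ho : ∀ p, p * (1 - F p) ≤ o * (1 - F o)) (hl : 0 ≤ l) (hlu : l < u) (hη : 0 < η)
    (hε : 0 < ε) {b : ℝ} (hb : l + ε ≤ b) (hbu : b ≤ u - ε) (hob : o ≤ b) :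
    meanMarginal F ε b ≤ -((b - o) * meanDemand F ε b / u)
      + (4 * u * densityBound l u η ^ 2 + u * η) * ε := by
  have hM := densityBound_pos hlu hη
  set M := densityBound l u η
  have ho0 := opt_pos h ho hl hlu hη
  have ho1 := le_opt' h ho hl hlu hη
  have hou := opt_lt h ho hl hlu hη
  have h1 := survival_le_of_opt_le h ho hl hlu hη hob (show b < u by linarith)
  have h2 := abs_le.1 (h.abs_meanDemand_sub_le (b := b) hlu hη hε b)
  have h3 := abs_le.1 (h.abs_meanSlope_sub_le hlu hη hε hb hbu)
  have hA0 := h.meanDemand_nonneg (b := b) hlu hη hε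
  change -(M * _) ≤ _ ∧ _ ≤ M * _ at h2
  simp only [sub_self, abs_zero, zero_add] at h2
  unfold meanMarginal
  set A := meanDemand F ε b
  set s := meanSlope F ε b
  have hb0 : 0 < b := by linarith
  have h4 : A - M * ε ≤ o * f b := by linarith
  have h5 : b * (f b - η * ε) ≤ b * s := by gcongr; linarith
  have h6 : b * (η * ε) ≤ u * (η * ε) := by gcongr; linarith
  have h7 : b / o * (A - M * ε) ≤ b * f b := by
    calc b / o * (A - M * ε) ≤ b / o * (o * f b) := by gcongr
      _ = b * f b := by field_simp
  have h8 : b / o ≤ 4 * u * M := by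
    rw [div_le_iff₀ ho0]
    have : 1 ≤ o * (4 * M) := by rwa [div_le_iff₀ (by positivity)] at ho1
    nlinarith
  have h9 : b / o * (M * ε) ≤ 4 * u * M * (M * ε) := by gcongr
  have h10 : (b - o) * A / u ≤ (b - o) * A / o := by
    have : 0 ≤ b - o := by linarith
    gcongr
  have h11 : (b - o) * A / o = b / o * A - A := by field_simp
  nlinarith

/-- The same comparison with the reversed hazard inequality. Here `b / o ≤ 1`, and `l + ε ≤ b ≤ o`
makes the optimum interior. -/
lemma le_meanMarginal_of_le_opt (h : IHRCdf l u η F f)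
    (ho : ∀ p, p * (1 - F p) ≤ o * (1 - F o)) (hl : 0 ≤ l) (hlu : l < u) (hη : 0 < η)
    (hε : 0 < ε) {b : ℝ} (hb : l + ε ≤ b) (hbu : b ≤ u - ε) (hob : b ≤ o) :
    (o - b) * meanDemand F ε b / u - (densityBound l u η + u * η) * ε ≤ meanMarginal F ε b := by
  have hM := densityBound_pos hlu hη
  set M := densityBound l u η
  have ho0 := opt_pos h ho hl hlu hη
  have hou := opt_lt h ho hl hlu hη
  have h1 := le_survival_of_le_opt h ho hl hlu hη (show l < o by linarith)
    (show l ≤ b by linarith) hob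
  have h2 := abs_le.1 (h.abs_meanDemand_sub_le (b := b) hlu hη hε b)
  have h3 := abs_le.1 (h.abs_meanSlope_sub_le hlu hη hε hb hbu)
  have hA0 := h.meanDemand_nonneg (b := b) hlu hη hε
  change -(M * _) ≤ _ ∧ _ ≤ M * _ at h2
  simp only [sub_self, abs_zero, zero_add] at h2
  unfold meanMarginal
  set A := meanDemand F ε b
  set s := meanSlope F ε b
  have hb0 : 0 < b := by linarith
  have h4 : o * f b ≤ A + M * ε := by linarith
  have h5 : b * s ≤ b * (f b + η * ε) := by gcongr; linarith
  have h6 : b * (η * ε) ≤ u * (η * ε) := by gcongr; linarith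
  have h7 : b * f b ≤ b / o * (A + M * ε) := by
    calc b * f b = b / o * (o * f b) := by field_simp
      _ ≤ b / o * (A + M * ε) := by gcongr
  have h8 : b / o ≤ 1 := by rw [div_le_one ho0]; exact hob
  have h9 : b / o * (M * ε) ≤ 1 * (M * ε) := by gcongr
  have h10 : (o - b) * A / u ≤ (o - b) * A / o := by
    have : 0 ≤ o - b := by linarith
    gcongr
  have h11 : (o - b) * A / o = A - b / o * A := by field_simp
  nlinarith

/-- The smoothed marginal profit changes sign, up to an error of order `ε`, at a single price near
the optimal price. -/
lemma exists_approx_root (h : IHRCdf l u η F f)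
    (ho : ∀ p, p * (1 - F p) ≤ o * (1 - F o)) (hl : 0 ≤ l) (hlu : l < u) (hη : 0 < η)
    (hε : 0 < ε) (hεu : l + 2 * ε ≤ u) (hεM : ε ≤ 1 / (16 * densityBound l u η)) :
    ∃ b₀, |b₀ - o| ≤ 2 * ε ∧ ∀ b, 0 ≤ b → b ≤ u - ε →
      (b ≤ b₀ → (b₀ - b) * meanDemand F ε b / u - marginalConst l u η * ε ≤ meanMarginal F ε b) ∧
      (b₀ ≤ b →
        meanMarginal F ε b ≤ -((b - b₀) * meanDemand F ε b / u) + marginalConst l u η * ε) := by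
  have hM := densityBound_pos hlu hη
  have hR := fun b => meanMarginal_le_of_opt_le (b := b) h ho hl hlu hη hε
  have hL := fun b => le_meanMarginal_of_le_opt (b := b) h ho hl hlu hη hε
  have hN := fun b b' => h.meanMarginal_le_of_le (b := b) (b' := b') hlu hη hε hεu
  have hA0 := fun b => h.meanDemand_nonneg (b := b) hlu hη hε
  have hA1 := fun b => h.meanDemand_le_one (b := b) hlu hη hε
  have hAl := fun b p => h.abs_meanDemand_sub_le (b := b) hlu hη hε p
  have hou := opt_lt h ho hl hlu hη
  have hlo := le_opt h ho
  have ho1 := le_opt' h ho hl hlu hη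
  have hu : 0 < u := by linarith
  have hC : marginalConst l u η * ε = (4 * u * densityBound l u η ^ 2 + u * η) * ε
      + u * (2 * η * ε) + 4 * densityBound l u η * ε + 2 * ε / u := by
    unfold marginalConst; ring
  have hC1 : 0 ≤ (4 * u * densityBound l u η ^ 2 + u * η) * ε := by positivity
  have hC2 : 0 ≤ u * (2 * η * ε) := by positivity
  have hC3 : 0 ≤ 4 * densityBound l u η * ε := by positivity
  have hC4 : 0 ≤ 2 * ε / u := by positivity
  have hC5 : 0 ≤ u * η * ε := by positivity
  have hC6 : 0 ≤ (4 * u * densityBound l u η ^ 2) * ε := by positivity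
  -- Below `l - ε` everybody buys and the marginal profit is exactly 1, which dominates `(b₀ - b) *
  -- A b / u`.
  have hlow : ∀ b₀ ≤ u, ∀ b, 0 ≤ b → b < l - ε → b ≤ b₀ →
      (b₀ - b) * meanDemand F ε b / u - marginalConst l u η * ε ≤ meanMarginal F ε b := by
    intro b₀ hb₀ b hb hbl hbb
    rw [h.meanMarginal_of_le hlu hη hε hbl.le]
    have : (b₀ - b) * meanDemand F ε b / u ≤ 1 := by
      rw [div_le_one hu]
      have := hA0 b
      have := hA1 b
      nlinarith
    linarith
  have hsmall : ∀ t b, t ≤ 2 * ε → t * meanDemand F ε b / u ≤ 2 * ε / u := by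
    intro t b ht
    have := hA0 b
    have := hA1 b
    rw [div_le_div_iff_of_pos_right hu]
    nlinarith
  -- Away from the kink at `l` the optimum itself serves as `b₀`. Otherwise `o` lies in `[l, l +
  -- ε)`, possibly at the corner, and `b₀` is chosen in the smoothing window around `l`.
  rcases le_or_gt (l + ε) o with h1 | h1
  · refine ⟨o, by simp [hε.le], fun b hb hbu => ⟨fun hbo => ?_, fun hob => ?_⟩⟩
    · rcases lt_or_ge b (l - ε) with h2 | h2
      · exact hlow o hou.le b hb h2 hbo
      · rcases le_or_gt (l + ε) b with h3 | h3
        · have := hL b h3 hbu hbo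
          linarith
        -- In the window around `l` the bound at `l + ε` is transported down by almost-monotonicity;
        -- price and mean demand change by only O(ε) on the way.
        · have h4 := hL (l + ε) le_rfl (by linarith) h1
          have h5 := hN (l + ε) b hb h2 h3.le le_rfl
          have h6 := abs_le.1 (hAl b b)
          have h7 := abs_le.1 (hAl (l + ε) b)
          have h8 : |l + ε - b| ≤ 2 * ε := by rw [abs_of_pos] <;> linarith
          have h9 : densityBound l u η * (|l + ε - b| + ε) ≤ densityBound l u η * (2 * ε + ε) := by
            gcongr
          simp only [sub_self, abs_zero, zero_add] at h6
          have h10 : meanDemand F ε b ≤ meanDemand F ε (l + ε) + 4 * densityBound l u η * ε := by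
            linarith
          have h11 : (o - b) * meanDemand F ε b ≤
              (o - (l + ε)) * meanDemand F ε (l + ε) + u * (4 * densityBound l u η * ε)
                + 2 * ε := by
            have e1 : (o - (l + ε)) * meanDemand F ε b ≤ (o - (l + ε)) *
              (meanDemand F ε (l + ε) + 4 * densityBound l u η * ε) := by
              apply mul_le_mul_of_nonneg_left h10; linarith
            have e2 : (l + ε - b) * meanDemand F ε b ≤ 2 * ε * 1 := by
              apply mul_le_mul _ (hA1 b) (hA0 b) <;> linarith
            have e3 : (o - (l + ε)) * (4 * densityBound l u η * ε) ≤
                u * (4 * densityBound l u η * ε) := by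
              apply mul_le_mul_of_nonneg_right _ hC3; linarith
            linarith
          have h12 : (o - b) * meanDemand F ε b / u ≤
              (o - (l + ε)) * meanDemand F ε (l + ε) / u + 4 * densityBound l u η * ε
                + 2 * ε / u := by
            calc _ ≤ ((o - (l + ε)) * meanDemand F ε (l + ε) + u * (4 * densityBound l u η * ε)
                + 2 * ε) / u := by gcongr
              _ = _ := by field_simp
          -- The errors to the left of `o` involve `densityBound` to the first power; `1 ≤ 4 * u *
          -- densityBound l u η` lets the quadratic term of `marginalConst` absorb them.
          have h13 : densityBound l u η * ε ≤ 4 * u * densityBound l u η ^ 2 * ε := by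
            have := one_le_densityBound_mul hlu hη
            have h14 : 1 ≤ 4 * u * densityBound l u η := by nlinarith
            have h15 : 0 ≤ densityBound l u η * ε := by positivity
            nlinarith
          linarith
    · have := hR b (h1.trans hob) hbu hob
      linarith
  -- If the marginal profit is still nonnegative at the right end of the window, that end is a valid
  -- `b₀`; otherwise the sign changes inside the window.
  · rcases le_or_gt 0 (meanMarginal F ε (l + ε)) with h2 | h2
    · refine ⟨l + ε, by rw [abs_le]; constructor <;> linarith,
        fun b hb hbu => ⟨fun hbo => ?_, fun hob => ?_⟩⟩
      · rcases lt_or_ge b (l - ε) with h3 | h3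
        · exact hlow _ (by linarith) b hb h3 hbo
        · have h5 := hN (l + ε) b hb h3 hbo le_rfl
          have h6 := hsmall (l + ε - b) b (by linarith)
          linarith
      · have h3 := hR b hob hbu (by linarith)
        have h4 : (b - (l + ε)) * meanDemand F ε b / u ≤ (b - o) * meanDemand F ε b / u := by
          have := hA0 b
          gcongr
        linarith
    -- Since `o < l + ε` and `o ≥ 1 / (4 * densityBound l u η) ≥ 4 * ε`, the window contains no
    -- negative prices. The marginal profit is 1 at its left end and negative at its right end, so
    -- it has a zero inside.
    · have hle : 0 ≤ l - ε := by
        have : 1 / (4 * densityBound l u η) = 4 * (1 / (16 * densityBound l u η)) := by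
          field_simp; norm_num
        linarith
      have hroot : (0 : ℝ) ∈ meanMarginal F ε '' Set.Icc (l - ε) (l + ε) := by
        apply intermediate_value_Icc' (by linarith)
          (continuous_meanMarginal (h.continuous hlu hη)).continuousOn
        rw [h.meanMarginal_of_le hlu hη hε le_rfl]
        exact ⟨h2.le, zero_le_one⟩
      obtain ⟨b₀, hb₀, hG⟩ := hroot
      refine ⟨b₀, by rw [abs_le]; constructor <;> linarith [hb₀.1, hb₀.2],
        fun b hb hbu => ⟨fun hbo => ?_, fun hob => ?_⟩⟩
      · rcases lt_or_ge b (l - ε) with h3 | h3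
        · exact hlow _ (by linarith [hb₀.2]) b hb h3 hbo
        · have h5 := hN b₀ b hb h3 hbo hb₀.2
          have h6 := hsmall (b₀ - b) b (by linarith [hb₀.2])
          linarith
      · rcases le_or_gt (l + ε) b with h3 | h3
        · have h4 := hR b h3 hbu (by linarith)
          have h5 := hsmall (o - b₀) b (by linarith [hb₀.1])
          have h6 : (b - b₀) * meanDemand F ε b / u = (b - o) * meanDemand F ε b / u
            + (o - b₀) * meanDemand F ε b / u := by ring
          linarith
        · have h5 := hN b b₀ (by linarith [hb₀.1]) hb₀.1 hob h3.le
          have h6 := hsmall (b - b₀) b (by linarith [hb₀.1])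
          linarith

end IHRCdf

/-! ### The Lyapunov function and its drift along the mean dynamics -/

/-- Bounds for the mean dynamics `b' = b ^ 2 * G b / (2 * x)`, `x' = b * A b - x` of the price `b`
and the predicted profit `x` on the price range `[b₁, b₂]`, with rest point `(b₀, x₀)` up to an
error of order `ε`. -/
structure DriftBounds (b₁ br b₂ c q κ L C xlo xhi ε : ℝ) (A G : ℝ → ℝ) (b₀ x₀ : ℝ) : Prop where
  br_le : br ≤ b₀
  le_right : b₀ + 2 * c ≤ b₂
  xlo_le : xlo ≤ x₀
  le_xhi : x₀ ≤ xhi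
  nonneg : ∀ b ∈ Set.Icc b₁ b₂, 0 ≤ A b
  le_one : ∀ b ∈ Set.Icc b₁ b₂, A b ≤ 1
  lower : ∀ b ∈ Set.Icc b₁ b₂, b ≤ b₀ + 2 * c → q ≤ A b
  left : ∀ b ∈ Set.Icc b₁ b₂, b ≤ b₀ → κ * ((b₀ - b) * A b) - C * ε ≤ G b
  right : ∀ b ∈ Set.Icc b₁ b₂, b₀ ≤ b → G b ≤ -(κ * ((b - b₀) * A b)) + C * ε
  profit : ∀ b ∈ Set.Icc b₁ b₂, b ≤ b₀ + 2 * c → |b * A b - x₀| ≤ L * |b - b₀| + C * ε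

/-- The relative-entropy-like function `x - x₀ - x₀ * log (x / x₀)`. -/
def entropyGap (x₀ x : ℝ) : ℝ := x - x₀ - x₀ * Real.log (x / x₀)

/-- The Lyapunov function of the price `b` and the predicted profit `x`. -/
def lyap (K₁ K₂ E c b₀ x₀ b x : ℝ) : ℝ :=
  K₁ * (max (b₀ - b) 0) ^ 2 + K₂ * (max (b - b₀) 0) ^ 2 + entropyGap x₀ x
    + E * x * (max (b - b₀ - c) 0) ^ 2

/-- The partial derivative of `lyap` with respect to the price. -/
def lyapB (K₁ K₂ E c b₀ b x : ℝ) : ℝ :=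
  2 * (-(K₁ * max (b₀ - b) 0) + K₂ * max (b - b₀) 0 + E * x * max (b - b₀ - c) 0)

/-- The partial derivative of `lyap` with respect to the predicted profit. -/
def lyapX (E c b₀ x₀ b x : ℝ) : ℝ := 1 - x₀ / x + E * (max (b - b₀ - c) 0) ^ 2

section EntropyGap

variable {x₀ x : ℝ}

lemma entropyGap_nonneg (h₀ : 0 < x₀) (hx : 0 < x) : 0 ≤ entropyGap x₀ x := by
  have h1 := Real.log_le_sub_one_of_pos (show 0 < x / x₀ by positivity)
  have h2 : x₀ * Real.log (x / x₀) ≤ x₀ * (x / x₀ - 1) := by gcongr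
  have h3 : x₀ * (x / x₀ - 1) = x - x₀ := by field_simp
  unfold entropyGap
  linarith

/-- Quadratic upper bound, from `log z ≥ 1 - 1 / z`. It lets a quadratic decrease dominate a
multiple of the Lyapunov function. -/
lemma mul_entropyGap_le (h₀ : 0 < x₀) (hx : 0 < x) : x * entropyGap x₀ x ≤ (x - x₀) ^ 2 := by
  have h1 := Real.one_sub_inv_le_log_of_pos (show 0 < x / x₀ by positivity)
  have h2 : x * x₀ * (1 - (x / x₀)⁻¹) ≤ x * x₀ * Real.log (x / x₀) := by gcongr
  have h3 : x * x₀ * (1 - (x / x₀)⁻¹) = x * x₀ - x₀ ^ 2 := by field_simp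
  unfold entropyGap
  nlinarith

lemma half_sub_le_entropyGap (h₀ : 0 < x₀) (hx : 0 < x) : x / 2 - x₀ ≤ entropyGap x₀ x := by
  have hz : 0 < x / x₀ := by positivity
  have h1 := Real.log_le_sub_one_of_pos (show 0 < x / x₀ / 2 by positivity)
  rw [Real.log_div hz.ne' (by norm_num)] at h1
  have h2 := Real.log_le_sub_one_of_pos (show (0 : ℝ) < 2 by norm_num)
  have h3 : x₀ * Real.log (x / x₀) ≤ x₀ * (x / x₀ / 2) := by
    gcongr
    linarith
  have h4 : x₀ * (x / x₀ / 2) = x / 2 := by field_simp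
  unfold entropyGap
  linarith

/-- The logarithmic barrier at `x = 0`, which keeps the predicted profit away from zero. -/
lemma le_entropyGap_of_le_exp {xlo v : ℝ} (hlo : 0 < xlo) (h₀ : xlo ≤ x₀) (hx : 0 < x)
    (hv : 0 ≤ v) (h : x ≤ xlo * Real.exp (-((v + x₀) / xlo))) : v ≤ entropyGap x₀ x := by
  have hx₀ : 0 < x₀ := by linarith
  have h1 : x / x₀ ≤ Real.exp (-((v + x₀) / xlo)) := by
    rw [div_le_iff₀ hx₀]
    have := Real.exp_pos (-((v + x₀) / xlo))
    nlinarith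
  have h2 : Real.log (x / x₀) ≤ -((v + x₀) / xlo) := by
    rw [Real.log_le_iff_le_exp (by positivity)]
    exact h1
  have h3 : x₀ * ((v + x₀) / xlo) ≤ -(x₀ * Real.log (x / x₀)) := by nlinarith
  have h4 : v + x₀ ≤ x₀ * ((v + x₀) / xlo) := by
    rw [mul_div_assoc', le_div_iff₀ hlo]
    nlinarith
  unfold entropyGap
  linarith

/-- With `x = p ^ 2` and `x₀ = r ^ 2`, the inequality `log (p / r) ≤ p / r - 1` shows that the gap
is at least `(p - r) ^ 2`; the remaining factor `(p + r) ^ 2` is at most `4 * X`. -/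
lemma sq_sub_le_entropyGap {X : ℝ} (h₀ : 0 < x₀) (hx : 0 < x) (h₀X : x₀ ≤ X) (hX : x ≤ X) :
    (x - x₀) ^ 2 ≤ 4 * X * entropyGap x₀ x := by
  obtain ⟨p, hp, rfl⟩ : ∃ p, 0 < p ∧ x = p ^ 2 := ⟨√x, by positivity, (Real.sq_sqrt hx.le).symm⟩
  obtain ⟨r, hr, rfl⟩ : ∃ p, 0 < p ∧ x₀ = p ^ 2 :=
    ⟨√x₀, by positivity, (Real.sq_sqrt h₀.le).symm⟩
  have h1 := Real.log_le_sub_one_of_pos (show 0 < p / r by positivity)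
  have h2 : (p - r) ^ 2 ≤ entropyGap (r ^ 2) (p ^ 2) := by
    unfold entropyGap
    rw [← div_pow, Real.log_pow]
    have h3 : r ^ 2 * (2 * Real.log (p / r)) ≤ r ^ 2 * (2 * (p / r - 1)) := by gcongr
    have h4 : r ^ 2 * (2 * (p / r - 1)) = 2 * p * r - 2 * r ^ 2 := by field_simp
    push_cast
    nlinarith
  have h3 : (p + r) ^ 2 ≤ 4 * X := by nlinarith [sq_nonneg (p - r)]
  calc (p ^ 2 - r ^ 2) ^ 2 = (p + r) ^ 2 * (p - r) ^ 2 := by ring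
    _ ≤ 4 * X * entropyGap (r ^ 2) (p ^ 2) :=
        mul_le_mul h3 h2 (sq_nonneg _) (by linarith [sq_nonneg (p + r)])

end EntropyGap

lemma lyap_nonneg {K₁ K₂ E c b₀ x₀ b x : ℝ} (hK₁ : 0 ≤ K₁) (hK₂ : 0 ≤ K₂) (hE : 0 ≤ E)
    (h₀ : 0 < x₀) (hx : 0 < x) : 0 ≤ lyap K₁ K₂ E c b₀ x₀ b x := by
  have := entropyGap_nonneg h₀ hx
  unfold lyap
  positivity

namespace DriftBounds

variable {b₁ br b₂ c q κ L C xlo xhi ε : ℝ} {A G : ℝ → ℝ} {b₀ x₀ : ℝ}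

/-- Split `b * A b - x` at `x₀` and apply Young's inequality: half of `(x - x₀) ^ 2` pays for the
dependence of profit on the price. -/
lemma cross_le (h : DriftBounds b₁ br b₂ c q κ L C xlo xhi ε A G b₀ x₀)
    (hε : 0 < ε) (hε1 : ε ≤ 1) {b x : ℝ} (hb : b ∈ Set.Icc b₁ b₂) (hb' : b ≤ b₀ + 2 * c) :
    (x - x₀) * (b * A b - x) ≤ L ^ 2 * (b - b₀) ^ 2 + C ^ 2 * ε - (x - x₀) ^ 2 / 2 := by
  have h1 := h.profit b hb hb'
  have h2 : (x - x₀) * (b * A b - x₀) ≤ |x - x₀| * (L * |b - b₀| + C * ε) := by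
    refine (le_abs_self _).trans ?_
    rw [abs_mul]
    gcongr
  have h3 : ε ^ 2 ≤ ε := by nlinarith
  have h4 : C ^ 2 * ε ^ 2 ≤ C ^ 2 * ε := by gcongr
  rw [← sq_abs (b - b₀), ← sq_abs (x - x₀)]
  have h5 : (x - x₀) * (b * A b - x) = (x - x₀) * (b * A b - x₀) - |x - x₀| ^ 2 := by
    rw [sq_abs]; ring
  nlinarith [sq_nonneg (|x - x₀| / 2 - L * |b - b₀|), sq_nonneg (|x - x₀| / 2 - C * ε)]

/-- Below `b₀` demand is at least `q`, so the price decrease is truly quadratic, and `K₁` is large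
enough for it to outweigh the cross term. -/
lemma left_drift (h : DriftBounds b₁ br b₂ c q κ L C xlo xhi ε A G b₀ x₀)
    (hb₁ : 0 < b₁) (hc : 0 < c) (hq : 0 < q) (hκ : 0 < κ) (hC : 0 < C)
    (hε : 0 < ε) (hε1 : ε ≤ 1) {K₁ b x : ℝ} (hK : 0 ≤ K₁)
    (hK₁ : L ^ 2 + 1 ≤ K₁ * (b₁ ^ 2 * κ * q)) (hb : b ∈ Set.Icc b₁ b₂) (hb' : b ≤ b₀) :
    -(K₁ * (b₀ - b)) * (b ^ 2 * G b) + (x - x₀) * (b * A b - x) ≤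
      -(b - b₀) ^ 2 - (x - x₀) ^ 2 / 2 + (K₁ * (b₂ ^ 3 * C) + C ^ 2) * ε := by
  have h1 := h.cross_le hε hε1 (x := x) hb (by linarith)
  have h2 := h.left b hb hb'
  have h3 := h.lower b hb (by linarith)
  have h4 := h.le_right
  have hb0 : 0 < b := by linarith [hb.1]
  set t := b₀ - b with ht
  have ht0 : 0 ≤ t := by linarith
  have htb : t ≤ b₂ := by linarith
  have hb20 : 0 < b₂ := by linarith
  have h5 : t * b ^ 2 * (κ * (t * A b) - C * ε) ≤ t * b ^ 2 * G b := by gcongr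
  have h6 : t ^ 2 * (b₁ ^ 2 * κ * q) ≤ t * b ^ 2 * (κ * (t * A b)) := by
    calc t ^ 2 * (b₁ ^ 2 * κ * q) ≤ t ^ 2 * (b ^ 2 * κ * A b) := by
          have := hb.1
          gcongr
      _ = _ := by ring
  have h7 : t * b ^ 2 * (C * ε) ≤ b₂ ^ 3 * C * ε := by
    calc t * b ^ 2 * (C * ε) ≤ b₂ * b₂ ^ 2 * (C * ε) := by
          have := hb.2
          gcongr
      _ = _ := by ring
  have h8 : K₁ * (t ^ 2 * (b₁ ^ 2 * κ * q) - b₂ ^ 3 * C * ε) ≤ K₁ * (t * b ^ 2 * G b) := by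
    gcongr
    linarith
  have h9 : (L ^ 2 + 1) * t ^ 2 ≤ K₁ * (b₁ ^ 2 * κ * q) * t ^ 2 := by gcongr
  have h10 : (b - b₀) ^ 2 = t ^ 2 := by rw [ht]; ring
  rw [h10] at h1 ⊢
  linarith

/-- The leading part of `G` has the favourable sign here, so only its O(ε) error can raise the extra
term. -/
lemma right_error_le (h : DriftBounds b₁ br b₂ c q κ L C xlo xhi ε A G b₀ x₀)
    (hb₁ : 0 < b₁) (hbr : 0 < br) (hc : 0 < c) (hκ : 0 < κ) (hC : 0 < C)
    (hε : 0 < ε) {E b x X : ℝ} (hE : 0 ≤ E) (hx : 0 < x) (hxX : x ≤ X)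
    (hb : b ∈ Set.Icc b₁ b₂) (hb' : b₀ ≤ b) :
    E * x * max (b - b₀ - c) 0 * (b ^ 2 * G b) ≤ E * X * (b₂ ^ 3 * C) * ε := by
  have h2 := h.right b hb hb'
  have hA := h.nonneg b hb
  have hb0 : 0 < b := by linarith [hb.1]
  have hw : max (b - b₀ - c) 0 ≤ b₂ := by
    apply max_le <;> linarith [hb.2, h.br_le]
  have hw0 : 0 ≤ max (b - b₀ - c) 0 := le_max_right _ _
  have hb20 : 0 < b₂ := by linarith [hb.2]
  have hX0 : 0 < X := by linarith
  have h3 : G b ≤ C * ε := by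
    have : 0 ≤ κ * ((b - b₀) * A b) := by
      have : 0 ≤ b - b₀ := by linarith
      positivity
    linarith
  calc E * x * max (b - b₀ - c) 0 * (b ^ 2 * G b)
      ≤ E * x * max (b - b₀ - c) 0 * (b ^ 2 * (C * ε)) := by gcongr
    _ ≤ E * X * b₂ * (b₂ ^ 2 * (C * ε)) := by
        have := hb.2
        gcongr
    _ = _ := by ring

/-- Demand is still at least `q`. The additional `E` term contributes at most `E * b₂ ^ 2 * (b - b₀)
^ 2`, since `x * (b * A b - x) ≤ b₂ ^ 2`; a larger `K₂` absorbs it. -/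
lemma mid_drift (h : DriftBounds b₁ br b₂ c q κ L C xlo xhi ε A G b₀ x₀)
    (hb₁ : 0 < b₁) (hbr : 0 < br) (hc : 0 < c) (hq : 0 < q) (hκ : 0 < κ) (hC : 0 < C)
    (hε : 0 < ε) (hε1 : ε ≤ 1) {K₂ E b x X : ℝ} (hK : 0 ≤ K₂) (hE : 0 ≤ E) (hx : 0 < x)
    (hxX : x ≤ X)
    (hK₂ : L ^ 2 + E * b₂ ^ 2 + 1 ≤ K₂ * (b₁ ^ 2 * κ * q)) (hb : b ∈ Set.Icc b₁ b₂)
    (hb' : b₀ ≤ b) (hb'' : b ≤ b₀ + 2 * c) :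
    (K₂ * (b - b₀) + E * x * max (b - b₀ - c) 0) * (b ^ 2 * G b)
        + (x - x₀ + E * x * max (b - b₀ - c) 0 ^ 2) * (b * A b - x) ≤
      -(b - b₀) ^ 2 - (x - x₀) ^ 2 / 2 + (K₂ * (b₂ ^ 3 * C) + E * X * (b₂ ^ 3 * C) + C ^ 2) * ε := by
  have h1 := h.cross_le hε hε1 (x := x) hb hb''
  have h2 := h.right b hb hb'
  have h3 := h.lower b hb hb''
  have h4 := h.right_error_le hb₁ hbr hc hκ hC hε hE hx hxX hb hb'
  have hA := h.nonneg b hb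
  have hA1 := h.le_one b hb
  have hb0 : 0 < b := by linarith [hb.1]
  set w := max (b - b₀ - c) 0
  have hw0 : 0 ≤ w := le_max_right _ _
  have hw : w ≤ b - b₀ := max_le (by linarith) (by linarith)
  set t := b - b₀ with ht
  have ht0 : 0 ≤ t := by linarith
  have htb : t ≤ b₂ := by linarith [hb.2, h.br_le]
  have hb20 : 0 < b₂ := by linarith [hb.2]
  have h5 : t * b ^ 2 * G b ≤ t * b ^ 2 * (-(κ * (t * A b)) + C * ε) := by gcongr
  have h6 : t ^ 2 * (b₁ ^ 2 * κ * q) ≤ t * b ^ 2 * (κ * (t * A b)) := by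
    calc t ^ 2 * (b₁ ^ 2 * κ * q) ≤ t ^ 2 * (b ^ 2 * κ * A b) := by
          have := hb.1
          gcongr
      _ = _ := by ring
  have h7 : t * b ^ 2 * (C * ε) ≤ b₂ ^ 3 * C * ε := by
    calc t * b ^ 2 * (C * ε) ≤ b₂ * b₂ ^ 2 * (C * ε) := by
          have := hb.2
          gcongr
      _ = _ := by ring
  have h8 : K₂ * (t * b ^ 2 * G b) ≤ K₂ * (-(t ^ 2 * (b₁ ^ 2 * κ * q)) + b₂ ^ 3 * C * ε) := by
    gcongr
    linarith
  have h9 : (L ^ 2 + E * b₂ ^ 2 + 1) * t ^ 2 ≤ K₂ * (b₁ ^ 2 * κ * q) * t ^ 2 := by gcongr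
  have h10 : x * (b * A b - x) ≤ b₂ ^ 2 := by
    have h11 : b * A b ≤ b₂ := by nlinarith [hb.2]
    have h12 : 0 ≤ b * A b := by positivity
    nlinarith [sq_nonneg (x - b * A b)]
  have h13 : E * w ^ 2 * (x * (b * A b - x)) ≤ E * t ^ 2 * b₂ ^ 2 := by
    calc E * w ^ 2 * (x * (b * A b - x)) ≤ E * w ^ 2 * b₂ ^ 2 := by gcongr
      _ ≤ _ := by gcongr
  linarith

/-- Demand `A b` may be arbitrarily small here. All positive terms proportional to `A b` are
dominated by the push with weight `K₂`. The terms without `A b` are `x₀ * x - x ^ 2 - E * w ^ 2 * x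
^ 2`, and the choice of `E` gives `E * w ^ 2 * x ≥ 2 * x₀`, so they sum to at most `-x₀ * x`. -/
lemma far_drift (h : DriftBounds b₁ br b₂ c q κ L C xlo xhi ε A G b₀ x₀)
    (hb₁ : 0 < b₁) (hbr : 0 < br) (hc : 0 < c) (hκ : 0 < κ) (hC : 0 < C) (hlo : 0 < xlo)
    (hε : 0 < ε) {K₂ E b x x₁ X : ℝ} (hK : 0 ≤ K₂) (hE : 0 ≤ E) (hx₁ : 0 < x₁)
    (hx : x₁ ≤ x) (hxX : x ≤ X) (hEx : 2 * xhi ≤ E * c ^ 2 * x₁)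
    (hK₂ : b₂ * (X * (1 + E * b₂ ^ 2)) ≤ K₂ * (4 * c ^ 2 * b₁ ^ 2 * κ))
    (hb : b ∈ Set.Icc b₁ b₂) (hb'' : b₀ + 2 * c ≤ b) :
    (K₂ * (b - b₀) + E * x * max (b - b₀ - c) 0) * (b ^ 2 * G b)
        + (x - x₀ + E * x * max (b - b₀ - c) 0 ^ 2) * (b * A b - x) ≤
      -(xlo * x₁) + (K₂ * (b₂ ^ 3 * C) + E * X * (b₂ ^ 3 * C)) * ε := by
  have hb' : b₀ ≤ b := by linarith
  have hx0 : 0 < x := by linarith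
  have h2 := h.right b hb hb'
  have h4 := h.right_error_le hb₁ hbr hc hκ hC hε hE hx0 hxX hb hb'
  have hA := h.nonneg b hb
  have hA1 := h.le_one b hb
  have hb0 : 0 < b := by linarith [hb.1]
  have hx₀ : 0 < x₀ := by linarith [h.xlo_le]
  set w := max (b - b₀ - c) 0 with hwd
  have hw0 : 0 ≤ w := le_max_right _ _
  have hwc : c ≤ w := le_max_of_le_left (by linarith)
  have hw : w ≤ b₂ := max_le (by linarith [hb.2, h.br_le]) (by linarith [hb.2])
  set t := b - b₀ with ht
  have ht0 : 0 ≤ t := by linarith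
  have htc : 2 * c ≤ t := by linarith
  have htb : t ≤ b₂ := by linarith [hb.2, h.br_le]
  have hb20 : 0 < b₂ := by linarith [hb.2]
  have h5 : t * b ^ 2 * G b ≤ t * b ^ 2 * (-(κ * (t * A b)) + C * ε) := by gcongr
  have h6 : (4 * c ^ 2 * b₁ ^ 2 * κ) * A b ≤ t * b ^ 2 * (κ * (t * A b)) := by
    calc (4 * c ^ 2 * b₁ ^ 2 * κ) * A b = (2 * c) ^ 2 * b₁ ^ 2 * κ * A b := by ring
      _ ≤ t ^ 2 * b ^ 2 * κ * A b := by
          have := hb.1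
          gcongr
      _ = _ := by ring
  have h7 : t * b ^ 2 * (C * ε) ≤ b₂ ^ 3 * C * ε := by
    calc t * b ^ 2 * (C * ε) ≤ b₂ * b₂ ^ 2 * (C * ε) := by
          have := hb.2
          gcongr
      _ = _ := by ring
  have h8 : K₂ * (t * b ^ 2 * G b) ≤
      K₂ * (-((4 * c ^ 2 * b₁ ^ 2 * κ) * A b) + b₂ ^ 3 * C * ε) := by
    gcongr
    linarith
  have h9 : b₂ * (X * (1 + E * b₂ ^ 2)) * A b ≤ K₂ * (4 * c ^ 2 * b₁ ^ 2 * κ) * A b := by gcongr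
  have h10 : b * A b * (x - x₀ + E * x * w ^ 2) ≤ b₂ * (X * (1 + E * b₂ ^ 2)) * A b := by
    calc b * A b * (x - x₀ + E * x * w ^ 2) ≤ b * A b * (x + E * x * w ^ 2) := by
          gcongr; linarith
      _ ≤ b₂ * A b * (X + E * X * b₂ ^ 2) := by
          have := hb.2
          have : 0 < X := by linarith
          gcongr
      _ = _ := by ring
  have h11 : 2 * x₀ * x ≤ E * w ^ 2 * x ^ 2 := by
    have e1 : E * c ^ 2 * x₁ ≤ E * w ^ 2 * x := by gcongr
    have e2 := h.le_xhi
    nlinarith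
  have h12 : xlo * x₁ ≤ x₀ * x := mul_le_mul h.xlo_le hx hx₁.le hx₀.le
  nlinarith [sq_nonneg x]

end DriftBounds

/-! ### Choice of the Lyapunov constants and of the box -/

/-- Constants for which `lyap` decreases along the mean dynamics on the box
`b ∈ [b₁, b₂]`, `x / b ∈ [y₁, y₂]`, and is at least as large outside the box as at the
reset point `(br, br)`. -/
structure LyapunovConstants (b₁ br b₂ c q κ L C xlo xhi yl yh : ℝ) where
  K₁ : ℝ
  K₂ : ℝ
  E : ℝ
  y₁ : ℝ
  y₂ : ℝ
  rate : ℝ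
  err : ℝ
  one_le_K₁ : 1 ≤ K₁
  one_le_K₂ : 1 ≤ K₂
  E_nonneg : 0 ≤ E
  y₁_pos : 0 < y₁
  y₁_lt : y₁ < yl
  lt_y₂ : yh < y₂
  rate_pos : 0 < rate
  err_pos : 0 < err
  drift : ∀ ε A G b₀ x₀, 0 < ε → ε ≤ 1 → DriftBounds b₁ br b₂ c q κ L C xlo xhi ε A G b₀ x₀ →
    ∀ b ∈ Set.Icc b₁ b₂, ∀ y ∈ Set.Icc y₁ y₂,
      lyapB K₁ K₂ E c b₀ b (b * y) * (b ^ 2 * G b / (2 * (b * y)))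
        + lyapX E c b₀ x₀ b (b * y) * (b * A b - b * y)
      ≤ -(rate * lyap K₁ K₂ E c b₀ x₀ b (b * y)) + err * ε
  exit : ∀ b₀ x₀, br ≤ b₀ → b₀ + 2 * c ≤ b₂ → xlo ≤ x₀ → x₀ ≤ xhi → ∀ b y, 0 < b → 0 < y →
    ¬(b ∈ Set.Icc b₁ b₂ ∧ y ∈ Set.Icc y₁ y₂) →
      lyap K₁ K₂ E c b₀ x₀ br br ≤ lyap K₁ K₂ E c b₀ x₀ b (b * y)

/-- The reset price lies below `b₀`, so the terms with `K₂` and `E` vanish there and the bound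
depends on `K₁` alone. This is what makes the later choice of constants non-circular. -/
lemma lyap_reset_le {K₁ K₂ E c b₀ x₀ br : ℝ} (hc : 0 < c) (hbr : br ≤ b₀) (hbr0 : 0 < br)
    (hx₀ : 0 < x₀) :
    lyap K₁ K₂ E c b₀ x₀ br br ≤ K₁ * (b₀ - br) ^ 2 + (br - x₀) ^ 2 / br := by
  have h1 : entropyGap x₀ br ≤ (br - x₀) ^ 2 / br := by
    rw [le_div_iff₀ hbr0, mul_comm]
    exact mul_entropyGap_le hx₀ hbr0
  unfold lyap
  rw [max_eq_left (by linarith), max_eq_right (by linarith : br - b₀ ≤ 0),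
    max_eq_right (by linarith : br - b₀ - c ≤ 0)]
  linarith

/-- Passing from a bound for `x` times the drift to a bound for the drift. -/
lemma drift_le_of_mul_le {x x₁ V P Q r e ε : ℝ} (hx₁ : 0 < x₁) (hx : x₁ ≤ x)
    (he : 0 ≤ e) (hε : 0 < ε) (hP : x * P ≤ -Q + e * ε) (hQ : r * (x * V) ≤ Q) :
    P ≤ -(r * V) + e / x₁ * ε := by
  have hx0 : 0 < x := by linarith
  have h1 : e * ε ≤ x * (e / x₁ * ε) := by
    calc e * ε = x₁ * (e / x₁ * ε) := by field_simp
      _ ≤ _ := by gcongr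
  have h2 : x * P ≤ x * (-(r * V) + e / x₁ * ε) := by linarith
  exact le_of_mul_le_mul_left h2 hx0

lemma exists_drift_constants {b₁ br b₂ c q κ L C xlo xhi : ℝ} (hb₁ : 0 < b₁)
    (hbr : 0 < br) (hc : 0 < c) (hq : 0 < q) (hκ : 0 < κ) (hC : 0 < C) (hlo : 0 < xlo)
    {K₁ K₂ E x₁ X : ℝ} (hK₁ : 1 ≤ K₁) (hK₂ : 1 ≤ K₂) (hE : 0 ≤ E) (hx₁ : 0 < x₁) (hX : x₁ ≤ X)
    (hK₁' : L ^ 2 + 1 ≤ K₁ * (b₁ ^ 2 * κ * q)) (hEx : 2 * xhi ≤ E * c ^ 2 * x₁)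
    (hK₂' : L ^ 2 + E * b₂ ^ 2 + 1 ≤ K₂ * (b₁ ^ 2 * κ * q))
    (hK₂'' : b₂ * (X * (1 + E * b₂ ^ 2)) ≤ K₂ * (4 * c ^ 2 * b₁ ^ 2 * κ)) :
    ∃ rate > 0, ∃ err > 0, ∀ ε A G b₀ x₀, 0 < ε → ε ≤ 1 →
      DriftBounds b₁ br b₂ c q κ L C xlo xhi ε A G b₀ x₀ →
      ∀ b ∈ Set.Icc b₁ b₂, ∀ x ∈ Set.Icc x₁ X,
      lyapB K₁ K₂ E c b₀ b x * (b ^ 2 * G b / (2 * x)) + lyapX E c b₀ x₀ b x * (b * A b - x)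
      ≤ -(rate * lyap K₁ K₂ E c b₀ x₀ b x) + err * ε := by
  have hX0 : 0 < X := by linarith
  -- `Z` bounds the ratio of `x` times the Lyapunov function to the decrease `Q`: the first two
  -- summands serve the quadratic regime near `b₀`, the fraction serves the far regime, where `Q` is
  -- the constant `xlo * x₁`.
  set Z := 2 + X * (K₁ + K₂ + E * X) + (X * (K₁ + K₂ + E * X) * b₂ ^ 2 + (X + |xhi|) ^ 2) /
    (xlo * x₁) with hZ
  have hZ2 : 2 ≤ Z := by
    have : 0 ≤ X * (K₁ + K₂ + E * X) := by positivity
    have : 0 ≤ (X * (K₁ + K₂ + E * X) * b₂ ^ 2 + (X + |xhi|) ^ 2) / (xlo * x₁) := by positivity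
    linarith
  have hZX : X * (K₁ + K₂ + E * X) ≤ Z := by
    have : 0 ≤ (X * (K₁ + K₂ + E * X) * b₂ ^ 2 + (X + |xhi|) ^ 2) / (xlo * x₁) := by positivity
    linarith
  have hZx : (X * (K₁ + K₂ + E * X) * b₂ ^ 2 + (X + |xhi|) ^ 2) ≤ Z * (xlo * x₁) := by
    have : 0 ≤ X * (K₁ + K₂ + E * X) := by positivity
    rw [← div_le_iff₀ (by positivity)]
    linarith
  have hZ0 : 0 < Z := by linarith
  set e := |K₁ * (b₂ ^ 3 * C)| + |K₂ * (b₂ ^ 3 * C) + E * X * (b₂ ^ 3 * C)| + C ^ 2 with he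
  have he0 : 0 < e := by positivity
  refine ⟨Z⁻¹, by positivity, e / x₁, by positivity, ?_⟩
  intro ε A G b₀ x₀ hε hε1 h b hb x hx
  have hx0 : 0 < x := by linarith [hx.1]
  have hx₀ : 0 < x₀ := by linarith [h.xlo_le]
  have hgap := mul_entropyGap_le hx₀ hx0
  have hb0 : 0 < b := by linarith [hb.1]
  have habs1 := le_abs_self (K₁ * (b₂ ^ 3 * C))
  have habs2 := le_abs_self (K₂ * (b₂ ^ 3 * C) + E * X * (b₂ ^ 3 * C))
  have habs3 := abs_nonneg (K₁ * (b₂ ^ 3 * C))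
  have habs4 := abs_nonneg (K₂ * (b₂ ^ 3 * C) + E * X * (b₂ ^ 3 * C))
  have hP : x * (lyapB K₁ K₂ E c b₀ b x * (b ^ 2 * G b / (2 * x))
      + lyapX E c b₀ x₀ b x * (b * A b - x)) =
      (-(K₁ * max (b₀ - b) 0) + K₂ * max (b - b₀) 0 + E * x * max (b - b₀ - c) 0) * (b ^ 2 * G b)
        + (x - x₀ + E * x * max (b - b₀ - c) 0 ^ 2) * (b * A b - x) := by
    unfold lyapB lyapX
    field_simp
  rcases le_total b b₀ with hbb | hbb
  · refine drift_le_of_mul_le (Q := (b - b₀) ^ 2 + (x - x₀) ^ 2 / 2) hx₁ hx.1 he0.le hε ?_ ?_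
    · rw [hP, max_eq_left (by linarith : 0 ≤ b₀ - b), max_eq_right (by linarith : b - b₀ ≤ 0),
        max_eq_right (by linarith : b - b₀ - c ≤ 0)]
      have h1 := h.left_drift (x := x) hb₁ hc hq hκ hC hε hε1 (by linarith) hK₁' hb hbb
      have h2 : (K₁ * (b₂ ^ 3 * C) + C ^ 2) * ε ≤ e * ε := by gcongr; linarith
      linarith
    · unfold lyap
      rw [max_eq_left (by linarith : 0 ≤ b₀ - b), max_eq_right (by linarith : b - b₀ ≤ 0),
        max_eq_right (by linarith : b - b₀ - c ≤ 0), inv_mul_le_iff₀ hZ0]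
      have h1 : x * K₁ * (b - b₀) ^ 2 ≤ Z * (b - b₀) ^ 2 := by
        gcongr
        refine le_trans ?_ hZX
        gcongr
        · exact hx.2
        · have : 0 ≤ E * X := by positivity
          linarith
      have h2 : 2 * (x - x₀) ^ 2 ≤ Z * (x - x₀) ^ 2 := by gcongr
      linarith
  · set w := max (b - b₀ - c) 0 with hw
    have hw0 : 0 ≤ w := le_max_right _ _
    have hw1 : w ≤ b - b₀ := max_le (by linarith) (by linarith)
    have hw2 : w ^ 2 ≤ (b - b₀) ^ 2 := by gcongr
    have hxV : x * lyap K₁ K₂ E c b₀ x₀ b x ≤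
        X * (K₁ + K₂ + E * X) * (b - b₀) ^ 2 + (x - x₀) ^ 2 := by
      unfold lyap
      rw [max_eq_right (by linarith : b₀ - b ≤ 0), max_eq_left (by linarith : 0 ≤ b - b₀), ← hw]
      have h1 : x * (K₂ * (b - b₀) ^ 2) ≤ X * (K₂ * (b - b₀) ^ 2) := by gcongr; exact hx.2
      have h2 : x * (E * x * w ^ 2) ≤ X * (E * X * (b - b₀) ^ 2) := by
        gcongr <;> exact hx.2
      have h3 : 0 ≤ X * K₁ * (b - b₀) ^ 2 := by positivity
      linarith
    rcases le_total b (b₀ + 2 * c) with hbc | hbc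
    · refine drift_le_of_mul_le (Q := (b - b₀) ^ 2 + (x - x₀) ^ 2 / 2) hx₁ hx.1 he0.le hε ?_ ?_
      · rw [hP, max_eq_right (by linarith : b₀ - b ≤ 0), max_eq_left (by linarith : 0 ≤ b - b₀)]
        have h1 := h.mid_drift hb₁ hbr hc hq hκ hC hε hε1 (by linarith : 0 ≤ K₂) hE hx0 hx.2
          hK₂' hb hbb hbc
        have h2 : (K₂ * (b₂ ^ 3 * C) + E * X * (b₂ ^ 3 * C) + C ^ 2) * ε ≤ e * ε := by
          gcongr; linarith
        simp only [← hw] at h1 ⊢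
        linarith
      · rw [inv_mul_le_iff₀ hZ0]
        have h1 : X * (K₁ + K₂ + E * X) * (b - b₀) ^ 2 ≤ Z * (b - b₀) ^ 2 := by gcongr
        have h2 : 2 * (x - x₀) ^ 2 ≤ Z * (x - x₀) ^ 2 := by gcongr
        have h3 := sq_nonneg (x - x₀)
        linarith
    · refine drift_le_of_mul_le (Q := xlo * x₁) hx₁ hx.1 he0.le hε ?_ ?_
      · rw [hP, max_eq_right (by linarith : b₀ - b ≤ 0), max_eq_left (by linarith : 0 ≤ b - b₀)]
        have h1 := h.far_drift hb₁ hbr hc hκ hC hlo hε (by linarith : 0 ≤ K₂) hE hx₁ hx.1 hx.2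
          hEx hK₂'' hb hbc
        have h2 : (K₂ * (b₂ ^ 3 * C) + E * X * (b₂ ^ 3 * C)) * ε ≤ e * ε := by
          gcongr
          have := sq_nonneg C
          linarith
        simp only [← hw] at h1 ⊢
        linarith
      · rw [inv_mul_le_iff₀ hZ0]
        refine le_trans (hxV.trans ?_) hZx
        have h1 : (b - b₀) ^ 2 ≤ b₂ ^ 2 := by
          have := hb.2
          have := h.br_le
          gcongr; linarith
        have h2 : (x - x₀) ^ 2 ≤ (X + |xhi|) ^ 2 := by
          apply sq_le_sq'
          · have := le_abs_self xhi
            linarith [h.le_xhi]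
          · have := abs_nonneg xhi
            linarith [hx.2]
        gcongr

/-- Outside the box the Lyapunov function is at least as large as at the reset point. -/
lemma lyap_reset_le_of_notMem {b₁ br b₂ c xlo xhi K₁ K₂ E y₁ y₂ R Vr b₀ x₀ b y : ℝ} (hb₁ : 0 < b₁)
    (hb₁r : b₁ < br) (hc : 0 < c) (hlo : 0 < xlo) (hlohi : xlo ≤ xhi)
    (hR : R = (br + xhi) ^ 2 / br) (hK₂ : 0 ≤ K₂) (hE : 0 ≤ E)
    (hK₁R : R ≤ K₁ * (br - b₁) ^ 2) (hVr : Vr = K₁ * b₂ ^ 2 + R) (hK₂V : Vr ≤ K₂ * (4 * c ^ 2))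
    (hb₀ : br ≤ b₀) (hb₀' : b₀ + 2 * c ≤ b₂) (hx₀ : xlo ≤ x₀) (hx₀' : x₀ ≤ xhi)
    (hb : 0 < b) (hy : 0 < y) (hy₁ : b₂ * y₁ ≤ xlo * Real.exp (-((Vr + xhi) / xlo)))
    (hy₂ : 2 * (Vr + xhi) ≤ b₁ * y₂) (hout : ¬(b ∈ Set.Icc b₁ b₂ ∧ y ∈ Set.Icc y₁ y₂)) :
    lyap K₁ K₂ E c b₀ x₀ br br ≤ lyap K₁ K₂ E c b₀ x₀ b (b * y) := by
  have hbr : 0 < br := by linarith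
  have hb₂ : 0 < b₂ := by linarith
  have hR0 : 0 ≤ R := by rw [hR]; positivity
  have hK₁ : 0 ≤ K₁ := by
    have h1 : 0 < (br - b₁) ^ 2 := by
      have : 0 < br - b₁ := by linarith
      positivity
    by_contra hcon
    nlinarith [not_le.1 hcon]
  have hVr0 : 0 ≤ Vr := by rw [hVr]; positivity
  have hx₀0 : 0 < x₀ := by linarith
  have hx : 0 < b * y := by positivity
  have hgap := entropyGap_nonneg hx₀0 hx
  have hRx : (br - x₀) ^ 2 / br ≤ R := by
    rw [hR]
    gcongr ?_ / _
    apply sq_le_sq' <;> linarith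
  have hres := lyap_reset_le (K₁ := K₁) (K₂ := K₂) (E := E) hc hb₀ hbr hx₀0
  have hresV : lyap K₁ K₂ E c b₀ x₀ br br ≤ Vr := by
    have : K₁ * (b₀ - br) ^ 2 ≤ K₁ * b₂ ^ 2 := by
      gcongr; linarith
    linarith
  have hp1 : 0 ≤ K₁ * max (b₀ - b) 0 ^ 2 := by positivity
  have hp2 : 0 ≤ K₂ * max (b - b₀) 0 ^ 2 := by positivity
  have hp3 : 0 ≤ E * (b * y) * max (b - b₀ - c) 0 ^ 2 := by positivity
  have hV : lyap K₁ K₂ E c b₀ x₀ b (b * y) = K₁ * max (b₀ - b) 0 ^ 2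
    + K₂ * max (b - b₀) 0 ^ 2 + entropyGap x₀ (b * y)
    + E * (b * y) * max (b - b₀ - c) 0 ^ 2 := rfl
  rcases lt_or_ge b b₁ with h1 | h1
  -- Here `b < b₁ < br ≤ b₀`, so the square at `b` exceeds the one at `br` by at least `(br - b₁) ^
  -- 2`, whose weight `K₁` pays for the entropy gap at the reset point.
  · have h3 : (b₀ - br) ^ 2 + (br - b₁) ^ 2 ≤ max (b₀ - b) 0 ^ 2 := by
      rw [max_eq_left (by linarith)]
      nlinarith
    have h2 : K₁ * ((b₀ - br) ^ 2 + (br - b₁) ^ 2) ≤ K₁ * max (b₀ - b) 0 ^ 2 := by gcongr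
    linarith
  · refine hresV.trans ?_
    rw [hV]
    rcases lt_or_ge b₂ b with h2 | h2
    · have h3 : K₂ * (4 * c ^ 2) ≤ K₂ * max (b - b₀) 0 ^ 2 := by
        rw [max_eq_left (by linarith), show 4 * c ^ 2 = (2 * c) ^ 2 by ring]
        gcongr
        linarith
      linarith
    · have hyout : ¬ y ∈ Set.Icc y₁ y₂ := fun h => hout ⟨⟨h1, h2⟩, h⟩
      -- Only the quantity is out of range: the logarithm makes the gap large below `y₁`, its linear
      -- growth does so above `y₂`.
      have h4 : Vr ≤ entropyGap x₀ (b * y) := by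
        rcases lt_or_ge y y₁ with h3 | h3
        · apply le_entropyGap_of_le_exp hlo hx₀ hx hVr0
          have h5 : b * y ≤ b₂ * y₁ := mul_le_mul h2 h3.le hy.le hb₂.le
          refine (h5.trans hy₁).trans ?_
          gcongr
        · have h5 : y₂ < y := by
            by_contra hcon
            exact hyout ⟨h3, not_lt.1 hcon⟩
          have h6 := half_sub_le_entropyGap hx₀0 hx
          have h7 : b₁ * y₂ ≤ b * y := by
            apply mul_le_mul h1 h5.le _ hb.le
            by_contra hcon
            nlinarith [not_le.1 hcon]
          linarith
      linarith

/-- The order of choice matters. `K₁` comes first and bounds the reset value by `Vr`; then `y₁`,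
`y₂` are taken extreme enough for the entropy gap to exceed `Vr` outside; these fix the range of
`x`, hence `E`; finally `K₂` dominates everything involving `E`. No step revises an earlier one
because `Vr` involves neither `E` nor `K₂`. -/
lemma nonempty_lyapunovConstants {b₁ br b₂ c q κ L C xlo xhi yl yh : ℝ} (hb₁ : 0 < b₁)
    (hb₁r : b₁ < br) (hbr₂ : br < b₂) (hc : 0 < c) (hq : 0 < q) (hκ : 0 < κ) (hC : 0 < C)
    (hlo : 0 < xlo) (hlohi : xlo ≤ xhi) (hyl : 0 < yl) (hyh : yl < yh) :
    Nonempty (LyapunovConstants b₁ br b₂ c q κ L C xlo xhi yl yh) := by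
  have hbr : 0 < br := by linarith
  have hb₂ : 0 < b₂ := by linarith
  have hd : 0 < br - b₁ := by linarith
  have hxhi : 0 < xhi := by linarith
  set g := b₁ ^ 2 * κ * q with hg
  have hg0 : 0 < g := by positivity
  set R := (br + xhi) ^ 2 / br with hR
  have hR0 : 0 < R := by positivity
  set K₁ := 1 + (L ^ 2 + 1) / g + R / (br - b₁) ^ 2 with hK₁
  have hK₁1 : 1 ≤ K₁ := by
    have : 0 ≤ (L ^ 2 + 1) / g := by positivity
    have : 0 ≤ R / (br - b₁) ^ 2 := by positivity
    linarith
  have hK₁g : L ^ 2 + 1 ≤ K₁ * g := by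
    have : 0 ≤ R / (br - b₁) ^ 2 := by positivity
    rw [← div_le_iff₀ hg0]
    linarith
  have hK₁R : R ≤ K₁ * (br - b₁) ^ 2 := by
    have : 0 ≤ (L ^ 2 + 1) / g := by positivity
    rw [← div_le_iff₀ (by positivity)]
    linarith
  set Vr := K₁ * b₂ ^ 2 + R with hVr
  have hVr0 : 0 < Vr := by positivity
  set X₁ := xlo * Real.exp (-((Vr + xhi) / xlo)) with hX₁
  have hX₁0 : 0 < X₁ := by positivity
  set y₁ := min (X₁ / b₂) (yl / 2) with hy₁
  have hy₁0 : 0 < y₁ := by positivity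
  have hy₁l : y₁ < yl := (min_le_right _ _).trans_lt (by linarith)
  set y₂ := yh + 2 * (Vr + xhi) / b₁ with hy₂
  have hy₂h : yh < y₂ := by
    have : 0 < 2 * (Vr + xhi) / b₁ := by positivity
    linarith
  set x₁ := b₁ * y₁ with hx₁
  have hx₁0 : 0 < x₁ := by positivity
  set X := b₂ * y₂ with hX
  have hxX : x₁ ≤ X := by
    have : 0 < y₂ := by linarith
    apply mul_le_mul <;> linarith
  have hX0 : 0 < X := by linarith
  set E := 2 * xhi / (c ^ 2 * x₁) with hE
  have hE0 : 0 ≤ E := by positivity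
  have hEx : 2 * xhi ≤ E * c ^ 2 * x₁ := by
    rw [hE]; apply le_of_eq; field_simp
  set K₂ := 1 + (L ^ 2 + E * b₂ ^ 2 + 1) / g
    + b₂ * (X * (1 + E * b₂ ^ 2)) / (4 * c ^ 2 * b₁ ^ 2 * κ) + Vr / (4 * c ^ 2) with hK₂
  have e1 : 0 ≤ (L ^ 2 + E * b₂ ^ 2 + 1) / g := by positivity
  have e2 : 0 ≤ b₂ * (X * (1 + E * b₂ ^ 2)) / (4 * c ^ 2 * b₁ ^ 2 * κ) := by positivity
  have e3 : 0 ≤ Vr / (4 * c ^ 2) := by positivity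
  have hK₂1 : 1 ≤ K₂ := by linarith
  have hK₂g : L ^ 2 + E * b₂ ^ 2 + 1 ≤ K₂ * g := by
    rw [← div_le_iff₀ hg0]
    linarith
  have hK₂X : b₂ * (X * (1 + E * b₂ ^ 2)) ≤ K₂ * (4 * c ^ 2 * b₁ ^ 2 * κ) := by
    rw [← div_le_iff₀ (by positivity)]
    linarith
  have hK₂V : Vr ≤ K₂ * (4 * c ^ 2) := by
    rw [← div_le_iff₀ (by positivity)]
    linarith
  obtain ⟨rate, hrate, err, herr, hdrift⟩ := exists_drift_constants (xhi := xhi) hb₁ hbr hc hq hκ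
    hC hlo hK₁1 hK₂1 hE0 hx₁0 hxX hK₁g hEx hK₂g hK₂X
  refine ⟨⟨K₁, K₂, E, y₁, y₂, rate, err, hK₁1, hK₂1, hE0, hy₁0, hy₁l, hy₂h, hrate, herr, ?_, ?_⟩⟩
  · intro ε A G b₀ x₀ hε hε1 h b hb y hy
    exact hdrift ε A G b₀ x₀ hε hε1 h b hb (b * y)
      ⟨mul_le_mul hb.1 hy.1 hy₁0.le (by linarith [hb.1]),
        mul_le_mul hb.2 hy.2 (by linarith [hy.1]) hb₂.le⟩
  · intro b₀ x₀ hb₀ hb₀' hx₀ hx₀' b y hb hy hout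
    refine lyap_reset_le_of_notMem hb₁ hb₁r hc hlo hlohi hR (by linarith) hE0 hK₁R hVr hK₂V hb₀
      hb₀' hx₀ hx₀' hb hy ?_ ?_ hout
    · calc b₂ * y₁ ≤ b₂ * (X₁ / b₂) := by gcongr; exact min_le_left _ _
        _ = X₁ := by field_simp
    · calc 2 * (Vr + xhi) = b₁ * (2 * (Vr + xhi) / b₁) := by field_simp
        _ ≤ b₁ * y₂ := by gcongr; linarith

/-! ### Second-order effect of a least-squares step -/

lemma entropyGap_add_le {x₀ x k : ℝ} (h₀ : 0 < x₀) (hx : 0 < x) (hk : |k| ≤ x / 2) :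
    entropyGap x₀ (x + k) ≤ entropyGap x₀ x + (1 - x₀ / x) * k + 2 * x₀ / x ^ 2 * k ^ 2 := by
  -- With `z = k / x`, the condition `|z| ≤ 1 / 2` gives `log (1 + z) ≥ z / (1 + z) ≥ z - 2 * z ^
  -- 2`.
  have hk' := abs_le.1 hk
  have hxk : 0 < x + k := by linarith
  have h1 : k / x - 2 * (k / x) ^ 2 ≤ Real.log ((x + k) / x) := by
    have h2 := Real.one_sub_inv_le_log_of_pos (show 0 < (x + k) / x by positivity)
    refine le_trans ?_ h2
    rw [inv_div, ← sub_nonneg]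
    have h3 : 1 - x / (x + k) - (k / x - 2 * (k / x) ^ 2)
        = k ^ 2 * (x + 2 * k) / (x ^ 2 * (x + k)) := by
      field_simp
      ring
    have h4 : 0 ≤ x + 2 * k := by linarith
    rw [h3]
    positivity
  have h4 : Real.log ((x + k) / x₀) = Real.log (x / x₀) + Real.log ((x + k) / x) := by
    rw [← Real.log_mul (by positivity) (by positivity)]
    congr 1
    field_simp
  have h5 : x₀ * (k / x - 2 * (k / x) ^ 2) ≤ x₀ * Real.log ((x + k) / x) := by gcongr
  have h6 : x₀ * (k / x - 2 * (k / x) ^ 2) = x₀ / x * k - 2 * x₀ / x ^ 2 * k ^ 2 := by field_simp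
  unfold entropyGap
  rw [h4]
  linarith

/-- The squared positive part has a Lipschitz derivative, which replaces a second derivative at the
kink. -/
lemma max_add_sq_le (t h : ℝ) : max (t + h) 0 ^ 2 ≤ max t 0 ^ 2 + 2 * max t 0 * h + h ^ 2 := by
  rcases max_cases t 0 with ⟨h1, h2⟩ | ⟨h1, h2⟩ <;>
  rcases max_cases (t + h) 0 with ⟨h3, h4⟩ | ⟨h3, h4⟩ <;> rw [h1, h3] <;> nlinarith

/-- Second-order expansion of the Lyapunov function. -/
lemma lyap_add_le {K₁ K₂ E c b₀ x₀ b x h k x₁ X B xhi : ℝ} (hK₁ : 0 ≤ K₁) (hK₂ : 0 ≤ K₂)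
    (hE : 0 ≤ E) (hx₁ : 0 < x₁) (hx : x₁ ≤ x) (hxX : x ≤ X) (h₀ : 0 < x₀) (h₀' : x₀ ≤ xhi)
    (hw : max (b - b₀ - c) 0 ≤ B) (hk : |k| ≤ x / 2) :
    lyap K₁ K₂ E c b₀ x₀ (b + h) (x + k) ≤ lyap K₁ K₂ E c b₀ x₀ b x
      + lyapB K₁ K₂ E c b₀ b x * h + lyapX E c b₀ x₀ b x * k
      + (K₁ + K₂ + 2 * xhi / x₁ ^ 2 + E * (B + 2 * X)) * (h ^ 2 + k ^ 2) := by
  have hx0 : 0 < x := by linarith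
  have hk' := abs_le.1 hk
  have h1 := entropyGap_add_le h₀ hx0 hk
  have h2 := max_add_sq_le (b₀ - b) (-h)
  have h3 := max_add_sq_le (b - b₀) h
  have h4 := max_add_sq_le (b - b₀ - c) h
  have h5 : 2 * x₀ / x ^ 2 * k ^ 2 ≤ 2 * xhi / x₁ ^ 2 * k ^ 2 := by
    have : 0 < xhi := by linarith
    gcongr
  rw [show b₀ - b + -h = b₀ - (b + h) by ring] at h2
  rw [show b - b₀ + h = b + h - b₀ by ring] at h3
  rw [show b - b₀ - c + h = b + h - b₀ - c by ring] at h4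
  unfold lyap lyapB lyapX
  set w := max (b - b₀ - c) 0
  have hw0 : 0 ≤ w := le_max_right _ _
  have e2 : K₁ * max (b₀ - (b + h)) 0 ^ 2 ≤
      K₁ * (max (b₀ - b) 0 ^ 2 + 2 * max (b₀ - b) 0 * -h + (-h) ^ 2) := by gcongr
  have e3 : K₂ * max (b + h - b₀) 0 ^ 2 ≤
      K₂ * (max (b - b₀) 0 ^ 2 + 2 * max (b - b₀) 0 * h + h ^ 2) := by gcongr
  have e4 : E * (x + k) * max (b + h - b₀ - c) 0 ^ 2 ≤
      E * (x + k) * (w ^ 2 + 2 * w * h + h ^ 2) := by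
    have : 0 ≤ x + k := by linarith
    gcongr
  -- The mixed term arises because the `E` term depends on price and profit jointly; it is of second
  -- order by `2 * k * h ≤ h ^ 2 + k ^ 2`.
  have e5 : E * (2 * w * (k * h)) ≤ E * (B * (h ^ 2 + k ^ 2)) := by
    gcongr E * ?_
    have : 2 * (k * h) ≤ h ^ 2 + k ^ 2 := by nlinarith [sq_nonneg (h - k)]
    calc 2 * w * (k * h) = w * (2 * (k * h)) := by ring
      _ ≤ w * (h ^ 2 + k ^ 2) := by gcongr
      _ ≤ _ := by gcongr
  have e6 : E * ((x + k) * h ^ 2) ≤ E * (2 * X * (h ^ 2 + k ^ 2)) := by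
    apply mul_le_mul_of_nonneg_left _ hE
    apply mul_le_mul _ _ (sq_nonneg _) <;> linarith [sq_nonneg k]
  have e7 : 0 ≤ K₁ * k ^ 2 := by positivity
  have e8 : 0 ≤ K₂ * k ^ 2 := by positivity
  have e9 : 0 ≤ 2 * xhi / x₁ ^ 2 * h ^ 2 := by
    have : 0 < xhi := by linarith
    positivity
  linarith

lemma abs_lyapB_le {K₁ K₂ E c b₀ b x X b₂ : ℝ} (hK₁ : 0 ≤ K₁) (hK₂ : 0 ≤ K₂) (hE : 0 ≤ E)
    (hx : 0 < x) (hxX : x ≤ X) (hc : 0 < c) (hb : 0 < b) (hb₂ : b ≤ b₂) (hb₀ : 0 < b₀)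
    (hb₀₂ : b₀ ≤ b₂) : |lyapB K₁ K₂ E c b₀ b x| ≤ 2 * (K₁ + K₂ + E * X) * b₂ := by
  have hb20 : 0 < b₂ := by linarith
  have hX0 : 0 < X := by linarith
  unfold lyapB
  have m1 : 0 ≤ max (b₀ - b) 0 := le_max_right _ _
  have m2 : 0 ≤ max (b - b₀) 0 := le_max_right _ _
  have m3 : max (b₀ - b) 0 ≤ b₂ := max_le (by linarith) hb20.le
  have m4 : max (b - b₀) 0 ≤ b₂ := max_le (by linarith) hb20.le
  have m5 : max (b - b₀ - c) 0 ≤ b₂ := max_le (by linarith) hb20.le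
  have m6 : 0 ≤ max (b - b₀ - c) 0 := le_max_right _ _
  have p1 : K₁ * max (b₀ - b) 0 ≤ K₁ * b₂ := by gcongr
  have p2 : K₂ * max (b - b₀) 0 ≤ K₂ * b₂ := by gcongr
  have p3 : E * x * max (b - b₀ - c) 0 ≤ E * X * b₂ := by gcongr
  have p4 : 0 ≤ K₁ * max (b₀ - b) 0 := by positivity
  have p5 : 0 ≤ K₂ * max (b - b₀) 0 := by positivity
  have p6 : 0 ≤ E * x * max (b - b₀ - c) 0 := by positivity
  rw [abs_le]
  constructor <;> linarith

lemma abs_lyapX_le {E c b₀ x₀ b x x₁ xhi b₂ : ℝ} (hE : 0 ≤ E) (h₀ : 0 < x₀) (h₀' : x₀ ≤ xhi)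
    (hx₁ : 0 < x₁) (hx : x₁ ≤ x) (hw : max (b - b₀ - c) 0 ≤ b₂) :
    |lyapX E c b₀ x₀ b x| ≤ 1 + xhi / x₁ + E * b₂ ^ 2 := by
  have hx0 : 0 < x := by linarith
  have hw0 : 0 ≤ max (b - b₀ - c) 0 := le_max_right _ _
  unfold lyapX
  have p1 : x₀ / x ≤ xhi / x₁ := div_le_div₀ (by linarith) h₀' hx₁ hx
  have p2 : 0 ≤ x₀ / x := by positivity
  have p3 : E * max (b - b₀ - c) 0 ^ 2 ≤ E * b₂ ^ 2 := by gcongr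
  have p4 : 0 ≤ E * max (b - b₀ - c) 0 ^ 2 := by positivity
  rw [abs_le]
  constructor <;> linarith

set_option maxHeartbeats 800000 in
/-- The effect on the Lyapunov function of one recursive least-squares step, written in terms of the
forecast error `r` and the weight `v` of the price noise. -/
lemma exists_step_constants {b₁ b₂ br c xlo xhi K₁ K₂ E y₁ y₂ : ℝ} (hb₁ : 0 < b₁) (hbr : 0 < br)
    (hbb : b₁ < b₂) (hc : 0 < c) (hlo : 0 < xlo) (hK₁ : 0 ≤ K₁) (hK₂ : 0 ≤ K₂) (hE : 0 ≤ E)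
    (hy₁ : 0 < y₁) (hyy : y₁ < y₂) :
    ∃ δ > 0, ∃ C₁ > 0, ∃ C₂ > 0, ∀ b₀ x₀ b y a Z r v ζ : ℝ, br ≤ b₀ → b₀ + 2 * c ≤ b₂ →
      xlo ≤ x₀ → x₀ ≤ xhi → b ∈ Set.Icc b₁ b₂ → y ∈ Set.Icc y₁ y₂ → 0 < a → 0 < Z →
      a * Z ≤ δ → |r| ≤ Z → |r * v| ≤ Z → |ζ| ≤ Z → ζ = r * (1 + b * v) →
      0 < y / b - a * (r * v) ∧ 0 < 2 * y + a * (r * (1 - b * v)) ∧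
      |lyapB K₁ K₂ E c b₀ b (b * y) * (ζ / (2 * (y / b)))
          + lyapX E c b₀ x₀ b (b * y) * (b * r)| ≤ C₁ * Z ∧
      lyap K₁ K₂ E c b₀ x₀ ((2 * y + a * (r * (1 - b * v))) / (2 * (y / b - a * (r * v))))
        ((2 * y + a * (r * (1 - b * v))) / (2 * (y / b - a * (r * v)))
          * ((2 * y + a * (r * (1 - b * v))) / 2)) ≤
        lyap K₁ K₂ E c b₀ x₀ b (b * y)
        + a * (lyapB K₁ K₂ E c b₀ b (b * y) * (ζ / (2 * (y / b)))
          + lyapX E c b₀ x₀ b (b * y) * (b * r)) + C₂ * (a * Z) ^ 2 := by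
  have hb₂ : 0 < b₂ := by linarith
  have hy₂ : 0 < y₂ := by linarith
  set m := y₁ / b₂ with hm
  have hm0 : 0 < m := by positivity
  set x₁ := b₁ * y₁ with hx₁
  have hx₁0 : 0 < x₁ := by positivity
  set X := b₂ * y₂ with hX
  have hX0 : 0 < X := by positivity
  set B := 2 * (K₁ + K₂ + E * X) * b₂ with hB
  have hB0 : 0 ≤ B := by positivity
  set X' := 1 + |xhi| / x₁ + E * b₂ ^ 2 with hX'
  have hX'0 : 0 < X' := by positivity
  set Q := K₁ + K₂ + 2 * |xhi| / x₁ ^ 2 + E * (b₂ + 2 * X) with hQ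
  have hQ0 : 0 ≤ Q := by positivity
  -- The three bounds on the step size keep the slope above `m / 2`, the intercept positive, and the
  -- change of `x` below `x / 2`, as the expansion of the logarithm requires.
  refine ⟨min (m / 2) (min (y₁ / (1 + b₂)) (x₁ / 2 / (b₂ + 1))), by positivity,
    B / (2 * m) + X' * b₂, by positivity,
    B / m ^ 2 + X' / (2 * m) + Q * (1 / m ^ 2 + (b₂ + 1) ^ 2), by positivity, ?_⟩
  intro b₀ x₀ b y a Z r v ζ hb₀ hb₀' hx₀ hx₀' hb hy ha hZ haZ hr hrv hζ hζe
  have hZ1 : a * Z ≤ m / 2 := haZ.trans (min_le_left _ _)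
  have hZ2 : a * Z * (1 + b₂) ≤ y₁ := by
    rw [← le_div_iff₀ (by positivity)]
    exact haZ.trans ((min_le_right _ _).trans (min_le_left _ _))
  have hZ3 : a * Z * (b₂ + 1) ≤ x₁ / 2 := by
    rw [← le_div_iff₀ (by positivity)]
    exact haZ.trans ((min_le_right _ _).trans (min_le_right _ _))
  have haZ0 : 0 < a * Z := by positivity
  have hb0 : 0 < b := by linarith [hb.1]
  have hy0 : 0 < y := by linarith [hy.1]
  set s := y / b with hs
  have hs0 : 0 < s := by positivity
  have hbs : b * s = y := by rw [hs]; field_simp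
  have hms : m ≤ s := div_le_div₀ hy0.le hy.1 hb0 hb.2
  have harv : |a * (r * v)| ≤ a * Z := by rw [abs_mul, abs_of_pos ha]; gcongr
  have har : |a * r| ≤ a * Z := by rw [abs_mul, abs_of_pos ha]; gcongr
  have haζ : |a * ζ| ≤ a * Z := by rw [abs_mul, abs_of_pos ha]; gcongr
  have harv' := abs_le.1 harv
  have har' := abs_le.1 har
  set s' := s - a * (r * v) with hs'
  have hms' : m / 2 ≤ s' := by linarith
  have hs'0 : 0 < s' := by linarith
  have hx₁x : x₁ ≤ b * y := mul_le_mul hb.1 hy.1 hy₁.le hb0.le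
  have hxX : b * y ≤ X := mul_le_mul hb.2 hy.2 hy0.le hb₂.le
  have hx0 : 0 < b * y := by positivity
  have hx₀0 : 0 < x₀ := by linarith
  have hxhi : |xhi| = xhi := abs_of_pos (by linarith)
  -- With `s'` the updated slope, the price moves by exactly `h`, and `x` moves by its linear part
  -- `a * b * r` plus a nonnegative quadratic remainder.
  set h := a * ζ / (2 * s') with hh
  set k := a * (b * r) + (a * ζ) ^ 2 / (4 * s') with hk
  have hnum : 2 * y + a * (r * (1 - b * v)) = 2 * b * s' + a * ζ := by
    rw [hs', hζe, ← hbs]; ring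
  have hb' : (2 * y + a * (r * (1 - b * v))) / (2 * s') = b + h := by
    rw [hnum, hh]; field_simp
  have hx' : (b + h) * ((2 * y + a * (r * (1 - b * v))) / 2) = b * y + k := by
    have e1 : a * (b * r) = b * (a * ζ) - b ^ 2 * (a * (r * v)) := by rw [hζe]; ring
    have e2 : b * y = b ^ 2 * s' + b ^ 2 * (a * (r * v)) := by rw [hs', ← hbs]; ring
    rw [hnum, hk, e1, e2, hh]
    field_simp
    ring
  have hw : max (b - b₀ - c) 0 ≤ b₂ := max_le (by linarith [hb.2]) hb₂.le
  have hw0 : 0 ≤ max (b - b₀ - c) 0 := le_max_right _ _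
  have hζ2 : (a * ζ) ^ 2 ≤ (a * Z) ^ 2 := sq_le_sq' (abs_le.1 haζ).1 (abs_le.1 haζ).2
  have hq : (a * ζ) ^ 2 / (4 * s') ≤ (a * Z) ^ 2 / (2 * m) := by
    apply div_le_div₀ (by positivity) hζ2 (by positivity)
    linarith
  have hq0 : 0 ≤ (a * ζ) ^ 2 / (4 * s') := by positivity
  have hkb : |k| ≤ a * Z * (b₂ + 1) := by
    have e1 : |a * (b * r)| ≤ a * Z * b₂ := by
      rw [show a * (b * r) = a * r * b by ring, abs_mul, abs_of_pos hb0]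
      gcongr
      exact hb.2
    have e2 : (a * Z) ^ 2 / (2 * m) ≤ a * Z := by
      rw [div_le_iff₀ (by positivity), sq]
      exact mul_le_mul_of_nonneg_left (by linarith) haZ0.le
    refine (abs_add_le _ _).trans ?_
    rw [abs_of_nonneg hq0]
    linarith
  have hhb : |h| ≤ a * Z / m := by
    rw [hh, abs_div, abs_of_pos (by positivity : 0 < 2 * s')]
    apply div_le_div₀ haZ0.le haζ hm0
    linarith
  have hLB : |lyapB K₁ K₂ E c b₀ b (b * y)| ≤ B :=
    abs_lyapB_le hK₁ hK₂ hE hx0 hxX hc hb0 hb.2 (by linarith) (by linarith)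
  have hLX : |lyapX E c b₀ x₀ b (b * y)| ≤ X' := by
    rw [hX', hxhi]
    exact abs_lyapX_le hE hx₀0 hx₀' hx₁0 hx₁x hw
  have hmain := lyap_add_le (h := h) hK₁ hK₂ hE hx₁0 hx₁x hxX hx₀0 hx₀' hw
    (hkb.trans (hZ3.trans (by linarith)))
  refine ⟨hs'0, ?_, ?_, ?_⟩
  · have e1 : |a * (r * v) * b| ≤ a * Z * b₂ := by
      rw [abs_mul, abs_of_pos hb0]
      gcongr
      exact hb.2
    have e2 := abs_le.1 e1
    have e3 := hy.1
    linarith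
  · refine (abs_add_le _ _).trans ?_
    rw [abs_mul, abs_mul (lyapX _ _ _ _ _ _), abs_mul b r, abs_of_pos hb0, abs_div,
      abs_of_pos (by positivity : 0 < 2 * s)]
    have e1 : |ζ| / (2 * s) ≤ Z / (2 * m) := by
      apply div_le_div₀ hZ.le hζ (by positivity)
      linarith
    calc |lyapB K₁ K₂ E c b₀ b (b * y)| * (|ζ| / (2 * s))
        + |lyapX E c b₀ x₀ b (b * y)| * (b * |r|) ≤ B * (Z / (2 * m)) + X' * (b₂ * Z) := by
          have := hb.2
          gcongr
      _ = _ := by ring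
  · rw [hb', hx']
    refine hmain.trans ?_
    -- Replacing the updated slope `s'` by the old slope `s` changes `h` by a product of two
    -- step-size factors, hence only to second order.
    have e1 : lyapB K₁ K₂ E c b₀ b (b * y) * h ≤
        a * (lyapB K₁ K₂ E c b₀ b (b * y) * (ζ / (2 * s))) + B / m ^ 2 * (a * Z) ^ 2 := by
      have f1 : lyapB K₁ K₂ E c b₀ b (b * y) * h
          - a * (lyapB K₁ K₂ E c b₀ b (b * y) * (ζ / (2 * s))) =
          lyapB K₁ K₂ E c b₀ b (b * y) * ((a * ζ) * (a * (r * v)) / (2 * s * s')) := by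
        rw [hh]
        field_simp
        rw [hs']
        ring
      have f2 : |(a * ζ) * (a * (r * v)) / (2 * s * s')| ≤ (a * Z) * (a * Z) / m ^ 2 := by
        rw [abs_div, abs_mul, abs_of_pos (by positivity : 0 < 2 * s * s')]
        apply div_le_div₀ (by positivity) (by gcongr) (by positivity)
        calc m ^ 2 = 2 * m * (m / 2) := by ring
          _ ≤ 2 * s * s' := by gcongr
      have f3 := (le_abs_self (lyapB K₁ K₂ E c b₀ b (b * y)
        * ((a * ζ) * (a * (r * v)) / (2 * s * s'))))
      rw [abs_mul] at f3
      have f4 : |lyapB K₁ K₂ E c b₀ b (b * y)| * |(a * ζ) * (a * (r * v)) / (2 * s * s')|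
          ≤ B * ((a * Z) * (a * Z) / m ^ 2) := by gcongr
      have f5 : B * ((a * Z) * (a * Z) / m ^ 2) = B / m ^ 2 * (a * Z) ^ 2 := by ring
      linarith
    have e2 : lyapX E c b₀ x₀ b (b * y) * k ≤
        a * (lyapX E c b₀ x₀ b (b * y) * (b * r)) + X' / (2 * m) * (a * Z) ^ 2 := by
      have f1 : lyapX E c b₀ x₀ b (b * y) * ((a * ζ) ^ 2 / (4 * s')) ≤
          X' * ((a * Z) ^ 2 / (2 * m)) := by
        apply mul_le_mul ((le_abs_self _).trans hLX) hq hq0 hX'0.le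
      rw [hk]
      have f5 : X' * ((a * Z) ^ 2 / (2 * m)) = X' / (2 * m) * (a * Z) ^ 2 := by ring
      linarith
    have e3 : h ^ 2 + k ^ 2 ≤ (1 / m ^ 2 + (b₂ + 1) ^ 2) * (a * Z) ^ 2 := by
      have f1 : h ^ 2 ≤ (a * Z / m) ^ 2 := sq_le_sq' (abs_le.1 hhb).1 (abs_le.1 hhb).2
      have f2 : k ^ 2 ≤ (a * Z * (b₂ + 1)) ^ 2 := sq_le_sq' (abs_le.1 hkb).1 (abs_le.1 hkb).2
      have f3 : (a * Z / m) ^ 2 + (a * Z * (b₂ + 1)) ^ 2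
        = (1 / m ^ 2 + (b₂ + 1) ^ 2) * (a * Z) ^ 2 := by ring
      linarith
    have e4 : Q * (h ^ 2 + k ^ 2) ≤ Q * ((1 / m ^ 2 + (b₂ + 1) ^ 2) * (a * Z) ^ 2) := by gcongr
    rw [hQ, hxhi] at e4 ⊢
    linarith

/-! ### Means of demand and of the forecast error under the shock law -/

section Shock

lemma isProbabilityMeasure_noiseLaw {ε : ℝ} (hε : 0 < ε) : IsProbabilityMeasure (noiseLaw ε) := by
  apply cond_isProbabilityMeasure_of_finite
  · simp [hε]
  · simp

lemma integral_noiseLaw {ε : ℝ} (hε : 0 < ε) (g : ℝ → ℝ) :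
    ∫ e, g e ∂(noiseLaw ε) = (∫ e in -ε..ε, g e) / (2 * ε) := by
  unfold noiseLaw ProbabilityTheory.cond
  rw [integral_smul_measure, intervalIntegral.integral_of_le (by linarith),
    integral_Icc_eq_integral_Ioc, Real.volume_Icc, ENNReal.toReal_inv,
    ENNReal.toReal_ofReal (by linarith), smul_eq_mul, sub_neg_eq_add, ← two_mul]
  ring

lemma ae_noiseLaw {ε : ℝ} : ∀ᵐ e ∂(noiseLaw ε), |e| ≤ ε := by
  have h : noiseLaw ε ≪ volume.restrict (Set.Icc (-ε) ε) := by
    unfold noiseLaw ProbabilityTheory.cond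
    exact Measure.smul_absolutelyContinuous
  apply h.ae_le
  filter_upwards [ae_restrict_mem measurableSet_Icc] with e he using abs_le.2 he

variable {N : ℕ} {ν : Fin N → Measure ℝ}

lemma quantity_nonneg (v : Fin N → ℝ) (p : ℝ) : 0 ≤ quantity v p := by
  unfold quantity
  refine div_nonneg (Finset.sum_nonneg fun i _ => ?_) (Nat.cast_nonneg N)
  split_ifs <;> norm_num

lemma quantity_le_one (v : Fin N → ℝ) (p : ℝ) : quantity v p ≤ 1 := by
  unfold quantity
  apply div_le_one_of_le₀ _ (Nat.cast_nonneg N)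
  calc ∑ i, (if p ≤ v i then (1 : ℝ) else 0) ≤ ∑ _i : Fin N, (1 : ℝ) := by
        apply Finset.sum_le_sum
        intro i _
        split_ifs <;> norm_num
    _ = N := by simp

lemma measurable_quantity : Measurable fun z : (Fin N → ℝ) × ℝ => quantity z.1 z.2 := by
  unfold quantity
  refine Measurable.div_const (Finset.measurable_sum _ fun i _ => ?_) _
  refine Measurable.ite (measurableSet_le (by fun_prop) (by fun_prop)) (by fun_prop) (by fun_prop)

lemma integral_quantity (hν : ∀ i, IsProbabilityMeasure (ν i))
    [IsProbabilityMeasure (aggregate ν)] (hac : aggregate ν ≪ volume) (p : ℝ) :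
    ∫ v, quantity v p ∂(Measure.pi ν) = 1 - cdf (aggregate ν) p := by
  rw [← real_Ici_eq_one_sub_cdf hac]
  unfold quantity
  have h1 : ∀ i, Integrable (fun v : Fin N → ℝ => if p ≤ v i then (1 : ℝ) else 0)
      (Measure.pi ν) := by
    intro i
    refine Integrable.of_bound (C := 1) (Measurable.ite (measurableSet_le (by fun_prop)
      (by fun_prop)) (by fun_prop) (by fun_prop)).aestronglyMeasurable (.of_forall fun v => ?_)
    split_ifs <;> simp
  rw [integral_div, integral_finsetSum _ fun i _ => h1 i]
  have h2 : ∀ i, ∫ v : Fin N → ℝ, (if p ≤ v i then (1 : ℝ) else 0) ∂(Measure.pi ν)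
      = (ν i).real (Set.Ici p) := by
    intro i
    rw [← (measurePreserving_eval ν i).measureReal_preimage measurableSet_Ici.nullMeasurableSet,
      ← integral_indicator_one]
    · rfl
    · exact measurableSet_Ici.preimage (measurable_pi_apply i)
  simp_rw [h2]
  unfold aggregate
  rw [measureReal_ennreal_smul_apply, measureReal_def, Measure.finsetSum_apply,
    ENNReal.toReal_sum (fun i _ => measure_ne_top _ _), ENNReal.toReal_inv]
  simp [measureReal_def, div_eq_inv_mul]

/-- The mean of the least-squares forecast error against an affine function of the noise. -/
lemma integral_error_mul (hν : ∀ i, IsProbabilityMeasure (ν i))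
    [IsProbabilityMeasure (aggregate ν)] (hac : aggregate ν ≪ volume)
    (hF : Continuous (cdf (aggregate ν))) {ε : ℝ} (hε : 0 < ε) (b y s α γ : ℝ)
    (hint : Integrable (fun z : ℝ × (Fin N → ℝ) =>
      (quantity z.2 (b + z.1) - y + s * z.1) * (α + γ * z.1)) ((noiseLaw ε).prod (Measure.pi ν))) :
    ∫ z, (quantity z.2 (b + z.1) - y + s * z.1) * (α + γ * z.1)
        ∂((noiseLaw ε).prod (Measure.pi ν)) =
      α * (meanDemand (cdf (aggregate ν)) ε b - y)
        + γ * (ε ^ 2 / 3) * (s - meanSlope (cdf (aggregate ν)) ε b) := by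
  have := isProbabilityMeasure_noiseLaw hε
  set F := cdf (aggregate ν)
  have hq : ∀ p, Integrable (fun v : Fin N → ℝ => quantity v p) (Measure.pi ν) := by
    intro p
    refine Integrable.of_bound (C := 1) ?_ (.of_forall fun v => ?_)
    · exact (measurable_quantity.comp (measurable_id.prodMk measurable_const)).aestronglyMeasurable
    · rw [Real.norm_eq_abs, abs_of_nonneg (quantity_nonneg v p)]
      exact quantity_le_one v p
  rw [integral_prod _ hint]
  have h1 : ∀ e : ℝ, ∫ v, (quantity v (b + e) - y + s * e) * (α + γ * e) ∂(Measure.pi ν)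
      = (1 - F (b + e) - y + s * e) * (α + γ * e) := by
    intro e
    have h2 : ∀ v : Fin N → ℝ, quantity v (b + e) - y + s * e
        = quantity v (b + e) + (s * e - y) := fun v => by ring
    simp only [h2]
    rw [integral_mul_const, integral_add (hq _) (integrable_const _), integral_quantity hν hac]
    simp only [integral_const, probReal_univ, one_smul, F]
    ring
  simp only [h1]
  rw [integral_noiseLaw hε]
  have h2 : ∀ e, (1 - F (b + e) - y + s * e) * (α + γ * e) =
      (α * (1 - F (b + e)) + (-γ) * (e * F (b + e))) +
        (-(α * y) + ((α * s + γ * (1 - y)) * e + (γ * s) * e ^ 2)) := by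
    intro e; ring
  simp only [h2]
  have hFb : Continuous fun e => F (b + e) := by
    exact hF.comp (by fun_prop)
  have i1 : IntervalIntegrable (fun e => α * (1 - F (b + e))) volume (-ε) ε :=
    Continuous.intervalIntegrable (by fun_prop) _ _
  have i2 : IntervalIntegrable (fun e => (-γ) * (e * F (b + e))) volume (-ε) ε :=
    Continuous.intervalIntegrable (by fun_prop) _ _
  have i3 : IntervalIntegrable (fun e : ℝ => (α * s + γ * (1 - y)) * e + (γ * s) * e ^ 2)
    volume (-ε) ε := Continuous.intervalIntegrable (by fun_prop) _ _
  rw [intervalIntegral.integral_add (i1.add i2) ((by simp : IntervalIntegrable (fun _ => -(α * y)) volume (-ε) ε).add i3),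
    intervalIntegral.integral_add i1 i2, intervalIntegral.integral_add (by simp) i3,
    integral_quadratic_symm, intervalIntegral.integral_const_mul,
    intervalIntegral.integral_const_mul, intervalIntegral.integral_const]
  unfold meanDemand meanSlope
  rw [smul_eq_mul]
  field_simp
  ring

end Shock

/-! ### Exponential moments along random recursions -/

/-- An exponential moment bound for bounded random variables. -/
lemma lintegral_exp_le {Z : Type*} [MeasurableSpace Z] {Λ : Measure Z} [IsProbabilityMeasure Λ]
    {W : Z → ℝ} (hW : Measurable W) {w θ : ℝ} (hWw : ∀ᵐ z ∂Λ, |W z| ≤ w) (hθ : 0 ≤ θ)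
    (hθw : θ * w ≤ 1) :
    ∫⁻ z, ENNReal.ofReal (Real.exp (θ * W z)) ∂Λ
      ≤ ENNReal.ofReal (Real.exp (θ * ∫ z, W z ∂Λ + (θ * w) ^ 2)) := by
  have hint : Integrable W Λ := Integrable.of_bound hW.aestronglyMeasurable w
    (by simpa using hWw)
  have hb : ∀ᵐ z ∂Λ, |θ * W z| ≤ θ * w := by
    filter_upwards [hWw] with z hz
    rw [abs_mul, abs_of_nonneg hθ]
    gcongr
  have hint2 : Integrable (fun z => Real.exp (θ * W z)) Λ := by
    refine Integrable.of_bound (C := Real.exp 1) (by fun_prop) ?_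
    filter_upwards [hb] with z hz
    rw [Real.norm_eq_abs, Real.abs_exp]
    gcongr
    exact (le_abs_self _).trans (hz.trans hθw)
  rw [← ofReal_integral_eq_lintegral_ofReal hint2 (.of_forall fun z => (Real.exp_pos _).le)]
  apply ENNReal.ofReal_le_ofReal
  -- `exp t ≤ 1 + t + t ^ 2` for `|t| ≤ 1`; after integration, `1 + t ≤ exp t` restores the
  -- exponential form.
  have h1 : ∫ z, Real.exp (θ * W z) ∂Λ ≤ ∫ z, (θ * W z + (1 + (θ * w) ^ 2)) ∂Λ := by
    apply integral_mono_ae hint2 ((hint.const_mul θ).add (integrable_const _))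
    filter_upwards [hb] with z hz
    have h2 := (abs_le.1 (Real.abs_exp_sub_one_sub_id_le (hz.trans hθw))).2
    have h3 : (θ * W z) ^ 2 ≤ (θ * w) ^ 2 := sq_le_sq' (abs_le.1 hz).1 (abs_le.1 hz).2
    simp only [Pi.add_apply]
    linarith
  refine h1.trans ?_
  rw [integral_add (hint.const_mul θ) (integrable_const _), integral_const_mul]
  have h4 := Real.add_one_le_exp (θ * ∫ z, W z ∂Λ + (θ * w) ^ 2)
  simp only [integral_const, probReal_univ, one_smul]
  linarith

section Recursion

variable {Z S : Type*} {step : S → Z → S} {X : (ℕ → Z) → ℕ → S} {s₀ : S}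

lemma recursion_congr (h0 : ∀ d, X d 0 = s₀) (hX : ∀ d t, X d (t + 1) = step (X d t) (d t))
    {d d' : ℕ → Z} {t : ℕ} (h : ∀ i < t, d i = d' i) : X d t = X d' t := by
  induction t with
  | zero => rw [h0, h0]
  | succ t ih => rw [hX, hX, ih fun i hi => h i (by omega), h t (by omega)]

variable [MeasurableSpace Z] [MeasurableSpace S]

lemma measurable_recursion (hstep : Measurable (Function.uncurry step)) (h0 : ∀ d, X d 0 = s₀)
    (hX : ∀ d t, X d (t + 1) = step (X d t) (d t)) (t : ℕ) : Measurable fun d => X d t := by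
  induction t with
  | zero => simp only [h0]; exact measurable_const
  | succ t ih =>
    simp only [hX]
    exact hstep.comp (ih.prodMk (measurable_pi_apply t))

variable {Ω : Type*} [MeasurableSpace Ω] {P : Measure Ω} {D : ℕ → Ω → Z}

lemma indepFun_recursion [Nonempty Z] (hstep : Measurable (Function.uncurry step))
    (h0 : ∀ d, X d 0 = s₀) (hX : ∀ d t, X d (t + 1) = step (X d t) (d t))
    (hD : ∀ t, Measurable (D t)) (hind : iIndepFun D P) (t : ℕ) :
    IndepFun (fun ω => X (fun i => D i ω) t) (D t) P := by
  have h1 := hind.indepFun_finset (Finset.range t) {t} (by simp) hD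
  set z₀ : Z := Classical.arbitrary Z
  -- The state at time `t` depends on the first `t` shocks only, so a finite block is padded with an
  -- arbitrary value to feed the recursion.
  set g : ((i : Finset.range t) → Z) → ℕ → Z :=
    fun r i => if hi : i ∈ Finset.range t then r ⟨i, hi⟩ else z₀ with hg
  have hgm : Measurable g := by
    rw [measurable_pi_iff]
    intro i
    by_cases hi : i ∈ Finset.range t
    · simp only [hg, hi, dite_true]
      exact measurable_pi_apply _
    · simp only [hg, hi, dite_false]
      exact measurable_const
  have hp : Measurable fun r : (({t} : Finset ℕ) → Z) => r ⟨t, by simp⟩ := measurable_pi_apply _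
  have h2 := h1.comp (φ := fun r => X (g r) t) (ψ := fun r => r ⟨t, by simp⟩)
    ((measurable_recursion hstep h0 hX t).comp hgm) hp
  refine h2.congr ?_ ?_
  · refine .of_forall fun ω => ?_
    apply recursion_congr h0 hX
    intro i hi
    simp [hg, hi]
  · exact .of_forall fun ω => rfl

/-- The Markov property: the new shock is independent of the current state, so it can be integrated
out first. -/
lemma lintegral_recursion_succ [Nonempty Z] [IsProbabilityMeasure P]
    (hstep : Measurable (Function.uncurry step))
    (h0 : ∀ d, X d 0 = s₀) (hX : ∀ d t, X d (t + 1) = step (X d t) (d t))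
    (hD : ∀ t, Measurable (D t)) (hind : iIndepFun D P) {Λ : Measure Z} [IsProbabilityMeasure Λ]
    (t : ℕ) (hlaw : P.map (D t) = Λ) {φ : S → ENNReal} (hφ : Measurable φ) :
    ∫⁻ ω, φ (X (fun i => D i ω) (t + 1)) ∂P
      = ∫⁻ ω, ∫⁻ z, φ (step (X (fun i => D i ω) t) z) ∂Λ ∂P := by
  have hXm : Measurable fun ω => X (fun i => D i ω) t :=
    (measurable_recursion hstep h0 hX t).comp (measurable_pi_iff.2 hD)
  have h1 := (indepFun_iff_map_prod_eq_prod_map_map hXm.aemeasurable (hD t).aemeasurable).1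
    (indepFun_recursion hstep h0 hX hD hind t)
  simp only [hX]
  have hm : Measurable fun p : S × Z => φ (step p.1 p.2) := hφ.comp hstep
  have h2 : ∫⁻ ω, φ (step (X (fun i => D i ω) t) (D t ω)) ∂P
      = ∫⁻ p, φ (step p.1 p.2) ∂(P.map fun ω => (X (fun i => D i ω) t, D t ω)) := by
    rw [lintegral_map hm (hXm.prodMk (hD t))]
  have : IsProbabilityMeasure (P.map fun ω => X (fun i => D i ω) t) :=
    Measure.isProbabilityMeasure_map hXm.aemeasurable
  rw [h2, h1, hlaw, lintegral_prod _ hm.aemeasurable, lintegral_map _ hXm]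
  exact hm.lintegral_prod_right'

/-- Exponential moments of a function that contracts in mean along a random recursion. -/
lemma lintegral_exp_recursion_le [Nonempty Z] [IsProbabilityMeasure P]
    (hstep : Measurable (Function.uncurry step))
    (h0 : ∀ d, X d 0 = s₀) (hX : ∀ d t, X d (t + 1) = step (X d t) (d t))
    (hD : ∀ t, Measurable (D t)) (hind : iIndepFun D P) {Λ : Measure Z} [IsProbabilityMeasure Λ]
    (hlaw : ∀ t, P.map (D t) = Λ) {V : S → ℝ} (hV : Measurable V) {B : Set S}
    (hs₀ : s₀ ∈ B) (hB : ∀ s ∈ B, ∀ z, step s z ∈ B) {Θ γ e Q : ℝ} (hγ : 0 ≤ γ) (hγ1 : γ ≤ 1)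
    (he : 0 ≤ e) (hQ : 0 ≤ Q)
    (hone : ∀ s ∈ B, ∀ θ ∈ Set.Icc 0 Θ, ∫⁻ z, ENNReal.ofReal (Real.exp (θ * V (step s z))) ∂Λ
      ≤ ENNReal.ofReal (Real.exp (θ * (1 - γ) * V s + (θ * γ * e + θ ^ 2 * γ * Q))))
    (t : ℕ) {θ : ℝ} (hθ : θ ∈ Set.Icc 0 Θ) :
    ∫⁻ ω, ENNReal.ofReal (Real.exp (θ * V (X (fun i => D i ω) t))) ∂P
      ≤ ENNReal.ofReal (Real.exp (θ * ((1 - γ) ^ t * V s₀ + e) + θ ^ 2 * Q)) := by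
  have hXB : ∀ d t, X d t ∈ B := by
    intro d t
    induction t with
    | zero => rw [h0]; exact hs₀
    | succ t ih => rw [hX]; exact hB _ ih _
  induction t generalizing θ with
  | zero =>
    simp only [h0, lintegral_const, measure_univ, mul_one, pow_zero, one_mul]
    have h1 := mul_nonneg hθ.1 he
    have h2 : 0 ≤ θ ^ 2 * Q := by positivity
    apply ENNReal.ofReal_le_ofReal
    gcongr
    linarith
  | succ t ih =>
    rw [lintegral_recursion_succ (φ := fun s => ENNReal.ofReal (Real.exp (θ * V s))) hstep h0 hX hD
      hind t (hlaw t) (by fun_prop)]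
    -- One step turns the parameter `θ` into `θ * (1 - γ)`; this is why the induction runs over all
    -- `θ` in `[0, Θ]`.
    have hθ' : θ * (1 - γ) ∈ Set.Icc 0 Θ := by
      have h1 : 0 ≤ 1 - γ := by linarith
      have h2 : θ * (1 - γ) ≤ θ * 1 := mul_le_mul_of_nonneg_left (by linarith) hθ.1
      exact ⟨mul_nonneg hθ.1 h1, by linarith [hθ.2]⟩
    calc ∫⁻ ω, ∫⁻ z, ENNReal.ofReal (Real.exp (θ * V (step (X (fun i => D i ω) t) z))) ∂Λ ∂P
        ≤ ∫⁻ ω, ENNReal.ofReal (Real.exp (θ * (1 - γ) * V (X (fun i => D i ω) t)))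
          * ENNReal.ofReal (Real.exp (θ * γ * e + θ ^ 2 * γ * Q)) ∂P := by
          apply lintegral_mono
          intro ω
          refine (hone _ (hXB _ _) θ hθ).trans (le_of_eq ?_)
          rw [Real.exp_add, ENNReal.ofReal_mul (Real.exp_pos _).le]
      _ = (∫⁻ ω, ENNReal.ofReal (Real.exp (θ * (1 - γ) * V (X (fun i => D i ω) t))) ∂P)
          * ENNReal.ofReal (Real.exp (θ * γ * e + θ ^ 2 * γ * Q)) := by
          rw [lintegral_mul_const]
          have hXm : Measurable fun ω => X (fun i => D i ω) t :=
            (measurable_recursion hstep h0 hX t).comp (measurable_pi_iff.2 hD)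
          exact ((hV.comp hXm).const_mul _).exp.ennreal_ofReal
      _ ≤ ENNReal.ofReal (Real.exp (θ * (1 - γ) * ((1 - γ) ^ t * V s₀ + e)
            + (θ * (1 - γ)) ^ 2 * Q))
          * ENNReal.ofReal (Real.exp (θ * γ * e + θ ^ 2 * γ * Q)) := by
          gcongr
          exact ih hθ'
      _ ≤ _ := by
          rw [← ENNReal.ofReal_mul (Real.exp_pos _).le, ← Real.exp_add]
          apply ENNReal.ofReal_le_ofReal
          apply Real.exp_le_exp.2
          -- The accumulated variance term shrinks by `(1 - γ) ^ 2` while each step adds `γ`, so the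
          -- bound `θ ^ 2 * Q` reproduces itself for every horizon.
          have h3 : (1 - γ) ^ 2 + γ ≤ 1 := by nlinarith
          have h4 : θ ^ 2 * Q * ((1 - γ) ^ 2 + γ) ≤ θ ^ 2 * Q * 1 := by gcongr
          have h5 : (1 - γ) ^ (t + 1) = (1 - γ) * (1 - γ) ^ t := by ring
          rw [h5]
          linarith

/-- Exponential tail bound for a function that contracts in mean along a random recursion. -/
lemma measure_recursion_gt_le [Nonempty Z] [IsProbabilityMeasure P]
    (hstep : Measurable (Function.uncurry step))
    (h0 : ∀ d, X d 0 = s₀) (hX : ∀ d t, X d (t + 1) = step (X d t) (d t))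
    (hD : ∀ t, Measurable (D t)) (hind : iIndepFun D P) {Λ : Measure Z} [IsProbabilityMeasure Λ]
    (hlaw : ∀ t, P.map (D t) = Λ) {V : S → ℝ} (hV : Measurable V) {B : Set S}
    (hs₀ : s₀ ∈ B) (hB : ∀ s ∈ B, ∀ z, step s z ∈ B) {Θ γ e Q : ℝ} (hγ : 0 ≤ γ) (hγ1 : γ ≤ 1)
    (he : 0 ≤ e) (hQ : 0 ≤ Q)
    (hone : ∀ s ∈ B, ∀ θ ∈ Set.Icc 0 Θ, ∫⁻ z, ENNReal.ofReal (Real.exp (θ * V (step s z))) ∂Λ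
      ≤ ENNReal.ofReal (Real.exp (θ * (1 - γ) * V s + (θ * γ * e + θ ^ 2 * γ * Q))))
    (t : ℕ) {θ v : ℝ} (hθ : θ ∈ Set.Icc 0 Θ) :
    P.real {ω | v < V (X (fun i => D i ω) t)}
      ≤ Real.exp (θ * ((1 - γ) ^ t * V s₀ + e) + θ ^ 2 * Q - θ * v) := by
  have hXm : Measurable fun ω => X (fun i => D i ω) t :=
    (measurable_recursion hstep h0 hX t).comp (measurable_pi_iff.2 hD)
  have h1 := lintegral_exp_recursion_le hstep h0 hX hD hind hlaw hV hs₀ hB hγ hγ1 he hQ hone t hθ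
  have h2 := mul_meas_ge_le_lintegral (μ := P)
    (f := fun ω => ENNReal.ofReal (Real.exp (θ * V (X (fun i => D i ω) t))))
    ((hV.comp hXm).const_mul _).exp.ennreal_ofReal
    (ENNReal.ofReal (Real.exp (θ * v)))
  have h3 : P {ω | v < V (X (fun i => D i ω) t)} ≤ P {ω | ENNReal.ofReal (Real.exp (θ * v)) ≤
      ENNReal.ofReal (Real.exp (θ * V (X (fun i => D i ω) t)))} := by
    apply measure_mono
    intro ω hω
    apply ENNReal.ofReal_le_ofReal
    have := hθ.1
    have hω' : v < V (X (fun i => D i ω) t) := hω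
    gcongr
  have h4 : ENNReal.ofReal (Real.exp (θ * v)) * P {ω | v < V (X (fun i => D i ω) t)} ≤
      ENNReal.ofReal (Real.exp (θ * ((1 - γ) ^ t * V s₀ + e) + θ ^ 2 * Q)) :=
    (mul_le_mul_right h3 _).trans (h2.trans h1)
  have h5 := ENNReal.toReal_mono ENNReal.ofReal_ne_top h4
  rw [ENNReal.toReal_mul, ENNReal.toReal_ofReal (Real.exp_pos _).le,
    ENNReal.toReal_ofReal (Real.exp_pos _).le] at h5
  rw [Real.exp_sub, le_div_iff₀ (Real.exp_pos _), mul_comm]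
  exact h5

end Recursion

/-! ### Geometry of the projection box -/

/-- The linear demands with optimal price in `[b₁, b₂]` and optimal quantity in `[y₁, y₂]`. -/
def demandBox (b₁ b₂ y₁ y₂ : ℝ) : Set (Fin 2 → ℝ) :=
  {β | y₁ ≤ β 0 / 2 ∧ β 0 / 2 ≤ y₂ ∧ 2 * b₁ * -β 1 ≤ β 0 ∧ β 0 ≤ 2 * b₂ * -β 1}

section DemandBox

variable {b₁ b₂ y₁ y₂ : ℝ}

lemma demandBox_sign (hb₂ : 0 < b₂) (hy₁ : 0 < y₁) {β : Fin 2 → ℝ}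
    (hβ : β ∈ demandBox b₁ b₂ y₁ y₂) : 0 < β 0 ∧ β 1 < 0 := by
  obtain ⟨h1, h2, h3, h4⟩ := hβ
  have h0 : 0 < β 0 := by linarith
  refine ⟨h0, ?_⟩
  by_contra hcon
  nlinarith [not_lt.1 hcon]

/-- The ratio constraint on the price becomes linear once the denominator is cleared. The box is
thus a convex polyhedron in `β` and a rectangle in price and quantity. -/
lemma mem_demandBox_iff {β : Fin 2 → ℝ} (h1 : β 1 < 0) :
    β ∈ demandBox b₁ b₂ y₁ y₂ ↔ linPrice β ∈ Set.Icc b₁ b₂ ∧ β 0 / 2 ∈ Set.Icc y₁ y₂ := by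
  have e : linPrice β = β 0 / (2 * -β 1) := by
    unfold linPrice
    rw [← neg_div_neg_eq]
    ring_nf
  have hp : 0 < 2 * -β 1 := by linarith
  rw [e, Set.mem_Icc, Set.mem_Icc, le_div_iff₀ hp, div_le_iff₀ hp]
  change (_ ∧ _ ∧ _ ∧ _) ↔ _
  constructor
  · rintro ⟨h1, h2, h3, h4⟩
    exact ⟨⟨by linarith, by linarith⟩, h1, h2⟩
  · rintro ⟨⟨h1, h2⟩, h3, h4⟩
    exact ⟨h3, h4, by linarith, by linarith⟩

lemma isClosed_demandBox : IsClosed (demandBox b₁ b₂ y₁ y₂) := by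
  refine (isClosed_le (f := fun _ => y₁) (g := fun β : Fin 2 → ℝ => β 0 / 2) ?_ ?_).inter
    ((isClosed_le (f := fun β : Fin 2 → ℝ => β 0 / 2) (g := fun _ => y₂) ?_ ?_).inter
    ((isClosed_le (f := fun β : Fin 2 → ℝ => 2 * b₁ * -β 1) (g := fun β => β 0) ?_ ?_).inter
    (isClosed_le (f := fun β : Fin 2 → ℝ => β 0) (g := fun β => 2 * b₂ * -β 1) ?_ ?_))) <;>
  fun_prop

lemma isCompact_demandBox (hb₁ : 0 < b₁) (hb₂ : 0 < b₂) (hy₁ : 0 < y₁) :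
    IsCompact (demandBox b₁ b₂ y₁ y₂) := by
  refine IsCompact.of_isClosed_subset (isCompact_Icc (a := ![2 * y₁, -(y₂ / b₁)])
    (b := ![2 * y₂, 0])) isClosed_demandBox ?_
  intro β hβ
  have hs := demandBox_sign hb₂ hy₁ hβ
  obtain ⟨h1, h2, h3, h4⟩ := hβ
  constructor
  · intro i
    fin_cases i
    · simp; linarith
    · simp only [Fin.mk_one, Matrix.cons_val_one, Matrix.cons_val_fin_one]
      have : -β 1 ≤ y₂ / b₁ := by
        rw [le_div_iff₀ hb₁]; linarith
      linarith
  · intro i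
    fin_cases i
    · simp; linarith
    · simpa using hs.2.le

lemma convex_demandBox : Convex ℝ (demandBox b₁ b₂ y₁ y₂) := by
  intro β hβ β' hβ' s t hs ht hst
  obtain ⟨h1, h2, h3, h4⟩ := hβ
  obtain ⟨h1', h2', h3', h4'⟩ := hβ'
  have e := hst
  obtain rfl : t = 1 - s := by linarith
  refine ⟨?_, ?_, ?_, ?_⟩ <;>
    simp only [Pi.add_apply, Pi.smul_apply, smul_eq_mul]
  · nlinarith
  · nlinarith
  · nlinarith
  · nlinarith

/-- Strict inequalities give interior points of the box. -/
lemma demandBox_subset_interior {b₁' b₂' y₁' y₂' : ℝ} (hb₂ : 0 < b₂') (hy : 0 < y₁')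
    (h1 : b₁ < b₁') (h2 : b₂' < b₂) (h3 : y₁ < y₁') (h4 : y₂' < y₂) :
    demandBox b₁' b₂' y₁' y₂' ⊆ interior (demandBox b₁ b₂ y₁ y₂) := by
  have ho : IsOpen {β : Fin 2 → ℝ |
      y₁ < β 0 / 2 ∧ β 0 / 2 < y₂ ∧ 2 * b₁ * -β 1 < β 0 ∧ β 0 < 2 * b₂ * -β 1} := by
    refine (isOpen_lt (f := fun _ => y₁) (g := fun β : Fin 2 → ℝ => β 0 / 2) ?_ ?_).inter
      ((isOpen_lt (f := fun β : Fin 2 → ℝ => β 0 / 2) (g := fun _ => y₂) ?_ ?_).inter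
      ((isOpen_lt (f := fun β : Fin 2 → ℝ => 2 * b₁ * -β 1) (g := fun β => β 0) ?_ ?_).inter
      (isOpen_lt (f := fun β : Fin 2 → ℝ => β 0) (g := fun β => 2 * b₂ * -β 1) ?_ ?_))) <;>
    fun_prop
  intro β hβ
  have hs := demandBox_sign hb₂ hy hβ
  obtain ⟨g1, g2, g3, g4⟩ := hβ
  refine mem_interior.2 ⟨_, ?_, ho, ?_⟩
  · rintro β ⟨a1, a2, a3, a4⟩
    exact ⟨a1.le, a2.le, a3.le, a4.le⟩
  · refine ⟨by linarith, by linarith, ?_, ?_⟩ <;> nlinarith [hs.2]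

end DemandBox

/-! ### One step of the algorithm in price and quantity coordinates -/

lemma lsUpdate_apply {ε : ℝ} (hε : ε ≠ 0) (a : ℝ) (β : Fin 2 → ℝ) (e q : ℝ) :
    lsUpdate ε a β (linPrice β + e) q 0 = β 0 + a * ((q - (β 0 + β 1 * (linPrice β + e)))
        * (1 - linPrice β * (3 * e / ε ^ 2))) ∧
    lsUpdate ε a β (linPrice β + e) q 1 = β 1 + a * ((q - (β 0 + β 1 * (linPrice β + e)))
        * (3 * e / ε ^ 2)) := by
  -- The determinant is the noise variance whatever the price, so the inverse maps `(1, b + e)` to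
  -- `(1 - b * v, v)` with `v = 3 * e / ε ^ 2`.
  have hdet : (momentMatrix ε (linPrice β)).det = ε ^ 2 / 3 := by
    unfold momentMatrix
    rw [Matrix.det_fin_two_of]; ring
  have hinv : (momentMatrix ε (linPrice β))⁻¹ *ᵥ ![1, linPrice β + e]
      = ![1 - linPrice β * (3 * e / ε ^ 2), 3 * e / ε ^ 2] := by
    rw [Matrix.inv_def, hdet, momentMatrix, Matrix.adjugate_fin_two_of, Ring.inverse_eq_inv']
    ext i
    fin_cases i
    · simp [Matrix.mulVec, dotProduct, Fin.sum_univ_two]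
      field_simp
      ring
    · simp [Matrix.mulVec, dotProduct, Fin.sum_univ_two]
      field_simp
      ring
  unfold lsUpdate
  rw [hinv]
  constructor <;> simp <;> ring

open Classical in
/-- One step of the constant-gain algorithm. -/
def lsStep {𝓕 : Set (Measure ℝ)} (pf : ProjectionFacility 𝓕) (ε a : ℝ) {N : ℕ} (β : Fin 2 → ℝ)
    (z : ℝ × (Fin N → ℝ)) : Fin 2 → ℝ :=
  if lsUpdate ε a β (linPrice β + z.1) (quantity z.2 (linPrice β + z.1)) ∈ pf.box then
    lsUpdate ε a β (linPrice β + z.1) (quantity z.2 (linPrice β + z.1)) else pf.reset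

lemma measurable_linPrice : Measurable linPrice := by
  unfold linPrice
  fun_prop

lemma measurable_lsStep {𝓕 : Set (Measure ℝ)} (pf : ProjectionFacility 𝓕) {ε : ℝ} (hε : ε ≠ 0)
    (a : ℝ) {N : ℕ} :
    Measurable (Function.uncurry (lsStep pf ε a (N := N))) := by
  have hl : Measurable fun w : (Fin 2 → ℝ) × (ℝ × (Fin N → ℝ)) => linPrice w.1 :=
    measurable_linPrice.comp measurable_fst
  have hq : Measurable fun w : (Fin 2 → ℝ) × (ℝ × (Fin N → ℝ)) =>
      quantity w.2.2 (linPrice w.1 + w.2.1) :=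
    measurable_quantity.comp (f := fun w : (Fin 2 → ℝ) × (ℝ × (Fin N → ℝ)) =>
      (w.2.2, linPrice w.1 + w.2.1)) (by fun_prop)
  have hu : Measurable fun w : (Fin 2 → ℝ) × (ℝ × (Fin N → ℝ)) =>
      lsUpdate ε a w.1 (linPrice w.1 + w.2.1) (quantity w.2.2 (linPrice w.1 + w.2.1)) := by
    rw [measurable_pi_iff]
    intro i
    fin_cases i
    · simp only [Fin.zero_eta, (lsUpdate_apply hε _ _ _ _).1]
      fun_prop
    · simp only [Fin.mk_one, (lsUpdate_apply hε _ _ _ _).2]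
      fun_prop
  exact Measurable.ite (hu pf.box_compact.isClosed.measurableSet) hu measurable_const

/-- The Lyapunov function of the estimated linear demand. -/
def betaLyap (K₁ K₂ E c b₀ x₀ : ℝ) (β : Fin 2 → ℝ) : ℝ :=
  lyap K₁ K₂ E c b₀ x₀ (linPrice β) (linPrice β * (β 0 / 2))

lemma measurable_betaLyap (K₁ K₂ E c b₀ x₀ : ℝ) : Measurable (betaLyap K₁ K₂ E c b₀ x₀) := by
  have := measurable_linPrice
  unfold betaLyap lyap entropyGap
  fun_prop

/-- Constants for the effect of one least-squares step on the Lyapunov function, see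
`exists_step_constants`. -/
structure StepConstants (b₁ b₂ br c xlo xhi K₁ K₂ E y₁ y₂ : ℝ) where
  δ : ℝ
  C₁ : ℝ
  C₂ : ℝ
  δ_pos : 0 < δ
  C₁_pos : 0 < C₁
  C₂_pos : 0 < C₂
  bound : ∀ b₀ x₀ b y a Z r v ζ : ℝ, br ≤ b₀ → b₀ + 2 * c ≤ b₂ →
      xlo ≤ x₀ → x₀ ≤ xhi → b ∈ Set.Icc b₁ b₂ → y ∈ Set.Icc y₁ y₂ → 0 < a → 0 < Z →
      a * Z ≤ δ → |r| ≤ Z → |r * v| ≤ Z → |ζ| ≤ Z → ζ = r * (1 + b * v) →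
      0 < y / b - a * (r * v) ∧ 0 < 2 * y + a * (r * (1 - b * v)) ∧
      |lyapB K₁ K₂ E c b₀ b (b * y) * (ζ / (2 * (y / b)))
          + lyapX E c b₀ x₀ b (b * y) * (b * r)| ≤ C₁ * Z ∧
      lyap K₁ K₂ E c b₀ x₀ ((2 * y + a * (r * (1 - b * v))) / (2 * (y / b - a * (r * v))))
        ((2 * y + a * (r * (1 - b * v))) / (2 * (y / b - a * (r * v)))
          * ((2 * y + a * (r * (1 - b * v))) / 2)) ≤
        lyap K₁ K₂ E c b₀ x₀ b (b * y)
        + a * (lyapB K₁ K₂ E c b₀ b (b * y) * (ζ / (2 * (y / b)))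
          + lyapX E c b₀ x₀ b (b * y) * (b * r)) + C₂ * (a * Z) ^ 2

/-- A bound for `ε` times the size of a least-squares step of gain one. -/
def noiseScale (b₁ b₂ y₂ : ℝ) : ℝ := 3 * (1 + y₂ + y₂ / b₁) * (1 + b₂)

/-- The coefficients of the linearized change of the Lyapunov function as an affine function of the
noise, times the forecast error. -/
def linCoeff (K₁ K₂ E c b₀ x₀ b y : ℝ) : ℝ :=
  lyapB K₁ K₂ E c b₀ b (b * y) / (2 * (y / b)) + lyapX E c b₀ x₀ b (b * y) * b

/-- The slope coefficient accompanying `linCoeff`. -/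
def noiseCoeff (K₁ K₂ E c b₀ b y ε : ℝ) : ℝ :=
  lyapB K₁ K₂ E c b₀ b (b * y) / (2 * (y / b)) * (b * (3 / ε ^ 2))

/-- The linearized change of the Lyapunov function in one step of gain one. -/
def linChange {N : ℕ} (K₁ K₂ E c b₀ x₀ ε b y : ℝ) (z : ℝ × (Fin N → ℝ)) : ℝ :=
  (quantity z.2 (b + z.1) - y + y / b * z.1)
    * (linCoeff K₁ K₂ E c b₀ x₀ b y + noiseCoeff K₁ K₂ E c b₀ b y ε * z.1)

lemma measurable_linChange {N : ℕ} (K₁ K₂ E c b₀ x₀ ε b y : ℝ) :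
    Measurable (linChange (N := N) K₁ K₂ E c b₀ x₀ ε b y) := by
  have hq : Measurable fun z : ℝ × (Fin N → ℝ) => quantity z.2 (b + z.1) :=
    measurable_quantity.comp (f := fun z : ℝ × (Fin N → ℝ) => (z.2, b + z.1)) (by fun_prop)
  unfold linChange
  fun_prop

/-- The forecast error itself is bounded; the factor `1 / ε` comes from the weight `3 * e / ε ^ 2`,
the price of identifying a slope from noise of width `ε`. -/
lemma abs_error_le {b₁ b₂ y₁ y₂ ε b y e q : ℝ} (hb₁ : 0 < b₁) (hy₁ : 0 < y₁)
    (hb : b ∈ Set.Icc b₁ b₂) (hy : y ∈ Set.Icc y₁ y₂) (hε : 0 < ε) (hε1 : ε ≤ 1) (he : |e| ≤ ε)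
    (hq : 0 ≤ q) (hq1 : q ≤ 1) :
    |q - y + y / b * e| ≤ noiseScale b₁ b₂ y₂ / ε ∧
    |(q - y + y / b * e) * (3 * e / ε ^ 2)| ≤ noiseScale b₁ b₂ y₂ / ε ∧
    |(q - y + y / b * e) * (1 + b * (3 * e / ε ^ 2))| ≤ noiseScale b₁ b₂ y₂ / ε := by
  have hb0 : 0 < b := by linarith [hb.1]
  have hy0 : 0 < y := by linarith [hy.1]
  have hb20 : 0 < b₂ := by linarith [hb.2]
  have hy20 : 0 < y₂ := by linarith [hy.2]
  set R := 1 + y₂ + y₂ / b₁ with hR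
  have hR0 : 0 < R := by positivity
  have hr : |q - y + y / b * e| ≤ R := by
    have h1 : |y / b * e| ≤ y₂ / b₁ * 1 := by
      rw [abs_mul, abs_of_pos (by positivity : 0 < y / b)]
      have h2 : y / b ≤ y₂ / b₁ := div_le_div₀ hy20.le hy.2 hb₁ hb.1
      gcongr
      exact he.trans hε1
    have h3 : |q - y| ≤ 1 + y₂ := by
      rw [abs_le]; constructor <;> linarith [hy.2]
    refine (abs_add_le _ _).trans ?_
    linarith
  have hv : |3 * e / ε ^ 2| ≤ 3 / ε := by
    rw [abs_div, abs_mul, abs_of_pos (by positivity : 0 < ε ^ 2), abs_of_pos (by norm_num :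
      (0 : ℝ) < 3), div_le_div_iff₀ (by positivity) hε]
    nlinarith
  have h1ε : 1 ≤ 1 / ε := by rw [le_div_iff₀ hε]; linarith
  have hv1 : |1 + b * (3 * e / ε ^ 2)| ≤ 3 * (1 + b₂) / ε := by
    refine (abs_add_le _ _).trans ?_
    rw [abs_mul, abs_of_pos hb0, abs_one]
    have h2 : b * |3 * e / ε ^ 2| ≤ b₂ * (3 / ε) := by
      have := hb.2
      gcongr
    have h3 : 3 * (1 + b₂) / ε = 3 * (1 / ε) + b₂ * (3 / ε) := by ring
    rw [h3]
    linarith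
  have hS : noiseScale b₁ b₂ y₂ / ε = R * (3 * (1 + b₂) / ε) := by
    unfold noiseScale; ring
  rw [hS]
  have h3 : 1 ≤ 3 * (1 + b₂) / ε := by
    have h4 : 3 * (1 + b₂) / ε = 3 * (1 + b₂) * (1 / ε) := by ring
    rw [h4]
    have : 1 ≤ 3 * (1 + b₂) := by linarith
    nlinarith
  refine ⟨?_, ?_, ?_⟩
  · nlinarith
  · rw [abs_mul]
    apply mul_le_mul hr _ (abs_nonneg _) hR0.le
    refine hv.trans ?_
    gcongr
    linarith
  · rw [abs_mul]
    exact mul_le_mul hr hv1 (abs_nonneg _) hR0.le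

section OneStep

variable {b₁ br b₂ c q κ L C xlo xhi yl yh : ℝ}
  (Ψ : LyapunovConstants b₁ br b₂ c q κ L C xlo xhi yl yh)
  (Φ : StepConstants b₁ b₂ br c xlo xhi Ψ.K₁ Ψ.K₂ Ψ.E Ψ.y₁ Ψ.y₂)
  {𝓕 : Set (Measure ℝ)} {pf : ProjectionFacility 𝓕} {N : ℕ} {ε a b₀ x₀ : ℝ}

/-- The projection facility does not increase the Lyapunov function. -/
lemma betaLyap_lsStep_le_lsUpdate (hbr : 0 < br) (hbox : pf.box = demandBox b₁ b₂ Ψ.y₁ Ψ.y₂)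
    (hreset : pf.reset = ![2, -(1 / br)])
    (hb₀ : br ≤ b₀) (hb₀' : b₀ + 2 * c ≤ b₂) (hx₀ : xlo ≤ x₀) (hx₀' : x₀ ≤ xhi)
    {β : Fin 2 → ℝ} {z : ℝ × (Fin N → ℝ)}
    (h0 : 0 < lsUpdate ε a β (linPrice β + z.1) (quantity z.2 (linPrice β + z.1)) 0)
    (h1 : lsUpdate ε a β (linPrice β + z.1) (quantity z.2 (linPrice β + z.1)) 1 < 0) :
    betaLyap Ψ.K₁ Ψ.K₂ Ψ.E c b₀ x₀ (lsStep pf ε a β z) ≤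
      betaLyap Ψ.K₁ Ψ.K₂ Ψ.E c b₀ x₀
        (lsUpdate ε a β (linPrice β + z.1) (quantity z.2 (linPrice β + z.1))) := by
  unfold lsStep
  split_ifs with hin
  · exact le_rfl
  · generalize lsUpdate ε a β (linPrice β + z.1) (quantity z.2 (linPrice β + z.1)) = β' at *
    rw [hbox, mem_demandBox_iff h1] at hin
    have hpos : 0 < linPrice β' := by
      unfold linPrice
      exact div_pos_of_neg_of_neg (by linarith) (by linarith)
    have h4 := Ψ.exit b₀ x₀ hb₀ hb₀' hx₀ hx₀' (linPrice β') (β' 0 / 2) hpos (by linarith) hin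
    have h2 : linPrice pf.reset = br := by
      rw [hreset]; unfold linPrice; simp; field_simp
    have h3 : pf.reset 0 / 2 = 1 := by rw [hreset]; simp
    unfold betaLyap
    rw [h2, h3, mul_one]
    exact h4

/-- One step of the algorithm changes the Lyapunov function by at most its linearized change, up to
a second-order term. -/
lemma betaLyap_lsStep_le (hb₁ : 0 < b₁) (hb₂ : 0 < b₂)
    (hbr : 0 < br) (hbox : pf.box = demandBox b₁ b₂ Ψ.y₁ Ψ.y₂) (hreset : pf.reset = ![2, -(1 / br)])
    (hb₀ : br ≤ b₀) (hb₀' : b₀ + 2 * c ≤ b₂) (hx₀ : xlo ≤ x₀) (hx₀' : x₀ ≤ xhi)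
    (hε : 0 < ε) (hε1 : ε ≤ 1) (ha : 0 < a) (haδ : a * (noiseScale b₁ b₂ Ψ.y₂ / ε) ≤ Φ.δ)
    {β : Fin 2 → ℝ} (hβ : β ∈ pf.box) {z : ℝ × (Fin N → ℝ)} (hz : |z.1| ≤ ε) :
    |linChange Ψ.K₁ Ψ.K₂ Ψ.E c b₀ x₀ ε (linPrice β) (β 0 / 2) z|
      ≤ Φ.C₁ * (noiseScale b₁ b₂ Ψ.y₂ / ε) ∧
    betaLyap Ψ.K₁ Ψ.K₂ Ψ.E c b₀ x₀ (lsStep pf ε a β z) ≤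
      betaLyap Ψ.K₁ Ψ.K₂ Ψ.E c b₀ x₀ β
        + a * linChange Ψ.K₁ Ψ.K₂ Ψ.E c b₀ x₀ ε (linPrice β) (β 0 / 2) z
        + Φ.C₂ * (a * (noiseScale b₁ b₂ Ψ.y₂ / ε)) ^ 2 := by
  rw [hbox] at hβ
  have hsign := demandBox_sign hb₂ Ψ.y₁_pos hβ
  obtain ⟨hb, hy⟩ := (mem_demandBox_iff hsign.2).1 hβ
  set b := linPrice β with hbdef
  set y := β 0 / 2 with hydef
  have hb0 : 0 < b := by linarith [hb.1]
  have hy0 : 0 < y := by linarith [hy.1, Ψ.y₁_pos]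
  -- In price and quantity coordinates the slope is `-y / b`, so the predicted quantity at `b + z.1`
  -- is `y - y / b * z.1`.
  have hs : y / b = -β 1 := by
    rw [hbdef, hydef, linPrice]
    have := hsign.1.ne'
    have := hsign.2.ne
    field_simp
  set p := b + z.1
  set Q := quantity z.2 p
  set r := Q - y + y / b * z.1 with hr
  set v := 3 * z.1 / ε ^ 2 with hv
  have hrq : Q - (β 0 + β 1 * p) = r := by
    have h1 : β 1 = -(y / b) := by rw [hs]; ring
    have h2 : β 0 = 2 * y := by rw [hydef]; ring
    rw [h1, h2, hr]
    have h3 : y / b * b = y := by field_simp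
    change Q - (2 * y + -(y / b) * (b + z.1)) = _
    linear_combination h3
  obtain ⟨e1, e2, e3⟩ := abs_error_le (b₂ := b₂) hb₁ Ψ.y₁_pos hb hy hε hε1 hz
    (quantity_nonneg z.2 p) (quantity_le_one z.2 p)
  have hZ : 0 < noiseScale b₁ b₂ Ψ.y₂ / ε := by
    have : 0 < Ψ.y₂ := by linarith [hy.2]
    unfold noiseScale
    positivity
  obtain ⟨p1, p2, p3, p4⟩ := Φ.bound b₀ x₀ b y a _ r v _ hb₀ hb₀' hx₀ hx₀' hb hy ha hZ haδ
    e1 e2 e3 rfl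
  obtain ⟨u0, u1⟩ := lsUpdate_apply hε.ne' a β z.1 Q
  have hlin : lyapB Ψ.K₁ Ψ.K₂ Ψ.E c b₀ b (b * y) * (r * (1 + b * v) / (2 * (y / b)))
          + lyapX Ψ.E c b₀ x₀ b (b * y) * (b * r)
      = linChange Ψ.K₁ Ψ.K₂ Ψ.E c b₀ x₀ ε b y z := by
    unfold linChange linCoeff noiseCoeff
    change _ = r * _
    rw [hv]
    ring
  rw [hlin] at p3 p4
  refine ⟨p3, ?_⟩
  have hβ0 : β 0 = 2 * y := by rw [hydef]; ring
  have hβ1 : β 1 = -(y / b) := by rw [hs]; ring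
  set β' := lsUpdate ε a β p Q with hβ'
  have v0 : β' 0 = 2 * y + a * (r * (1 - b * v)) := by
    rw [← hβ0, ← hrq]; exact u0
  have v1 : -β' 1 = y / b - a * (r * v) := by
    have : β' 1 = β 1 + a * (r * v) := by rw [← hrq]; exact u1
    rw [this, hβ1]; ring
  have hlp : linPrice β' = (2 * y + a * (r * (1 - b * v))) / (2 * (y / b - a * (r * v))) := by
    unfold linPrice
    rw [← v0, ← v1, ← neg_div_neg_eq]
    ring_nf
  have hV' : betaLyap Ψ.K₁ Ψ.K₂ Ψ.E c b₀ x₀ β' ≤ betaLyap Ψ.K₁ Ψ.K₂ Ψ.E c b₀ x₀ β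
        + a * linChange Ψ.K₁ Ψ.K₂ Ψ.E c b₀ x₀ ε b y z
        + Φ.C₂ * (a * (noiseScale b₁ b₂ Ψ.y₂ / ε)) ^ 2 := by
    unfold betaLyap
    rw [hlp, v0]
    exact p4
  have hneg : β' 1 < 0 := by linarith
  have hpos : 0 < β' 0 := by rw [v0]; exact p2
  exact (betaLyap_lsStep_le_lsUpdate Ψ hbr hbox hreset hb₀ hb₀' hx₀ hx₀' hpos hneg).trans hV'

/-- The mean of the linearized change is the derivative of the Lyapunov function along the mean
dynamics. -/
lemma integral_linChange_le (hb₁ : 0 < b₁) {ν : Fin N → Measure ℝ}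
    (hν : ∀ i, IsProbabilityMeasure (ν i)) [IsProbabilityMeasure (aggregate ν)]
    (hac : aggregate ν ≪ volume) (hF : Continuous (cdf (aggregate ν)))
    (hε : 0 < ε) (hε1 : ε ≤ 1)
    (h : DriftBounds b₁ br b₂ c q κ L C xlo xhi ε (meanDemand (cdf (aggregate ν)) ε)
      (meanMarginal (cdf (aggregate ν)) ε) b₀ x₀)
    {b y : ℝ} (hb : b ∈ Set.Icc b₁ b₂) (hy : y ∈ Set.Icc Ψ.y₁ Ψ.y₂)
    (hint : Integrable (linChange Ψ.K₁ Ψ.K₂ Ψ.E c b₀ x₀ ε b y)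
      ((noiseLaw ε).prod (Measure.pi ν))) :
    ∫ z, linChange Ψ.K₁ Ψ.K₂ Ψ.E c b₀ x₀ ε b y z ∂((noiseLaw ε).prod (Measure.pi ν))
      ≤ -(Ψ.rate * lyap Ψ.K₁ Ψ.K₂ Ψ.E c b₀ x₀ b (b * y)) + Ψ.err * ε := by
  have hb0 : 0 < b := by linarith [hb.1]
  have hy0 : 0 < y := by linarith [hy.1, Ψ.y₁_pos]
  refine le_trans (le_of_eq ?_) (Ψ.drift ε _ _ b₀ x₀ hε hε1 h b hb y hy)
  -- The error has mean A - y, and its mean against the slope weight is y/b - S. In the linearized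
  -- step these combine to G for the price and b A - x for the profit.
  have := integral_error_mul hν hac hF hε b y (y / b) _ _ hint
  refine this.trans ?_
  unfold linCoeff noiseCoeff meanMarginal
  field_simp
  ring

/-- One step of the algorithm contracts the Lyapunov function, at the level of exponential
moments. -/
lemma lintegral_exp_lsStep_le (hb₁ : 0 < b₁) (hb₂ : 0 < b₂)
    (hbr : 0 < br) (hbox : pf.box = demandBox b₁ b₂ Ψ.y₁ Ψ.y₂) (hreset : pf.reset = ![2, -(1 / br)])
    {ν : Fin N → Measure ℝ}
    (hν : ∀ i, IsProbabilityMeasure (ν i)) [IsProbabilityMeasure (aggregate ν)]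
    (hac : aggregate ν ≪ volume) (hF : Continuous (cdf (aggregate ν)))
    (hε : 0 < ε) (hε1 : ε ≤ 1)
    (h : DriftBounds b₁ br b₂ c q κ L C xlo xhi ε (meanDemand (cdf (aggregate ν)) ε)
      (meanMarginal (cdf (aggregate ν)) ε) b₀ x₀)
    (ha : 0 < a) (haδ : a * (noiseScale b₁ b₂ Ψ.y₂ / ε) ≤ Φ.δ)
    (haC : Φ.C₂ * (a * (noiseScale b₁ b₂ Ψ.y₂ / ε) ^ 2) ≤ Ψ.err * ε)
    {β : Fin 2 → ℝ} (hβ : β ∈ pf.box) {θ : ℝ} (hθ : 0 ≤ θ)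
    (hθ1 : θ * (a * (Φ.C₁ * (noiseScale b₁ b₂ Ψ.y₂ / ε))) ≤ 1) :
    ∫⁻ z, ENNReal.ofReal (Real.exp (θ * betaLyap Ψ.K₁ Ψ.K₂ Ψ.E c b₀ x₀ (lsStep pf ε a β z)))
      ∂((noiseLaw ε).prod (Measure.pi ν)) ≤
    ENNReal.ofReal (Real.exp (θ * (1 - Ψ.rate * a) * betaLyap Ψ.K₁ Ψ.K₂ Ψ.E c b₀ x₀ β
      + (θ * (Ψ.rate * a) * (2 * Ψ.err * ε / Ψ.rate) + θ ^ 2 * (Ψ.rate * a) *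
        (a * (Φ.C₁ * (noiseScale b₁ b₂ Ψ.y₂ / ε)) ^ 2 / Ψ.rate)))) := by
  have := isProbabilityMeasure_noiseLaw hε
  set Z := noiseScale b₁ b₂ Ψ.y₂ / ε
  set Λ := (noiseLaw ε).prod (Measure.pi ν) with hΛ
  set V := betaLyap Ψ.K₁ Ψ.K₂ Ψ.E c b₀ x₀ with hV
  set W := linChange (N := N) Ψ.K₁ Ψ.K₂ Ψ.E c b₀ x₀ ε (linPrice β) (β 0 / 2) with hW
  have hnoise : ∀ᵐ z ∂Λ, |z.1| ≤ ε :=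
    Measure.quasiMeasurePreserving_fst.ae ae_noiseLaw
  have hstep := fun z (hz : |z.1| ≤ ε) => betaLyap_lsStep_le Ψ Φ (N := N) hb₁ hb₂ hbr hbox hreset
    h.br_le h.le_right h.xlo_le h.le_xhi hε hε1 ha haδ hβ (z := z) hz
  have hWm : Measurable W := measurable_linChange _ _ _ _ _ _ _ _ _
  have hWb : ∀ᵐ z ∂Λ, |W z| ≤ Φ.C₁ * Z := by
    filter_upwards [hnoise] with z hz using (hstep z hz).1
  have hint : Integrable W Λ := Integrable.of_bound hWm.aestronglyMeasurable _
    (by simpa using hWb)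
  have hβ' := hβ
  rw [hbox] at hβ'
  obtain ⟨hb, hy⟩ := (mem_demandBox_iff (demandBox_sign hb₂ Ψ.y₁_pos hβ').2).1 hβ'
  have hmean : ∫ z, W z ∂Λ ≤ -(Ψ.rate * V β) + Ψ.err * ε :=
    integral_linChange_le Ψ hb₁ hν hac hF hε hε1 h hb hy hint
  -- The gain is absorbed into the parameter: the linear change is exponentiated with `θ * a`.
  have h1 := lintegral_exp_le (Λ := Λ) hWm hWb (θ := θ * a) (by positivity) (by
    rw [mul_assoc]; exact hθ1)
  calc ∫⁻ z, ENNReal.ofReal (Real.exp (θ * V (lsStep pf ε a β z))) ∂Λ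
      ≤ ∫⁻ z, ENNReal.ofReal (Real.exp (θ * (V β + Φ.C₂ * (a * Z) ^ 2)))
        * ENNReal.ofReal (Real.exp (θ * a * W z)) ∂Λ := by
        apply lintegral_mono_ae
        filter_upwards [hnoise] with z hz
        rw [← ENNReal.ofReal_mul (Real.exp_pos _).le, ← Real.exp_add]
        apply ENNReal.ofReal_le_ofReal
        apply Real.exp_le_exp.2
        have h2 := mul_le_mul_of_nonneg_left (hstep z hz).2 hθ
        refine h2.trans (le_of_eq ?_)
        ring
    _ ≤ ENNReal.ofReal (Real.exp (θ * (V β + Φ.C₂ * (a * Z) ^ 2))) *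
        ENNReal.ofReal (Real.exp (θ * a * ∫ z, W z ∂Λ + (θ * a * (Φ.C₁ * Z)) ^ 2)) := by
        rw [lintegral_const_mul _ (by fun_prop)]
        gcongr
    _ ≤ _ := by
        rw [← ENNReal.ofReal_mul (Real.exp_pos _).le, ← Real.exp_add]
        apply ENNReal.ofReal_le_ofReal
        apply Real.exp_le_exp.2
        have h3 : θ * a * ∫ z, W z ∂Λ ≤ θ * a * (-(Ψ.rate * V β) + Ψ.err * ε) := by gcongr
        -- The drift error and the second-order remainder each contribute `err * ε`, which explains
        -- the factor 2 in the stated error.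
        have h4 : θ * a * (Φ.C₂ * (a * Z ^ 2)) ≤ θ * a * (Ψ.err * ε) := by gcongr
        have hr := Ψ.rate_pos
        have h5 : θ * (Ψ.rate * a) * (2 * Ψ.err * ε / Ψ.rate) = 2 * (θ * a * (Ψ.err * ε)) := by
          field_simp
        have h6 : θ ^ 2 * (Ψ.rate * a) * (a * (Φ.C₁ * Z) ^ 2 / Ψ.rate)
            = (θ * a * (Φ.C₁ * Z)) ^ 2 := by
          field_simp
        rw [h5, h6]
        linarith

end OneStep

/-! ### Uniform constants of the class and the projection facility -/

/-- A lower bound for the optimal price and the optimal profit. -/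
def priceLow (l u η : ℝ) : ℝ := 1 / (4 * IHRCdf.densityBound l u η)

/-- A lower bound for the optimal quantity. -/
def quantityLow (l u η : ℝ) : ℝ := priceLow l u η / u

/-- One eighth of a lower bound for the distance of the optimal price from `u`. -/
def priceGap (l u η : ℝ) : ℝ := quantityLow l u η / IHRCdf.densityBound l u η / 8

/-- The constant in the error terms of the drift bounds. -/
def driftConst (l u η : ℝ) : ℝ :=
  IHRCdf.marginalConst l u η + 3 * u * IHRCdf.densityBound l u η + 2

section Constants

variable {l u η : ℝ} (hl : 0 ≤ l) (hlu : l < u) (hη : 0 < η)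

include hlu hη

lemma priceLow_pos : 0 < priceLow l u η := by
  have := IHRCdf.densityBound_pos hlu hη
  unfold priceLow
  positivity

include hl

lemma quantityLow_pos : 0 < quantityLow l u η :=
  div_pos (priceLow_pos hlu hη) (by linarith)

lemma priceGap_pos : 0 < priceGap l u η := by
  have := IHRCdf.densityBound_pos hlu hη
  have := quantityLow_pos hl hlu hη
  unfold priceGap
  positivity

lemma driftConst_pos : 0 < driftConst l u η := by
  have := IHRCdf.densityBound_pos hlu hη
  have : 0 < u := by linarith
  unfold driftConst IHRCdf.marginalConst
  positivity

lemma one_le_mul_densityBound : 1 ≤ u * IHRCdf.densityBound l u η := by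
  have := IHRCdf.densityBound_pos hlu hη
  have := IHRCdf.one_le_densityBound_mul hlu hη
  nlinarith

lemma quantityLow_le : quantityLow l u η ≤ 1 / 4 := by
  have h1 := IHRCdf.densityBound_pos hlu hη
  have h2 := one_le_mul_densityBound hl hlu hη
  have hu : 0 < u := by linarith
  unfold quantityLow priceLow
  rw [div_div, div_le_div_iff₀ (by positivity) (by norm_num)]
  linarith

lemma priceLow_add_priceGap_lt : priceLow l u η / 2 + 6 * priceGap l u η < u := by
  have h1 := IHRCdf.densityBound_pos hlu hη
  have h2 := one_le_mul_densityBound hl hlu hη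
  have h3 := quantityLow_le hl hlu hη
  have hu : 0 < u := by linarith
  have h4 : 1 / IHRCdf.densityBound l u η ≤ u := by
    rw [div_le_iff₀ h1]; exact h2
  have h5 : priceLow l u η = 1 / IHRCdf.densityBound l u η / 4 := by
    unfold priceLow
    rw [div_div, mul_comm]
  have h6 : priceGap l u η ≤ 1 / IHRCdf.densityBound l u η / 32 := by
    unfold priceGap
    calc quantityLow l u η / IHRCdf.densityBound l u η / 8
        ≤ 1 / 4 / IHRCdf.densityBound l u η / 8 := by gcongr
      _ = _ := by field_simp; norm_num
  linarith

end Constants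

/-- Transfers the sign change of `G` to the form used by the Lyapunov analysis, with constants that
depend on `l`, `u`, `η` only. The optimum lies at least `8 * priceGap` below `u`, which leaves room
for `b₀`, the margin `2 * c` and the noise inside the support. -/
lemma IHRCdf.driftBounds {l u η : ℝ} {F f : ℝ → ℝ} (h : IHRCdf l u η F f) {o ε : ℝ}
    (ho : ∀ p, p * (1 - F p) ≤ o * (1 - F o)) (hl : 0 ≤ l) (hlu : l < u) (hη : 0 < η)
    (hε : 0 < ε) (hεc : ε ≤ priceGap l u η / 4) (hεp : ε ≤ priceLow l u η / 4) :
    ∃ b₀, |b₀ - o| ≤ 2 * ε ∧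
      DriftBounds (priceLow l u η / 4) (priceLow l u η / 2) (u - 4 * priceGap l u η)
        (priceGap l u η) (quantityLow l u η / 2) (1 / u) (u * densityBound l u η + 1)
        (driftConst l u η) (priceLow l u η) u ε (meanDemand F ε) (meanMarginal F ε)
        b₀ (o * (1 - F o)) := by
  have hM := densityBound_pos hlu hη
  have hp0 := priceLow_pos hlu hη
  have hq0 := quantityLow_pos hl hlu hη
  have hc0 := priceGap_pos hl hlu hη
  have hop : priceLow l u η ≤ o := le_opt' h ho hl hlu hη
  have hlo := le_opt h ho
  have hou : o ≤ u - 8 * priceGap l u η := by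
    have := opt_le h ho hl hlu hη
    unfold priceGap quantityLow priceLow
    linarith
  have hoq : quantityLow l u η ≤ 1 - F o := opt_quantity_ge h ho hl hlu hη
  have hov : priceLow l u η ≤ o * (1 - F o) := opt_value h ho hl hlu hη
  have hcM : densityBound l u η * priceGap l u η = quantityLow l u η / 8 := by
    unfold priceGap; field_simp
  have hu : 0 < u := by linarith
  obtain ⟨b₀, hb₀, hroot⟩ := h.exists_approx_root ho hl hlu hη hε (by linarith) (by
    have : 1 / (16 * densityBound l u η) = priceLow l u η / 4 := by
      unfold priceLow; field_simp; norm_num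
    linarith)
  have hb₀' := abs_le.1 hb₀
  set M := densityBound l u η with hMd
  set c := priceGap l u η
  have hmc : marginalConst l u η * ε ≤ driftConst l u η * ε := by
    unfold driftConst
    have : 0 ≤ (3 * u * M + 2) * ε := by positivity
    linarith
  refine ⟨b₀, hb₀, ⟨by linarith, by linarith, hov, ?_, ?_, ?_, ?_, ?_, ?_, ?_⟩⟩
  · have := h.nonneg o
    nlinarith
  · exact fun b _ => h.meanDemand_nonneg hlu hη hε
  · exact fun b _ => h.meanDemand_le_one hlu hη hε
  · intro b hb hbc
    have h1 := meanDemand_antitone (h.continuous hlu hη) h.mono hε (le_max_left b o)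
    have h2 := (abs_le.1 (h.abs_meanDemand_sub_le (b := max b o) hlu hη hε o)).1
    have h3 : |max b o - o| ≤ 2 * c + 2 * ε := by
      rw [abs_of_nonneg (by linarith [le_max_right b o])]
      have : max b o ≤ o + 2 * c + 2 * ε := max_le (by linarith) (by linarith)
      linarith
    -- Demand is at least `quantityLow` at the optimum, and by the definition of `priceGap` it loses
    -- at most half of this over a distance `4 * c`.
    have h4 : M * (|max b o - o| + ε) ≤ M * (c * 4) := by
      gcongr
      linarith
    linarith
  · intro b hb hbb
    have h1 := (hroot b (by linarith [hb.1]) (by linarith [hb.2])).1 hbb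
    have h2 : 1 / u * ((b₀ - b) * meanDemand F ε b) = (b₀ - b) * meanDemand F ε b / u := by ring
    linarith
  · intro b hb hbb
    have h1 := (hroot b (by linarith [hb.1]) (by linarith [hb.2])).2 hbb
    have h2 : 1 / u * ((b - b₀) * meanDemand F ε b) = (b - b₀) * meanDemand F ε b / u := by ring
    linarith
  · intro b hb _
    have hb0 : 0 < b := by linarith [hb.1]
    have h1 := h.abs_meanDemand_sub_le (b := b) hlu hη hε o
    have h2 : |b - o| ≤ |b - b₀| + 2 * ε := by
      have := abs_sub_le b b₀ o
      linarith
    have h3 : |1 - F o| ≤ 1 := by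
      rw [abs_of_nonneg (by linarith)]
      linarith [h.nonneg o]
    rw [show b * meanDemand F ε b - o * (1 - F o)
      = b * (meanDemand F ε b - (1 - F o)) + (b - o) * (1 - F o) by ring]
    have h4 : |b * (meanDemand F ε b - (1 - F o))| ≤ u * (M * (|b - b₀| + 2 * ε + ε)) := by
      rw [abs_mul, abs_of_pos hb0]
      apply mul_le_mul (by linarith [hb.2]) _ (abs_nonneg _) hu.le
      refine h1.trans ?_
      gcongr
    have h5 : |(b - o) * (1 - F o)| ≤ (|b - b₀| + 2 * ε) * 1 := by
      rw [abs_mul]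
      gcongr
    refine (abs_add_le _ _).trans ?_
    have h6 : 0 ≤ marginalConst l u η * ε := by
      unfold marginalConst
      positivity
    unfold driftConst
    linarith

/-- The projection facility used by the algorithm. -/
def boxFacility {l u η : ℝ} (hl : 0 ≤ l) (hlu : l < u) (hη : 0 < η) {y₁ y₂ : ℝ} (hy₁ : 0 < y₁)
    (hy₁' : y₁ < quantityLow l u η / 2) (hy₂ : 2 < y₂) :
    ProjectionFacility (lipschitzIHR l u η) where
  core := demandBox (priceLow l u η / 3) (u - 6 * priceGap l u η) (quantityLow l u η / 2) 2
  box := demandBox (priceLow l u η / 4) (u - 4 * priceGap l u η) y₁ y₂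
  -- The demand line with price `priceLow / 2` and quantity 1. A reset price below every possible
  -- `b₀` keeps the reset value of the Lyapunov function free of `K₂` and `E`.
  reset := ![2, -(1 / (priceLow l u η / 2))]
  core_compact := by
    have h1 := priceLow_pos hlu hη
    have h2 := quantityLow_pos hl hlu hη
    have h3 := priceLow_add_priceGap_lt hl hlu hη
    exact isCompact_demandBox (by linarith) (by linarith) (by linarith)
  opt_mem_core := by
    rintro m ⟨f, hf, hlip⟩
    have h := hf.ihrCdf hlip
    have hex : ∃ b, IsOptimalPrice m b := (h.existsUnique_isMax hl hlu hη).exists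
    have ho : ∀ p, p * (1 - cdf m p) ≤ optPrice m * (1 - cdf m (optPrice m)) :=
      Classical.epsilon_spec hex
    have h1 := priceLow_pos hlu hη
    have h2 := quantityLow_pos hl hlu hη
    have h3 : priceLow l u η ≤ optPrice m := h.le_opt' ho hl hlu hη
    have h4 : optPrice m ≤ u - 8 * priceGap l u η := by
      have := h.opt_le ho hl hlu hη
      unfold priceGap quantityLow priceLow
      linarith
    have h5 : quantityLow l u η ≤ optQuantity m := h.opt_quantity_ge ho hl hlu hη
    have h6 : optQuantity m ≤ 1 := by
      unfold optQuantity
      linarith [h.nonneg (optPrice m)]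
    have h7 := priceGap_pos hl hlu hη
    have h8 : 0 < optPrice m := by linarith
    have h9 : optPrice m * (optQuantity m / optPrice m) = optQuantity m := by field_simp
    have h10 : 0 ≤ optQuantity m / optPrice m := div_nonneg (by linarith) h8.le
    unfold optBeta
    refine ⟨?_, ?_, ?_, ?_⟩ <;>
      simp only [Matrix.cons_val_zero, Matrix.cons_val_one, Matrix.cons_val_fin_one, neg_neg]
    · linarith
    · linarith
    · nlinarith
    · nlinarith
  box_compact := by
    have h1 := priceLow_pos hlu hη
    have h3 := priceLow_add_priceGap_lt hl hlu hη
    have h4 := priceGap_pos hl hlu hη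
    exact isCompact_demandBox (by linarith) (by linarith) hy₁
  box_convex := convex_demandBox
  core_subset := by
    have h1 := priceLow_pos hlu hη
    have h2 := quantityLow_pos hl hlu hη
    have h3 := priceLow_add_priceGap_lt hl hlu hη
    have h4 := priceGap_pos hl hlu hη
    exact demandBox_subset_interior (by linarith) (by linarith) (by linarith) (by linarith) hy₁' hy₂
  box_sign := fun β hβ => by
    have h1 := priceLow_pos hlu hη
    have h3 := priceLow_add_priceGap_lt hl hlu hη
    have h4 := priceGap_pos hl hlu hη
    exact demandBox_sign (by linarith) hy₁ hβ
  reset_mem := by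
    have h1 := priceLow_pos hlu hη
    have h2 := quantityLow_le hl hlu hη
    have h3 := priceLow_add_priceGap_lt hl hlu hη
    refine demandBox_subset_interior (b₁' := priceLow l u η / 2) (b₂' := priceLow l u η / 2)
      (y₁' := 1) (y₂' := 1) (by linarith) one_pos (by linarith) (by linarith) (by linarith)
      (by norm_num) ?_
    have h4 : priceLow l u η / 2 * (1 / (priceLow l u η / 2)) = 1 := by field_simp
    refine ⟨?_, ?_, ?_, ?_⟩ <;>
      simp only [Matrix.cons_val_zero, Matrix.cons_val_one, Matrix.cons_val_fin_one, neg_neg] <;>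
      linarith

/-! ### Lyapunov values, forecast errors and invariance of the box -/

lemma lyap_le {K₁ K₂ E c b₀ x₀ b x b₂ x₁ X xhi : ℝ} (hK₁ : 0 ≤ K₁) (hK₂ : 0 ≤ K₂) (hE : 0 ≤ E)
    (hc : 0 ≤ c) (hb : 0 ≤ b) (hb₂ : b ≤ b₂) (hb₀ : 0 ≤ b₀) (hb₀₂ : b₀ ≤ b₂) (hx₁ : 0 < x₁)
    (hx : x₁ ≤ x) (hxX : x ≤ X) (hx₀ : 0 < x₀) (hx₀' : x₀ ≤ xhi) :
    lyap K₁ K₂ E c b₀ x₀ b x ≤ (K₁ + K₂ + E * X) * b₂ ^ 2 + (X + xhi) ^ 2 / x₁ := by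
  have hx0 : 0 < x := by linarith
  have h1 : entropyGap x₀ x ≤ (X + xhi) ^ 2 / x₁ := by
    have h2 := mul_entropyGap_le hx₀ hx0
    have h3 : (x - x₀) ^ 2 ≤ (X + xhi) ^ 2 := by apply sq_le_sq' <;> linarith
    calc entropyGap x₀ x ≤ (x - x₀) ^ 2 / x := by rw [le_div_iff₀ hx0]; linarith
      _ ≤ _ := div_le_div₀ (by positivity) h3 hx₁ hx
  have m1 : 0 ≤ max (b₀ - b) 0 := le_max_right _ _
  have m2 : 0 ≤ max (b - b₀) 0 := le_max_right _ _
  have m3 : 0 ≤ max (b - b₀ - c) 0 := le_max_right _ _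
  have m4 : max (b₀ - b) 0 ≤ b₂ := max_le (by linarith) (by linarith)
  have m5 : max (b - b₀) 0 ≤ b₂ := max_le (by linarith) (by linarith)
  have m6 : max (b - b₀ - c) 0 ≤ b₂ := max_le (by linarith) (by linarith)
  have p1 : K₁ * max (b₀ - b) 0 ^ 2 ≤ K₁ * b₂ ^ 2 := by gcongr
  have p2 : K₂ * max (b - b₀) 0 ^ 2 ≤ K₂ * b₂ ^ 2 := by gcongr
  have p3 : E * x * max (b - b₀ - c) 0 ^ 2 ≤ E * X * b₂ ^ 2 := by
    gcongr
    exact mul_nonneg hE (by linarith)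
  unfold lyap
  linarith

lemma sq_sub_le_lyap {K₁ K₂ E c b₀ x₀ b x : ℝ} (hK₁ : 1 ≤ K₁) (hK₂ : 1 ≤ K₂) (hE : 0 ≤ E)
    (hx : 0 < x) (hx₀ : 0 < x₀) : (b - b₀) ^ 2 ≤ lyap K₁ K₂ E c b₀ x₀ b x := by
  have h1 := entropyGap_nonneg hx₀ hx
  have h2 : 0 ≤ E * x * max (b - b₀ - c) 0 ^ 2 := by positivity
  have h3 : max (b₀ - b) 0 ^ 2 ≤ K₁ * max (b₀ - b) 0 ^ 2 :=
    le_mul_of_one_le_left (sq_nonneg _) hK₁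
  have h4 : max (b - b₀) 0 ^ 2 ≤ K₂ * max (b - b₀) 0 ^ 2 :=
    le_mul_of_one_le_left (sq_nonneg _) hK₂
  unfold lyap
  rcases le_total b b₀ with hb | hb
  · rw [max_eq_left (by linarith : 0 ≤ b₀ - b)] at h3 ⊢
    nlinarith [sq_nonneg (max (b - b₀) 0)]
  · rw [max_eq_left (by linarith : 0 ≤ b - b₀)] at h4 ⊢
    nlinarith [sq_nonneg (max (b₀ - b) 0)]

lemma entropyGap_le_lyap {K₁ K₂ E c b₀ x₀ b x : ℝ} (hK₁ : 0 ≤ K₁) (hK₂ : 0 ≤ K₂) (hE : 0 ≤ E)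
    (hx : 0 < x) : entropyGap x₀ x ≤ lyap K₁ K₂ E c b₀ x₀ b x := by
  have h2 : 0 ≤ E * x * max (b - b₀ - c) 0 ^ 2 := by positivity
  have h3 : 0 ≤ K₁ * max (b₀ - b) 0 ^ 2 := by positivity
  have h4 : 0 ≤ K₂ * max (b - b₀) 0 ^ 2 := by positivity
  unfold lyap
  linarith

/-- A small value of the Lyapunov function means that price and quantity are close to optimal. -/
lemma abs_sub_opt_le {K₁ K₂ E c b₀ b y o p w ε b₁ X : ℝ} (hK₁ : 1 ≤ K₁) (hK₂ : 1 ≤ K₂)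
    (hE : 0 ≤ E) (hb₁ : 0 < b₁) (hb : b₁ ≤ b) (hy : 0 < y) (ho : 0 < o) (hp : 0 < p) (hp1 : p ≤ 1)
    (hX : b * y ≤ X) (hX' : o * p ≤ X) (hb₀ : |b₀ - o| ≤ 2 * ε) (hεw : ε ≤ w)
    (hV : lyap K₁ K₂ E c b₀ (o * p) b (b * y) ≤ w ^ 2) (hw : 0 < w) :
    |b - o| ≤ 3 * w ∧ |y - p| ≤ (X + 4) / b₁ * w := by
  have hb0 : 0 < b := by linarith
  have hx : 0 < b * y := by positivity
  have hx₀ : 0 < o * p := by positivity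
  have hX0 : 0 < X := by linarith
  have h1 : |b - b₀| ≤ w :=
    abs_le_of_sq_le_sq ((sq_sub_le_lyap hK₁ hK₂ hE hx hx₀).trans hV) hw.le
  have h2 : |b - o| ≤ 3 * w := by
    have := abs_sub_le b b₀ o
    linarith
  refine ⟨h2, ?_⟩
  -- The entropy gap controls the profit error by `2 * √X * w`, and `4 * X ≤ (1 + X) ^ 2` removes
  -- the root. The quantity error then follows from the profit and price errors after division by `b
  -- ≥ b₁`.
  have h3 : |b * y - o * p| ≤ (1 + X) * w := by
    apply abs_le_of_sq_le_sq _ (by positivity)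
    have h4 := sq_sub_le_entropyGap hx₀ hx hX' hX
    have h5 : 4 * X * entropyGap (o * p) (b * y) ≤ 4 * X * w ^ 2 := by
      have := (entropyGap_le_lyap (c := c) (b₀ := b₀) (x₀ := o * p) (b := b)
        (by linarith : 0 ≤ K₁) (by linarith : 0 ≤ K₂) hE hx).trans hV
      gcongr
    have h6 : 4 * X * w ^ 2 ≤ (1 + X) ^ 2 * w ^ 2 := by
      gcongr
      nlinarith [sq_nonneg (1 - X)]
    linarith
  have h7 : |b * (y - p)| ≤ (X + 4) * w := by
    rw [show b * (y - p) = (b * y - o * p) + p * (o - b) by ring]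
    refine (abs_add_le _ _).trans ?_
    rw [abs_mul, abs_of_pos hp, abs_sub_comm o b]
    have : p * |b - o| ≤ 1 * (3 * w) := by gcongr
    linarith
  rw [abs_mul, abs_of_pos hb0] at h7
  have h8 : b₁ * |y - p| ≤ (X + 4) * w := by
    have : b₁ * |y - p| ≤ b * |y - p| := by gcongr
    linarith
  rw [div_mul_eq_mul_div, le_div_iff₀ hb₁]
  linarith

lemma distToOpt_le (m : Measure ℝ) (x : ℝ × ℝ) :
    distToOpt m x ≤ |x.1 - optPrice m| + |x.2 - optQuantity m| := by
  unfold distToOpt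
  rw [Real.sqrt_le_left (by positivity), add_sq, sq_abs, sq_abs]
  have : 0 ≤ 2 * |x.1 - optPrice m| * |x.2 - optQuantity m| := by positivity
  linarith

lemma estimate_succ {𝓕 : Set (Measure ℝ)} (pf : ProjectionFacility 𝓕) (ε a : ℝ) (β₀ : Fin 2 → ℝ)
    {N : ℕ} (d : ℕ → ℝ × (Fin N → ℝ)) (t : ℕ) :
    estimate pf ε a β₀ d (t + 1) = lsStep pf ε a (estimate pf ε a β₀ d t) (d t) := rfl

lemma lsStep_mem_box {𝓕 : Set (Measure ℝ)} (pf : ProjectionFacility 𝓕) (ε a : ℝ) {N : ℕ}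
    (β : Fin 2 → ℝ) (z : ℝ × (Fin N → ℝ)) : lsStep pf ε a β z ∈ pf.box := by
  unfold lsStep
  split_ifs with h
  · exact h
  · exact interior_subset (pf.core_subset (interior_subset pf.reset_mem))

lemma estimate_mem_box {𝓕 : Set (Measure ℝ)} (pf : ProjectionFacility 𝓕) (ε a : ℝ)
    {β₀ : Fin 2 → ℝ} (hβ₀ : β₀ ∈ pf.box) {N : ℕ} (d : ℕ → ℝ × (Fin N → ℝ)) (t : ℕ) :
    estimate pf ε a β₀ d t ∈ pf.box := by
  cases t with
  | zero => exact hβ₀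
  | succ t => rw [estimate_succ]; exact lsStep_mem_box _ _ _ _ _

/-! ### Tail bound along the algorithm and choice of parameters -/

section Tail

variable {b₁ br b₂ c q κ L C xlo xhi yl yh : ℝ}
  (Ψ : LyapunovConstants b₁ br b₂ c q κ L C xlo xhi yl yh)
  (Φ : StepConstants b₁ b₂ br c xlo xhi Ψ.K₁ Ψ.K₂ Ψ.E Ψ.y₁ Ψ.y₂)
  {𝓕 : Set (Measure ℝ)} {pf : ProjectionFacility 𝓕} {N : ℕ} {ε a b₀ x₀ : ℝ}

/-- Exponential tail bound for the Lyapunov function along the algorithm. -/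
lemma measure_betaLyap_estimate_gt_le (hb₁ : 0 < b₁) (hb₂ : 0 < b₂)
    (hbr : 0 < br) (hbox : pf.box = demandBox b₁ b₂ Ψ.y₁ Ψ.y₂) (hreset : pf.reset = ![2, -(1 / br)])
    {ν : Fin N → Measure ℝ}
    (hν : ∀ i, IsProbabilityMeasure (ν i)) [IsProbabilityMeasure (aggregate ν)]
    (hac : aggregate ν ≪ volume) (hF : Continuous (cdf (aggregate ν)))
    (hε : 0 < ε) (hε1 : ε ≤ 1)
    (h : DriftBounds b₁ br b₂ c q κ L C xlo xhi ε (meanDemand (cdf (aggregate ν)) ε)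
      (meanMarginal (cdf (aggregate ν)) ε) b₀ x₀)
    (ha : 0 < a) (haδ : a * (noiseScale b₁ b₂ Ψ.y₂ / ε) ≤ Φ.δ)
    (haC : Φ.C₂ * (a * (noiseScale b₁ b₂ Ψ.y₂ / ε) ^ 2) ≤ Ψ.err * ε) (har : Ψ.rate * a ≤ 1)
    {β₀ : Fin 2 → ℝ} (hβ₀ : β₀ ∈ pf.box) {Ω : Type} [MeasurableSpace Ω] {P : Measure Ω}
    {D : ℕ → Ω → ℝ × (Fin N → ℝ)} (hD : IsShockProcess P ν ε D) (T : ℕ) {θ v : ℝ} (hθ : 0 ≤ θ)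
    (hθ1 : θ * (a * (Φ.C₁ * (noiseScale b₁ b₂ Ψ.y₂ / ε))) ≤ 1) :
    P.real {ω | v < betaLyap Ψ.K₁ Ψ.K₂ Ψ.E c b₀ x₀ (estimate pf ε a β₀ (fun t => D t ω) T)} ≤
      Real.exp (θ * ((1 - Ψ.rate * a) ^ T * betaLyap Ψ.K₁ Ψ.K₂ Ψ.E c b₀ x₀ β₀
          + 2 * Ψ.err * ε / Ψ.rate)
        + θ ^ 2 * (a * (Φ.C₁ * (noiseScale b₁ b₂ Ψ.y₂ / ε)) ^ 2 / Ψ.rate) - θ * v) := by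
  have := hD.isProb
  have := isProbabilityMeasure_noiseLaw hε
  have hrate := Ψ.rate_pos
  have herr := Ψ.err_pos
  refine measure_recursion_gt_le (X := fun d t => estimate pf ε a β₀ d t) (Θ := θ)
    (γ := Ψ.rate * a)
    (measurable_lsStep pf hε.ne' a) (fun _ => rfl) (fun d t => estimate_succ pf ε a β₀ d t)
    hD.meas hD.indep hD.law (measurable_betaLyap _ _ _ _ _ _) hβ₀
    (fun s _ z => lsStep_mem_box pf ε a s z) (by positivity) har (by positivity) (by positivity)
    ?_ T ⟨hθ, le_rfl⟩
  intro β hβ θ' hθ'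
  refine lintegral_exp_lsStep_le Ψ Φ hb₁ hb₂ hbr hbox hreset hν hac hF hε hε1 h ha haδ haC hβ
    hθ'.1 (le_trans ?_ hθ1)
  have h0 : β₀ ∈ demandBox b₁ b₂ Ψ.y₁ Ψ.y₂ := hbox ▸ hβ₀
  have h1 : 0 < Ψ.y₂ := by
    have := Ψ.y₁_pos
    linarith [h0.1, h0.2.1]
  have h2 : 0 < noiseScale b₁ b₂ Ψ.y₂ := by unfold noiseScale; positivity
  have h3 := Φ.C₁_pos
  have := hθ'.2
  gcongr

end Tail

lemma one_sub_pow_le_pow {r a μ : ℝ} {n T : ℕ} (hr : 0 < r) (ha : 0 < a) (har : r * a ≤ 1)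
    (hμ : 0 < μ) (hT : n / r * (-Real.log μ) / a ≤ T) : (1 - r * a) ^ T ≤ μ ^ n := by
  have h1 : 1 - r * a ≤ Real.exp (-(r * a)) := by
    have := Real.add_one_le_exp (-(r * a))
    linarith
  calc (1 - r * a) ^ T ≤ Real.exp (-(r * a)) ^ T := pow_le_pow_left₀ (by linarith) h1 T
    _ = Real.exp (-(r * a * T)) := by rw [← Real.exp_nat_mul]; ring_nf
    _ ≤ Real.exp (n * Real.log μ) := by
        apply Real.exp_le_exp.2
        rw [div_le_iff₀ ha] at hT
        have h2 : r * (n / r * -Real.log μ) ≤ r * (T * a) := by gcongr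
        have h3 : r * (n / r * -Real.log μ) = -(n * Real.log μ) := by field_simp
        linarith
    _ = μ ^ n := by rw [Real.exp_nat_mul, Real.exp_log hμ]

/-- The forecast is close to the optimum when the Lyapunov function is small. -/
lemma distToOpt_forecast_le {l u η : ℝ} {m : Measure ℝ} {f : ℝ → ℝ} (h : IHRCdf l u η (cdf m) f)
    (hlu : l < u) (hη : 0 < η) {β : Fin 2 → ℝ} {w r e : ℝ} (hβ : β 1 < 0)
    (hprice : |linPrice β - optPrice m| ≤ 3 * w)
    (hquant : |β 0 / 2 - optQuantity m| ≤ r * w) (hw : 0 < w) (hr : 0 < r) (he : |e| ≤ w)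
    {φ : (Fin 2 → ℝ) → ℝ → ℝ × ℝ}
    (hφ : φ ∈ ({modelForecast, demandForecast m} : Set ((Fin 2 → ℝ) → ℝ → ℝ × ℝ))) :
    distToOpt m (φ β e) ≤ (3 + r + 4 * IHRCdf.densityBound l u η) * w := by
  have hM := IHRCdf.densityBound_pos hlu hη
  refine (distToOpt_le _ _).trans ?_
  rcases hφ with rfl | hφ
  · have h1 : β 0 + β 1 * linPrice β = β 0 / 2 := by
      unfold linPrice
      have := hβ.ne
      field_simp
      ring
    simp only [modelForecast, h1]
    have : 0 ≤ 4 * IHRCdf.densityBound l u η * w := by positivity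
    linarith
  · rw [Set.mem_singleton_iff] at hφ
    subst hφ
    simp only [demandForecast, optQuantity]
    -- The noise in the next price is at most `w`, so the true mean quantity there is within a
    -- Lipschitz multiple of `4 * w` of the optimal one.
    have h1 := h.lipschitz hlu hη (optPrice m) (linPrice β + e)
    change _ ≤ IHRCdf.densityBound l u η * _ at h1
    have h2 : |optPrice m - (linPrice β + e)| ≤ 4 * w := by
      rw [show optPrice m - (linPrice β + e) = (optPrice m - linPrice β) + -e by ring]
      refine (abs_add_le _ _).trans ?_
      rw [abs_neg, abs_sub_comm]
      linarith
    have h3 : IHRCdf.densityBound l u η * |optPrice m - (linPrice β + e)|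
        ≤ IHRCdf.densityBound l u η * (4 * w) := by gcongr
    rw [show 1 - cdf m (linPrice β + e) - (1 - cdf m (optPrice m))
      = cdf m (optPrice m) - cdf m (linPrice β + e) by ring]
    have : 0 ≤ r * w := by positivity
    linarith

/-- The exponent of the tail bound for a suitable choice of the parameters. -/
lemma tail_exponent_le {a k₁ μ C₁ S cε κ r e V₀ g : ℝ} (ha : 0 < a) (hk₁ : 0 < k₁)
    (hμ : 0 < μ) (hcε : 0 < cε) (hr : 0 < r)
    (hk : k₁ * (C₁ * S) ^ 2 ≤ κ ^ 2 * r * cε ^ 2 / 4)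
    (he : e ≤ (κ * μ) ^ 2 / 4) (hg : g * V₀ ≤ (κ * μ) ^ 2 / 4) :
    k₁ * μ ^ 6 / a * (g * V₀ + e)
      + (k₁ * μ ^ 6 / a) ^ 2 * (a * (C₁ * (S / (cε * μ ^ 2))) ^ 2 / r)
      - k₁ * μ ^ 6 / a * (κ * μ) ^ 2 ≤ -(k₁ * κ ^ 2 / 4 * μ ^ 8 / a) := by
  have hθ : 0 < k₁ * μ ^ 6 / a := by positivity
  -- The variance term and `θ * (κ * μ) ^ 2` are both of order μ⁸ / a, so a small `k₁` makes the
  -- variance at most a quarter. The initial value and the noise bias take a quarter each, and one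
  -- quarter remains.
  have h1 : (k₁ * μ ^ 6 / a) ^ 2 * (a * (C₁ * (S / (cε * μ ^ 2))) ^ 2 / r)
      = k₁ * μ ^ 6 / a * (μ ^ 2 * (k₁ * (C₁ * S) ^ 2 / (r * cε ^ 2))) := by
    field_simp
  have h2 : k₁ * (C₁ * S) ^ 2 / (r * cε ^ 2) ≤ κ ^ 2 / 4 := by
    rw [div_le_iff₀ (by positivity)]
    linarith
  have h3 : k₁ * μ ^ 6 / a * (μ ^ 2 * (k₁ * (C₁ * S) ^ 2 / (r * cε ^ 2)))
      ≤ k₁ * μ ^ 6 / a * (μ ^ 2 * (κ ^ 2 / 4)) := by gcongr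
  have h4 : k₁ * μ ^ 6 / a * (g * V₀ + e) ≤ k₁ * μ ^ 6 / a * ((κ * μ) ^ 2 / 2) := by
    gcongr
    linarith
  have h5 : k₁ * κ ^ 2 / 4 * μ ^ 8 / a = k₁ * μ ^ 6 / a * ((κ * μ) ^ 2 / 4) := by ring
  rw [h1, h5]
  linarith

lemma noiseScale_pos {b₁ b₂ y₂ : ℝ} (hb₁ : 0 < b₁) (hb₂ : 0 < b₂) (hy₂ : 0 < y₂) :
    0 < noiseScale b₁ b₂ y₂ := by
  unfold noiseScale
  positivity

set_option maxHeartbeats 1600000 in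
/-- The exponential bound for the failure probability with explicit dependence on the accuracy. -/
theorem exists_fails_bound (N : ℕ) {l u η : ℝ} (hl : 0 ≤ l) (hlu : l < u) (hη : 0 < η) :
    ∃ pf : ProjectionFacility (lipschitzIHR l u η), ∃ cε > 0, ∃ cτ > 0, ∃ k₂ > 0, ∃ k₃ > 0,
      ∀ μ ∈ Set.Ioc (0 : ℝ) (1 / 2), ∀ a ∈ Set.Ioo (0 : ℝ) (k₃ * μ ^ 6),
        FailsWithProbAtMost pf N (cε * μ ^ 2) a ⌈cτ * (-Real.log μ) / a⌉₊ (fun d => 4 * μ < d)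
          (Real.exp (-(k₂ * μ ^ 8 / a))) := by
  have hM := IHRCdf.densityBound_pos hlu hη
  have hp0 := priceLow_pos hlu hη
  have hq0 := quantityLow_pos hl hlu hη
  have hq1 := quantityLow_le hl hlu hη
  have hc0 := priceGap_pos hl hlu hη
  have hpg := priceLow_add_priceGap_lt hl hlu hη
  have hC0 := driftConst_pos hl hlu hη
  have hu : 0 < u := by linarith
  have hpu : priceLow l u η ≤ u := by
    have := quantityLow_le hl hlu hη
    unfold quantityLow at this
    rw [div_le_iff₀ hu] at this
    linarith
  set b₁ := priceLow l u η / 4 with hb₁d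
  set br := priceLow l u η / 2 with hbrd
  set c := priceGap l u η with hcd
  set b₂ := u - 4 * c with hb₂d
  have hb₁ : 0 < b₁ := by positivity
  have hbr : 0 < br := by positivity
  have hb₂ : 0 < b₂ := by linarith
  have hb₁₂ : b₁ < b₂ := by linarith
  obtain ⟨Ψ⟩ := nonempty_lyapunovConstants (b₁ := b₁) (br := br) (b₂ := b₂) (c := c)
    (q := quantityLow l u η / 2) (κ := 1 / u) (L := u * IHRCdf.densityBound l u η + 1)
    (C := driftConst l u η) (xlo := priceLow l u η) (xhi := u) (yl := quantityLow l u η / 2)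
    (yh := 2) hb₁ (by linarith) (by linarith) hc0 (by linarith) (by positivity) hC0 hp0 hpu
    (by linarith) (by linarith)
  have hK₁ := Ψ.one_le_K₁
  have hK₂ := Ψ.one_le_K₂
  have hE := Ψ.E_nonneg
  have hy₁ := Ψ.y₁_pos
  have hy₂ : 2 < Ψ.y₂ := Ψ.lt_y₂
  have hy₁' := Ψ.y₁_lt
  have hrate := Ψ.rate_pos
  have herr := Ψ.err_pos
  obtain ⟨Φ⟩ : Nonempty (StepConstants b₁ b₂ br c (priceLow l u η) u Ψ.K₁ Ψ.K₂ Ψ.E Ψ.y₁ Ψ.y₂) := by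
    obtain ⟨δ, hδ, C₁, hC₁, C₂, hC₂, hbd⟩ := exists_step_constants (b₁ := b₁) (b₂ := b₂) (br := br)
      (c := c) (xlo := priceLow l u η) (xhi := u) (K₁ := Ψ.K₁) (K₂ := Ψ.K₂) (E := Ψ.E)
      (y₁ := Ψ.y₁) (y₂ := Ψ.y₂) hb₁ hbr hb₁₂ hc0 hp0 (by linarith) (by linarith) hE hy₁
      (by linarith)
    exact ⟨⟨δ, C₁, C₂, hδ, hC₁, hC₂, hbd⟩⟩
  have hδ := Φ.δ_pos
  have hC₁ := Φ.C₁_pos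
  have hC₂ := Φ.C₂_pos
  set S := noiseScale b₁ b₂ Ψ.y₂ with hSd
  have hS : 0 < S := noiseScale_pos hb₁ hb₂ (by linarith)
  set X := b₂ * Ψ.y₂ + u with hXd
  have hX0 : 0 < X := by
    have : 0 < b₂ * Ψ.y₂ := mul_pos hb₂ (by linarith)
    linarith
  set Vm := (Ψ.K₁ + Ψ.K₂ + Ψ.E * (b₂ * Ψ.y₂)) * b₂ ^ 2 + (b₂ * Ψ.y₂ + u) ^ 2 / (b₁ * Ψ.y₁)
    with hVmd
  have hVm : 0 ≤ Vm := by
    have : 0 ≤ Ψ.E * (b₂ * Ψ.y₂) := mul_nonneg hE (mul_nonneg hb₂.le (by linarith))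
    have : 0 ≤ Ψ.K₁ + Ψ.K₂ + Ψ.E * (b₂ * Ψ.y₂) := by linarith
    positivity
  set Kd := 3 + (X + 4) / b₁ + 4 * IHRCdf.densityBound l u η with hKd
  have hKd0 : 0 < Kd := by positivity
  -- A Lyapunov value of at most `(κ * μ) ^ 2` yields a forecast error of at most `Kd * κ * μ = μ`.
  set κ := 1 / Kd with hκd
  have hκ : 0 < κ := by positivity
  -- The bounds serve, in turn: `ε ≤ 1`, the hypotheses of `IHRCdf.driftBounds`, `ε ≤ κ * μ`, and a
  -- stationary error `2 * err * ε / rate` of at most a quarter of `(κ * μ) ^ 2`.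
  set cε := min (min 1 (min (c / 4) (priceLow l u η / 4))) (min κ (κ ^ 2 * Ψ.rate / (8 * Ψ.err)))
    with hcεd
  have hcε : 0 < cε := by positivity
  have hcε1 : cε ≤ 1 := (min_le_left _ _).trans (min_le_left _ _)
  have hcε2 : cε ≤ c / 4 := (min_le_left _ _).trans ((min_le_right _ _).trans (min_le_left _ _))
  have hcε3 : cε ≤ priceLow l u η / 4 :=
    (min_le_left _ _).trans ((min_le_right _ _).trans (min_le_right _ _))
  have hcε4 : cε ≤ κ := (min_le_right _ _).trans (min_le_left _ _)
  have hcε5 : cε * (8 * Ψ.err) ≤ κ ^ 2 * Ψ.rate := by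
    rw [← le_div_iff₀ (by positivity)]
    exact (min_le_right _ _).trans (min_le_right _ _)
  -- Since `μ ≤ 1 / 2`, the extra factor `μ ^ n` in the contraction absorbs the initial value,
  -- whatever its size; waiting longer by a constant multiple of `-log μ / a` suffices.
  obtain ⟨n, hn⟩ : ∃ n : ℕ, (1 / 2 : ℝ) ^ n * (Vm + 1) < κ ^ 2 / 4 := by
    obtain ⟨n, hn⟩ := exists_pow_lt_of_lt_one (show 0 < κ ^ 2 / 4 / (Vm + 1) by positivity)
      (show (1 / 2 : ℝ) < 1 by norm_num)
    exact ⟨n, by rwa [lt_div_iff₀ (by positivity)] at hn⟩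
  -- The first bound keeps the exponent of one step below 1, the second controls the variance term.
  set k₁ := min (cε / (Φ.C₁ * S)) (κ ^ 2 * Ψ.rate * cε ^ 2 / 4 / (Φ.C₁ * S) ^ 2) with hk₁d
  have hk₁ : 0 < k₁ := by positivity
  have hk₁1 : k₁ * (Φ.C₁ * S) ≤ cε := by
    rw [← le_div_iff₀ (by positivity)]; exact min_le_left _ _
  have hk₁2 : k₁ * (Φ.C₁ * S) ^ 2 ≤ κ ^ 2 * Ψ.rate * cε ^ 2 / 4 := by
    rw [← le_div_iff₀ (by positivity)]; exact min_le_right _ _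
  -- The bounds ensure `rate * a ≤ 1`, admissible step sizes, and a second-order remainder below
  -- `err * ε`. The last one needs `a` of order `ε ^ 3`, which is the origin of μ⁶.
  set k₃ := min (1 / Ψ.rate) (min (Φ.δ * cε / S) (Ψ.err * cε ^ 3 / (Φ.C₂ * S ^ 2))) with hk₃d
  have hk₃ : 0 < k₃ := by positivity
  have hk₃1 : Ψ.rate * k₃ ≤ 1 := by
    rw [mul_comm, ← le_div_iff₀ hrate]; exact min_le_left _ _
  have hk₃2 : k₃ * S ≤ Φ.δ * cε := by
    rw [← le_div_iff₀ hS]; exact (min_le_right _ _).trans (min_le_left _ _)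
  have hk₃3 : k₃ * (Φ.C₂ * S ^ 2) ≤ Ψ.err * cε ^ 3 := by
    rw [← le_div_iff₀ (by positivity)]; exact (min_le_right _ _).trans (min_le_right _ _)
  have hKκ : Kd * κ = 1 := by rw [hκd]; field_simp
  clear_value cε k₁ k₃ κ
  refine ⟨boxFacility hl hlu hη hy₁ hy₁' hy₂, cε, hcε, ((n + 2 : ℕ) : ℝ) / Ψ.rate, by positivity,
    k₁ * κ ^ 2 / 4, by positivity, k₃, hk₃, ?_⟩
  rintro μ ⟨hμ, hμ2⟩ a ⟨ha, hak⟩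
  intro β₀ hβ₀ ν hν hmem Ω _ P D hD φ hφ
  obtain ⟨f, hf, hlip⟩ := hmem
  have h := hf.ihrCdf hlip
  have hprob := hf.isProb
  have hPprob := hD.isProb
  set m := aggregate ν with hmd
  have ho : ∀ p, p * (1 - cdf m p) ≤ optPrice m * (1 - cdf m (optPrice m)) :=
    Classical.epsilon_spec (show ∃ b, IsOptimalPrice m b from
      (h.existsUnique_isMax hl hlu hη).exists)
  set o := optPrice m with hod
  set ε := cε * μ ^ 2 with hεd
  have hε : 0 < ε := by positivity
  have hμ1 : μ ≤ 1 := by linarith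
  have hμsq : μ ^ 2 ≤ 1 := pow_le_one₀ hμ.le hμ1
  have hμ62 : μ ^ 6 ≤ μ ^ 2 := pow_le_pow_of_le_one hμ.le hμ1 (by norm_num)
  have hεc : ε ≤ cε := mul_le_of_le_one_right hcε.le hμsq
  have hεw : ε ≤ κ * μ := by
    have : μ ^ 2 ≤ μ := by
      rw [sq]
      exact mul_le_of_le_one_left hμ.le hμ1
    calc ε ≤ κ * μ ^ 2 := by rw [hεd]; gcongr
      _ ≤ κ * μ := by gcongr
  obtain ⟨b₀, hb₀, hdrift⟩ := h.driftBounds ho hl hlu hη hε (by linarith) (by linarith)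
  have hbox : (boxFacility hl hlu hη hy₁ hy₁' hy₂).box = demandBox b₁ b₂ Ψ.y₁ Ψ.y₂ := rfl
  have hreset : (boxFacility hl hlu hη hy₁ hy₁' hy₂).reset = ![2, -(1 / br)] := rfl
  set pf := boxFacility hl hlu hη hy₁ hy₁' hy₂ with hpf
  have hβ₀' : β₀ ∈ pf.box := interior_subset (pf.core_subset hβ₀)
  have hbounds : ∀ β ∈ pf.box, β 1 < 0 ∧ b₁ ≤ linPrice β ∧ linPrice β ≤ b₂ ∧
      Ψ.y₁ ≤ β 0 / 2 ∧ β 0 / 2 ≤ Ψ.y₂ := by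
    intro β hβ
    rw [hbox] at hβ
    have hs := demandBox_sign hb₂ hy₁ hβ
    obtain ⟨⟨g1, g2⟩, g3, g4⟩ := (mem_demandBox_iff hs.2).1 hβ
    exact ⟨hs.2, g1, g2, g3, g4⟩
  have hak3 : a ≤ k₃ := hak.le.trans (mul_le_of_le_one_right hk₃.le (hμ62.trans hμsq))
  have hx₀0 : 0 < o * (1 - cdf m o) := by linarith [hdrift.xlo_le]
  have hV₀ : betaLyap Ψ.K₁ Ψ.K₂ Ψ.E c b₀ (o * (1 - cdf m o)) β₀ ≤ Vm := by
    obtain ⟨_, g1, g2, g3, g4⟩ := hbounds β₀ hβ₀'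
    refine lyap_le (by linarith) (by linarith) hE hc0.le (by linarith) g2
      (by linarith [hdrift.br_le]) (by linarith [hdrift.le_right]) (by positivity)
      (mul_le_mul g1 g3 hy₁.le (by linarith)) (mul_le_mul g2 g4 (by linarith) hb₂.le) hx₀0
      hdrift.le_xhi
  have hV₀0 : 0 ≤ betaLyap Ψ.K₁ Ψ.K₂ Ψ.E c b₀ (o * (1 - cdf m o)) β₀ := by
    obtain ⟨_, g1, g2, g3, g4⟩ := hbounds β₀ hβ₀'
    exact lyap_nonneg (by linarith) (by linarith) hE hx₀0
      (mul_pos (by linarith) (by linarith))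
  set T := ⌈((n + 2 : ℕ) : ℝ) / Ψ.rate * (-Real.log μ) / a⌉₊ with hTd
  have har : Ψ.rate * a ≤ 1 := (mul_le_mul_of_nonneg_left hak3 hrate.le).trans hk₃1
  have haδ : a * (S / ε) ≤ Φ.δ := by
    rw [← mul_div_assoc, div_le_iff₀ hε, hεd]
    calc a * S ≤ k₃ * μ ^ 6 * S := by gcongr
      _ ≤ k₃ * μ ^ 2 * S := by gcongr
      _ = k₃ * S * μ ^ 2 := by ring
      _ ≤ Φ.δ * cε * μ ^ 2 := by gcongr
      _ = _ := by ring
  have haC : Φ.C₂ * (a * (S / ε) ^ 2) ≤ Ψ.err * ε := by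
    have e1 : Φ.C₂ * (a * (S / ε) ^ 2) = a * (Φ.C₂ * S ^ 2) / ε ^ 2 := by ring
    rw [e1, div_le_iff₀ (by positivity)]
    calc a * (Φ.C₂ * S ^ 2) ≤ k₃ * μ ^ 6 * (Φ.C₂ * S ^ 2) := by gcongr
      _ = k₃ * (Φ.C₂ * S ^ 2) * μ ^ 6 := by ring
      _ ≤ Ψ.err * cε ^ 3 * μ ^ 6 := by gcongr
      _ = _ := by rw [hεd]; ring
  have hθ1 : k₁ * μ ^ 6 / a * (a * (Φ.C₁ * (S / ε))) ≤ 1 := by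
    have e1 : k₁ * μ ^ 6 / a * (a * (Φ.C₁ * (S / ε))) = k₁ * (Φ.C₁ * S) * μ ^ 6 / ε := by
      field_simp
    rw [e1, div_le_one hε, hεd]
    gcongr
  have htail := measure_betaLyap_estimate_gt_le Ψ Φ hb₁ hb₂ hbr hbox hreset hν
    hf.absolutelyContinuous (h.continuous hlu hη) hε (hεc.trans hcε1) hdrift ha haδ haC har hβ₀'
    hD T (θ := k₁ * μ ^ 6 / a) (v := (κ * μ) ^ 2) (by positivity) hθ1
  have hpow : (1 - Ψ.rate * a) ^ T * betaLyap Ψ.K₁ Ψ.K₂ Ψ.E c b₀ (o * (1 - cdf m o)) β₀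
      ≤ (κ * μ) ^ 2 / 4 := by
    have e1 : (1 - Ψ.rate * a) ^ T ≤ μ ^ (n + 2) :=
      one_sub_pow_le_pow hrate ha har hμ (Nat.le_ceil _)
    have e2 : μ ^ (n + 2) ≤ (1 / 2) ^ n * μ ^ 2 := by
      rw [pow_add]
      gcongr
    calc _ ≤ (1 / 2) ^ n * μ ^ 2 * (Vm + 1) :=
          mul_le_mul (e1.trans e2) (by linarith) hV₀0 (by positivity)
      _ = (1 / 2) ^ n * (Vm + 1) * μ ^ 2 := by ring
      _ ≤ κ ^ 2 / 4 * μ ^ 2 := by gcongr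
      _ = _ := by ring
  have herrε : 2 * Ψ.err * ε / Ψ.rate ≤ (κ * μ) ^ 2 / 4 := by
    rw [div_le_iff₀ hrate, hεd]
    have : cε * (8 * Ψ.err) * μ ^ 2 ≤ κ ^ 2 * Ψ.rate * μ ^ 2 := by gcongr
    linarith
  have hexp := htail.trans (Real.exp_le_exp.2
    (tail_exponent_le (S := S) ha hk₁ hμ hcε hrate hk₁2 herrε hpow))
  refine le_trans ?_ hexp
  -- The second forecast uses the noise of the next period, which is bounded only almost surely; the
  -- events are compared modulo a null set.
  have hnoise : ∀ᵐ ω ∂P, |(D T ω).1| ≤ ε := by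
    have := isProbabilityMeasure_noiseLaw hε
    have e1 : ∀ᵐ z ∂(P.map (D T)), |z.1| ≤ ε := by
      rw [hD.law T]
      exact Measure.quasiMeasurePreserving_fst.ae ae_noiseLaw
    exact ae_of_ae_map (hD.meas T).aemeasurable e1
  apply ENNReal.toReal_mono (measure_ne_top _ _)
  apply measure_mono_ae
  filter_upwards [hnoise] with ω hω hbad
  change _ < _
  by_contra hcon
  rw [not_lt] at hcon
  have hbad' : 4 * μ < distToOpt m (φ (estimate pf ε a β₀ (fun t => D t ω) T) (D T ω).1) := hbad
  set β := estimate pf ε a β₀ (fun t => D t ω) T with hβd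
  obtain ⟨hβneg, g1, g2, g3, g4⟩ := hbounds β (estimate_mem_box pf ε a hβ₀' _ T)
  have hw : 0 < κ * μ := by positivity
  have ho0 : 0 < o := h.opt_pos ho hl hlu hη
  have hq : quantityLow l u η ≤ 1 - cdf m o := h.opt_quantity_ge ho hl hlu hη
  have hclose := abs_sub_opt_le (K₁ := Ψ.K₁) (K₂ := Ψ.K₂) (E := Ψ.E) (c := c) (b₀ := b₀)
    (b := linPrice β) (y := β 0 / 2) (o := o) (p := 1 - cdf m o) (w := κ * μ) (ε := ε) (b₁ := b₁)
    (X := X) hK₁ hK₂ hE hb₁ g1 (by linarith) ho0 (by linarith) (by linarith [h.nonneg o])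
    (by
      have := mul_le_mul g2 g4 (by linarith) hb₂.le
      linarith)
    (by
      have := mul_pos hb₂ (by linarith : 0 < Ψ.y₂)
      linarith [hdrift.le_xhi])
    hb₀ hεw hcon hw
  have hdist := distToOpt_forecast_le h hlu hη hβneg hclose.1 hclose.2 hw (by positivity)
    (hω.trans hεw) hφ
  have e1 : Kd * (κ * μ) = μ := by rw [← mul_assoc, hKκ, one_mul]
  have e2 : distToOpt m (φ β (D T ω).1) ≤ μ := by
    rw [← e1]; exact hdist
  linarith

/-- The failure bound is monotone in the event and in the probability. -/
lemma FailsWithProbAtMost.mono {𝓕 : Set (Measure ℝ)} {pf : ProjectionFacility 𝓕} {N : ℕ}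
    {ε a : ℝ} {T : ℕ} {bad bad' : ℝ → Prop} {δ δ' : ℝ} (h : FailsWithProbAtMost pf N ε a T bad δ)
    (hbad : ∀ d, bad' d → bad d) (hδ : δ ≤ δ') : FailsWithProbAtMost pf N ε a T bad' δ' := by
  intro β₀ hβ₀ ν hν hmem Ω _ P D hD φ hφ
  have := hD.isProb
  exact (measureReal_mono fun ω hω => hbad _ hω).trans
    ((h β₀ hβ₀ ν hν hmem Ω P D hD φ hφ).trans hδ)

/-- The stopping time of the uniform learning bound is polynomial in the accuracy. -/
lemma stopping_time_le {cτ k₂ k₃ μ r : ℝ} (hcτ : 0 < cτ) (hk₂ : 0 < k₂) (hk₃ : 0 < k₃)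
    (hμ : μ ∈ Set.Ioc (0 : ℝ) 1) (hr : r ∈ Set.Ioc (0 : ℝ) (1 / 2)) :
    (⌈cτ * (-Real.log (μ / 8)) / min (min 1 (k₃ * (μ / 8) ^ 6) / 2)
        (k₂ * (μ / 8) ^ 8 / -Real.log r)⌉₊ : ℝ)
      ≤ (cτ * 8 * (2 * (2 + 2 * 8 ^ 6 / k₃) + 8 ^ 8 / k₂) + 2) * (-Real.log r / μ ^ 9) := by
  obtain ⟨hμ0, hμ1⟩ := hμ
  obtain ⟨hr0, hr1⟩ := hr
  -- `-log r ≥ log 2` turns additive constants into multiples of `-log r`.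
  have hR : 1 / 2 ≤ -Real.log r := by
    have h1 : Real.log r ≤ Real.log (1 / 2) := Real.log_le_log hr0 hr1
    have h2 := Real.log_two_gt_d9
    rw [one_div, Real.log_inv] at h1
    linarith
  set R := -Real.log r
  have hR0 : 0 < R := by linarith
  -- The logarithm costs one power of `1 / μ`; together with the eight from the gain this gives the
  -- exponent 9.
  have hL : -Real.log (μ / 8) ≤ 8 / μ := by
    rw [← Real.log_inv, inv_div]
    exact (Real.log_le_sub_one_of_pos (by positivity)).trans (by linarith)
  have hL0 : 0 ≤ -Real.log (μ / 8) := by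
    have := Real.log_nonpos (x := μ / 8) (by positivity) (by linarith)
    linarith
  set L := -Real.log (μ / 8)
  set A := min 1 (k₃ * (μ / 8) ^ 6) / 2 with hA
  set B := k₂ * (μ / 8) ^ 8 / R with hB
  have hA0 : 0 < A := by positivity
  have hB0 : 0 < B := by positivity
  have hpow : ∀ n ≤ 8, 1 ≤ μ ^ n / μ ^ 8 := fun n hn => by
    rw [le_div_iff₀ (by positivity), one_mul]
    exact pow_le_pow_of_le_one hμ0.le hμ1 hn
  have hAi : 1 / A ≤ (2 + 2 * 8 ^ 6 / k₃) / μ ^ 8 := by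
    rw [div_le_div_iff₀ hA0 (by positivity), one_mul, hA]
    rcases le_total 1 (k₃ * (μ / 8) ^ 6) with hc | hc
    · rw [min_eq_left hc]
      have : μ ^ 8 ≤ 1 := pow_le_one₀ hμ0.le hμ1
      have : 0 ≤ 2 * 8 ^ 6 / k₃ := by positivity
      linarith
    · rw [min_eq_right hc]
      have e : (2 + 2 * 8 ^ 6 / k₃) * (k₃ * (μ / 8) ^ 6 / 2) = k₃ * (μ / 8) ^ 6 + μ ^ 6 := by
        field_simp
      rw [e]
      have : μ ^ 8 ≤ μ ^ 6 := pow_le_pow_of_le_one hμ0.le hμ1 (by norm_num)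
      have : 0 ≤ k₃ * (μ / 8) ^ 6 := by positivity
      linarith
  have hBi : 1 / B = 8 ^ 8 / k₂ * (R / μ ^ 8) := by
    rw [hB]
    field_simp
  have hmin : 1 / min A B ≤ 1 / A + 1 / B := by
    rcases le_total A B with hc | hc
    · rw [min_eq_left hc]
      have : 0 < 1 / B := by positivity
      linarith
    · rw [min_eq_right hc]
      have : 0 < 1 / A := by positivity
      linarith
  have hmin' : 1 / min A B ≤ (2 * (2 + 2 * 8 ^ 6 / k₃) + 8 ^ 8 / k₂) * (R / μ ^ 8) := by
    have e : (2 + 2 * 8 ^ 6 / k₃) / μ ^ 8 * 1 ≤ (2 + 2 * 8 ^ 6 / k₃) / μ ^ 8 * (2 * R) := by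
      gcongr
      linarith
    have e2 : (2 * (2 + 2 * 8 ^ 6 / k₃) + 8 ^ 8 / k₂) * (R / μ ^ 8)
        = (2 + 2 * 8 ^ 6 / k₃) / μ ^ 8 * (2 * R) + 8 ^ 8 / k₂ * (R / μ ^ 8) := by ring
    linarith
  have hone : (1 : ℝ) ≤ 2 * (R / μ ^ 9) := by
    rw [← mul_div_assoc, le_div_iff₀ (by positivity)]
    have : μ ^ 9 ≤ 1 := pow_le_one₀ hμ0.le hμ1
    linarith
  have hmain : cτ * L / min A B
      ≤ cτ * 8 * (2 * (2 + 2 * 8 ^ 6 / k₃) + 8 ^ 8 / k₂) * (R / μ ^ 9) := by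
    calc cτ * L / min A B = cτ * L * (1 / min A B) := by ring
      _ ≤ cτ * (8 / μ) * ((2 * (2 + 2 * 8 ^ 6 / k₃) + 8 ^ 8 / k₂) * (R / μ ^ 8)) := by
          have : 0 < min A B := lt_min hA0 hB0
          gcongr
      _ = _ := by
          field_simp
  have hnn : 0 ≤ cτ * L / min A B :=
    div_nonneg (mul_nonneg hcτ.le hL0) (lt_min hA0 hB0).le
  have := Nat.ceil_lt_add_one hnn
  linarith

end MonopolyLearning

end

/-! ### Deduction of both claims from the exponential bound -/

theorem mainTheorem1 (N : ℕ) (hN : 0 < N) (l u η : ℝ) (hl : 0 ≤ l) (hlu : l < u) (hη : 0 < η) :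
    (∀ m ∈ MonopolyLearning.lipschitzIHR l u η,
      ∃! b, MonopolyLearning.IsOptimalPrice m b) ∧
    ∃ pf : MonopolyLearning.ProjectionFacility (MonopolyLearning.lipschitzIHR l u η),
      (∃ ε τ ρ abar : ℝ → ℝ,
        (∀ μ > 0, 0 < ε μ ∧ 0 < τ μ ∧ 0 < ρ μ ∧ 0 < abar μ ∧
          ∀ a ∈ Set.Ioo 0 (abar μ),
            MonopolyLearning.FailsWithProbAtMost pf N (ε μ) a ⌈τ μ / a⌉₊ (fun d => 4 * μ < d)
              (Real.exp (-(ρ μ * (⌈τ μ / a⌉₊ : ℝ))))) ∧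
        τ =Θ[𝓝[>] 0] (fun μ => -Real.log μ) ∧
        abar =O[𝓝[>] 0] (fun μ => -(μ / Real.log μ))) ∧
      MonopolyLearning.UniformlyLearns pf N := by
  refine ⟨fun m ⟨f, hf, hlip⟩ => (hf.ihrCdf hlip).existsUnique_isMax hl hlu hη, ?_⟩
  obtain ⟨pf, cε, hcε, cτ, hcτ, k₂, hk₂, k₃, hk₃, H⟩ :=
    MonopolyLearning.exists_fails_bound N hl hlu hη
  have hlog : ∀ x ∈ Set.Ioc (0 : ℝ) (1 / 2), 0 < -Real.log x := fun x hx =>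
    neg_pos.2 (Real.log_neg hx.1 (by linarith [hx.2]))
  have hev : ∀ᶠ μ in 𝓝[>] (0 : ℝ), μ ∈ Set.Ioc (0 : ℝ) (1 / 2) :=
    Ioc_mem_nhdsGT (by norm_num)
  -- The exponential bound needs accuracy at most `1 / 2`; larger `μ` use the parameters for `1 /
  -- 2`, whose failure event is larger.
  refine ⟨pf, ⟨fun μ => cε * min μ (1 / 2) ^ 2, fun μ => cτ * -Real.log (min μ (1 / 2)),
    fun μ => k₂ * min μ (1 / 2) ^ 8 / (cτ * -Real.log (min μ (1 / 2)) + 1),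
    fun μ => min 1 (k₃ * min μ (1 / 2) ^ 6), fun μ hμ => ?_, ?_, ?_⟩, ?_⟩
  · have hμ' : min μ (1 / 2) ∈ Set.Ioc (0 : ℝ) (1 / 2) := ⟨by positivity, min_le_right _ _⟩
    have hle : min μ (1 / 2) ≤ μ := min_le_left _ _
    beta_reduce
    generalize min μ (1 / 2) = ν at *
    have hν := hμ'.1
    have hτ : 0 < cτ * -Real.log ν := mul_pos hcτ (hlog ν hμ')
    refine ⟨by positivity, hτ, by positivity, by positivity, fun a ha => ?_⟩
    have ha0 : 0 < a := ha.1
    have ha1 : a ≤ 1 := ha.2.le.trans (min_le_left _ _)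
    refine (H ν hμ' a ⟨ha0, ha.2.trans_le (min_le_right _ _)⟩).mono
      (fun d hd => lt_of_le_of_lt (by linarith) hd) (Real.exp_le_exp.2 (neg_le_neg ?_))
    -- The bound 1 on the gain turns the rounding of the stopping time into one extra `1 / a`. This
    -- is the `+ 1` in the denominator of `ρ`.
    have hT : (⌈cτ * -Real.log ν / a⌉₊ : ℝ) ≤ (cτ * -Real.log ν + 1) / a := by
      refine (Nat.ceil_lt_add_one (by positivity)).le.trans ?_
      rw [add_div]
      have : 1 ≤ 1 / a := by rwa [le_div_iff₀ ha0, one_mul]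
      linarith
    calc _ ≤ k₂ * ν ^ 8 / (cτ * -Real.log ν + 1) * ((cτ * -Real.log ν + 1) / a) := by gcongr
      _ = k₂ * ν ^ 8 / a := div_mul_div_cancel₀ (by positivity)
  · refine IsTheta.trans (EventuallyEq.isTheta (g := fun μ => cτ * -Real.log μ) ?_)
      ((isTheta_refl _ _).const_mul_left hcτ.ne')
    filter_upwards [hev] with μ hμ
    rw [min_eq_left hμ.2]
  · refine IsBigO.of_bound k₃ ?_
    filter_upwards [hev] with μ hμ
    have hL := hlog μ hμ
    have hμ0 := hμ.1
    rw [min_eq_left hμ.2, Real.norm_of_nonneg (by positivity), ← div_neg,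
      Real.norm_of_nonneg (by positivity)]
    refine (min_le_right _ _).trans ?_
    gcongr
    -- The admissible gain is of order μ⁶, well below `μ / -log μ`.
    have h1 : -Real.log μ ≤ 1 / μ := by
      rw [← Real.log_inv, one_div]
      exact (Real.log_le_sub_one_of_pos (by positivity)).trans (by linarith)
    have h2 : μ ^ 6 ≤ μ ^ 2 :=
      pow_le_pow_of_le_one hμ0.le (by linarith [hμ.2]) (by norm_num)
    refine h2.trans ?_
    rw [le_div_iff₀ hL]
    calc μ ^ 2 * -Real.log μ ≤ μ ^ 2 * (1 / μ) := by gcongr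
      _ = μ := by field_simp
  -- Accuracy `μ / 8` turns the threshold `4 * μ` into `μ / 2`, so that the non-strict event is
  -- covered. Halving the first bound on the gain keeps it strictly admissible, and the second bound
  -- makes the failure probability at most `r`.
  · refine ⟨fun μ => cε * min (μ / 8) (1 / 2) ^ 2,
      fun μ r => min (min 1 (k₃ * min (μ / 8) (1 / 2) ^ 6) / 2)
        (k₂ * min (μ / 8) (1 / 2) ^ 8 / -Real.log r),
      fun μ r => ⌈cτ * -Real.log (min (μ / 8) (1 / 2)) /
        min (min 1 (k₃ * min (μ / 8) (1 / 2) ^ 6) / 2)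
          (k₂ * min (μ / 8) (1 / 2) ^ 8 / -Real.log r)⌉₊,
      fun μ hμ => ?_, 9, by norm_num,
      cτ * 8 * (2 * (2 + 2 * 8 ^ 6 / k₃) + 8 ^ 8 / k₂) + 2, fun μ hμ r hr => ?_⟩
    · have hμ' : min (μ / 8) (1 / 2) ∈ Set.Ioc (0 : ℝ) (1 / 2) :=
        ⟨by positivity, min_le_right _ _⟩
      have hle : min (μ / 8) (1 / 2) ≤ μ / 8 := min_le_left _ _
      beta_reduce
      generalize min (μ / 8) (1 / 2) = ν at *
      have hν := hμ'.1
      refine ⟨by positivity, fun r hr => ?_⟩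
      have hR : 0 < -Real.log r := neg_pos.2 (Real.log_neg hr.1 hr.2)
      have hA : 0 < min 1 (k₃ * ν ^ 6) := by positivity
      have ha1 : min (min 1 (k₃ * ν ^ 6) / 2) (k₂ * ν ^ 8 / -Real.log r)
          < k₃ * ν ^ 6 :=
        (min_le_left _ _).trans_lt ((half_lt_self hA).trans_le (min_le_right _ _))
      have ha2 : min (min 1 (k₃ * ν ^ 6) / 2) (k₂ * ν ^ 8 / -Real.log r)
          ≤ k₂ * ν ^ 8 / -Real.log r := min_le_right _ _
      have ha0 : 0 < min (min 1 (k₃ * ν ^ 6) / 2) (k₂ * ν ^ 8 / -Real.log r) := by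
        positivity
      generalize min (min 1 (k₃ * ν ^ 6) / 2) (k₂ * ν ^ 8 / -Real.log r) = a at *
      refine ⟨ha0, (H ν hμ' a ⟨ha0, ha1⟩).mono (fun d hd => lt_of_lt_of_le (by linarith) hd) ?_⟩
      rw [← Real.le_log_iff_exp_le hr.1, neg_le, le_div_iff₀ ha0, mul_comm]
      exact (le_div_iff₀ hR).1 ha2
    · have e : min (μ / 8) (1 / 2 : ℝ) = μ / 8 := min_eq_left (by linarith [hμ.2])
      have e9 : μ ^ (9 : ℝ) = μ ^ 9 := by exact_mod_cast Real.rpow_natCast μ 9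
      beta_reduce
      rw [e, e9]
      exact MonopolyLearning.stopping_time_le hcτ hk₂ hk₃ hμ hr
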